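/- Let $H$ be a Lie group (smooth, finite-dimensional, real) with Lie algebra $\mathfrak h$, and let $(H,G)$ be a symmetric pair with involution $\sigma$: $\sigma\neq\mathrm{id}$ is a smooth automorphism of $H$ with $\sigma^2=\mathrm{id}$, and $G\subseteq H$ is a closed subgroup with $(H^\sigma)_0\subseteq G\subseteq H^\sigma$. Put $s=d\sigma_e$ and let $\mathfrak h=\mathfrak g\oplus\mathfrak p$ be the decomposition into the $+1$ and $-1$ eigenspaces of $s$ (so $\mathfrak g$ is the Lie algebra of $G$). Assume that $(H,G)$ is Legendrian, with Legendrian form $\Lambda$: a nondegenerate symmetric bilinear form on $\mathfrak h$ with $\Lambda(s\zeta_1,\zeta_2)=-\Lambda(\zeta_1,s\zeta_2)$, $\Lambda([\zeta_1,\zeta_2],\zeta_3)=-\Lambda(\zeta_2,[\zeta_1,\zeta_3])$ and $\Lambda(\mathrm{Ad}_h\zeta_1,\zeta_2)=\Lambda(\zeta_1,\mathrm{Ad}_{h^{-1}}\zeta_2)$ for all $\zeta_i\in\mathfrak h$, $h\in H$. Let $\theta$ be the left-invariant Maurer–Cartan form of $H$ and $\pi=\frac{1-s}{2}\theta$ its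 $\mathfrak p$-part. For $\xi\in\mathfrak g$ define $$\beta(\xi)_h=\Lambda(\xi,\mathrm{Ad}_h\pi)\in\Omega^1(H),\qquad \Upsilon=\tfrac13\Lambda(\pi,[\pi,\pi])\in\Omega^3(H),$$ where $\Lambda(\pi,[\pi,\pi])$ is the skew-symmetrization, $\Lambda(\pi,[\pi,\pi])(v_1,v_2,v_3)=\sum_{\varepsilon\in S_3}\mathrm{sgn}(\varepsilon)\,\Lambda(\pi v_{\varepsilon(1)},[\pi v_{\varepsilon(2)},\pi v_{\varepsilon(3)}])$. Then: 1. The coset space $P=H/G$, with the quotient topology, carries a smooth manifold structure of dimension $\dim\mathfrak p$ for which the quotient map $j:H\to P$ is a smooth submersion. In what follows $P$ carries any smooth manifold structure for which $j$ is a smooth submersion. 2. For $\xi\in\mathfrak g$ the form $\beta(\xi)$ is smooth and basic for the right action of $G$ on $H$, and $\beta(\mathrm{Ad}_g\xi)=L_{g^{-1}}^*\beta(\xi)$ for $g\in G$. The form $\Upsilon$ is smooth, basic for the right action of $G$, and invariant under left multiplication by elements of $G$. 3. There are unique smooth forms $\tau(\xi)\in\Omega^1(P)$ ($\xi\in\mathfrak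 g$) and $\Xi\in\Omega^3(P)$ with $j^*\tau(\xi)=\beta(\xi)$ and $j^*\Xi=\Upsilon$. The left action on $P$ is smooth, $\tau$ is linear in $\xi$, and $\Xi+\tau$ is a $G$-equivariant three-form on $P$: $g^*\Xi=\Xi$ and $\tau(\mathrm{Ad}_g\xi)=(g^{-1})^*\tau(\xi)$ for all $g\in G$ and $\xi\in\mathfrak g$. 4. $\Xi+\tau$ is equivariantly closed: for all $\xi\in\mathfrak g$, $$d\Xi=0,\qquad \iota_\xi\Xi=d\tau(\xi),\qquad \iota_\xi\tau(\xi)=0,$$ where $\iota_\xi$ is the interior product with the fundamental vector field $\xi_P(p)=\frac{d}{dt}\big|_{t=0}\exp(t\xi)\cdot p$. Hence $(H/G,\ \Xi+\tau)$ is a premoment space for $G$, that is, a $G$-manifold together with an equivariantly closed $G$-equivariant three-form. -/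

import Mathlib

open scoped Manifold ContDiff

/-! Differential forms on a (boundaryless, finite-dimensional) smooth manifold `M` modelled on `E`. -/

section Forms

variable {E : Type*} [NormedAddCommGroup E] [NormedSpace ℝ E]
  {M : Type*} [TopologicalSpace M] [ChartedSpace E M]
  {F : Type*} [NormedAddCommGroup F] [NormedSpace ℝ F]
  {N : Type*} [TopologicalSpace N] [ChartedSpace F N]

variable (E M) in
/-- Real differential `k`-forms on `M`, as pointwise families of alternating forms on the tangent
spaces; smoothness is the separate predicate `DiffForm.IsSmooth`. -/
abbrev DiffForm (k : ℕ) : Type _ :=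
  ∀ p : M, (TangentSpace 𝓘(ℝ, E) p) [⋀^Fin k]→L[ℝ] ℝ

namespace DiffForm

/-- The expression of a form in the preferred chart `φ` around `p`, i.e. the pullback of the form
under `φ⁻¹`, as a form on the model space `E` (meaningful on the target of `φ`). -/
noncomputable def inChart {k : ℕ} (α : DiffForm E M k) (p : M) (y : E) : E [⋀^Fin k]→L[ℝ] ℝ :=
  (α ((extChartAt 𝓘(ℝ, E) p).symm y)).compContinuousLinearMap
    (mfderiv 𝓘(ℝ, E) 𝓘(ℝ, E) (extChartAt 𝓘(ℝ, E) p).symm y)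

/-- A form is smooth if all its expressions in charts are `C^∞`. -/
def IsSmooth {k : ℕ} (α : DiffForm E M k) : Prop :=
  ∀ p : M, ContDiffOn ℝ ∞ (α.inChart p) (extChartAt 𝓘(ℝ, E) p).target

/-- The exterior derivative, computed at `p` in the preferred chart around `p`. The normalization is
`dα(X, Y) = X (α Y) - Y (α X) - α [X, Y]` for one-forms. -/
noncomputable def d {k : ℕ} (α : DiffForm E M k) : DiffForm E M (k + 1) := fun p =>
  (extDeriv (α.inChart p) (extChartAt 𝓘(ℝ, E) p p)).compContinuousLinearMap
    (mfderiv 𝓘(ℝ, E) 𝓘(ℝ, E) (extChartAt 𝓘(ℝ, E) p) p)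

/-- The pullback `f^* α`. -/
noncomputable def pullback {k : ℕ} (f : M → N) (α : DiffForm F N k) : DiffForm E M k := fun p =>
  (α (f p)).compContinuousLinearMap (mfderiv 𝓘(ℝ, E) 𝓘(ℝ, F) f p)

/-- The interior product `ι_X α = α(X, ·, …, ·)` with a vector field `X`. -/
noncomputable def contract {k : ℕ} (X : ∀ p : M, TangentSpace 𝓘(ℝ, E) p)
    (α : DiffForm E M (k + 1)) : DiffForm E M k := fun p =>
  ContinuousAlternatingMap.curryLeft (E := E) (α p) (X p)

end DiffForm

end Forms

section LieGroups

variable {E : Type*} [NormedAddCommGroup E] [NormedSpace ℝ E]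
  {H : Type*} [TopologicalSpace H] [ChartedSpace E H] [Group H]

instance lieGroupMinSmoothness [LieGroup 𝓘(ℝ, E) ∞ H] :
    LieGroup 𝓘(ℝ, E) (minSmoothness ℝ 3) H := by
  rw [minSmoothness_of_isRCLikeNormedField]
  infer_instance

/-- The adjoint representation `Ad_h`, the differential at `1` of `k ↦ h k h⁻¹`. -/
noncomputable def Ad (h : H) : GroupLieAlgebra 𝓘(ℝ, E) H →L[ℝ] GroupLieAlgebra 𝓘(ℝ, E) H :=
  mfderiv 𝓘(ℝ, E) 𝓘(ℝ, E) (fun k : H => h * k * h⁻¹) 1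

/-- The left-invariant Maurer–Cartan form `θ_h = (L_{h⁻¹})_* : T_h H → T_1 H`. -/
noncomputable def maurerCartan (h : H) :
    TangentSpace 𝓘(ℝ, E) h →L[ℝ] GroupLieAlgebra 𝓘(ℝ, E) H :=
  mfderiv 𝓘(ℝ, E) 𝓘(ℝ, E) (fun k : H => h⁻¹ * k) h

/-- The fundamental vector field of an action of `H`: the value at `p` is the velocity at time `0` of
`exp(tξ) • p`, that is, the image of `ξ` under the differential at `1` of the orbit map
`h ↦ h • p`. -/
noncomputable def fundamentalField {F : Type*} [NormedAddCommGroup F] [NormedSpace ℝ F]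
    {P : Type*} [TopologicalSpace P] [ChartedSpace F P] [MulAction H P]
    (ξ : GroupLieAlgebra 𝓘(ℝ, E) H) (p : P) : TangentSpace 𝓘(ℝ, F) p :=
  (mfderiv 𝓘(ℝ, E) 𝓘(ℝ, F) (fun h : H => h • p) 1 :
    GroupLieAlgebra 𝓘(ℝ, E) H →L[ℝ] TangentSpace 𝓘(ℝ, F) p) ξ

variable (E) in
/-- `(H, G)` is a symmetric pair with involution `σ`: `σ` is an involutive automorphism of the Lie
group `H`, different from the identity, `G` is closed, and `(H^σ)₀ ⊆ G ⊆ H^σ`. -/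
structure IsSymmetricPair (σ : H ≃* H) (G : Subgroup H) : Prop where
  smooth : ContMDiff 𝓘(ℝ, E) 𝓘(ℝ, E) ∞ σ
  involutive : ∀ h, σ (σ h) = h
  ne_id : σ ≠ MulEquiv.refl H
  isClosed : IsClosed (G : Set H)
  le_fixed : ∀ g ∈ G, σ g = g
  component_le : connectedComponentIn {h : H | σ h = h} 1 ⊆ G

/-- The differential `s = dσ_e` on the Lie algebra `𝔥` of `H` (recall `σ 1 = 1`). -/
noncomputable def dInvolution (σ : H ≃* H) :
    GroupLieAlgebra 𝓘(ℝ, E) H →L[ℝ] GroupLieAlgebra 𝓘(ℝ, E) H :=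
  mfderiv 𝓘(ℝ, E) 𝓘(ℝ, E) σ 1

variable (E) in
/-- `𝔤`, the `+1` eigenspace of `s`; for a symmetric pair this is the Lie algebra of `G`. -/
noncomputable def gPart (σ : H ≃* H) : Submodule ℝ (GroupLieAlgebra 𝓘(ℝ, E) H) :=
  Module.End.eigenspace (dInvolution σ).toLinearMap 1

variable (E) in
/-- `𝔭`, the `-1` eigenspace of `s`. -/
noncomputable def pPart (σ : H ≃* H) : Submodule ℝ (GroupLieAlgebra 𝓘(ℝ, E) H) :=
  Module.End.eigenspace (dInvolution σ).toLinearMap (-1)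

/-- For `g ∈ G` the operator `Ad_g` preserves `𝔤`. -/
theorem Ad_mem_gPart [LieGroup 𝓘(ℝ, E) ∞ H] {σ : H ≃* H} {G : Subgroup H}
    (hσ : IsSymmetricPair E σ G) {g : H} (hg : g ∈ G) {ξ : GroupLieAlgebra 𝓘(ℝ, E) H}
    (hξ : ξ ∈ gPart E σ) : Ad g ξ ∈ gPart E σ := by
  simp only [gPart, Module.End.mem_eigenspace_iff, one_smul] at hξ ⊢
  have hc : ContMDiff 𝓘(ℝ, E) 𝓘(ℝ, E) ∞ (fun k : H => g * k * g⁻¹) :=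
    (contMDiff_const.mul contMDiff_id).mul contMDiff_const
  have dc : ∀ x : H, MDifferentiableAt 𝓘(ℝ, E) 𝓘(ℝ, E) (fun k : H => g * k * g⁻¹) x :=
    fun x => (hc x).mdifferentiableAt (by simp)
  have ds : ∀ x : H, MDifferentiableAt 𝓘(ℝ, E) 𝓘(ℝ, E) σ x :=
    fun x => (hσ.smooth x).mdifferentiableAt (by simp)
  have hcomp : (σ : H → H) ∘ (fun k : H => g * k * g⁻¹) = (fun k : H => g * k * g⁻¹) ∘ σ := by
    funext k
    simp [hσ.le_fixed g hg]
  have h1 := mfderiv_comp (1 : H) (ds (g * 1 * g⁻¹)) (dc 1)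
  have h2 := mfderiv_comp (1 : H) (dc (σ 1)) (ds 1)
  rw [hcomp, h2] at h1
  have key : ∀ (f : H → H) (x y : H), x = y →
      (mfderiv 𝓘(ℝ, E) 𝓘(ℝ, E) f x : E →L[ℝ] E) = (mfderiv 𝓘(ℝ, E) 𝓘(ℝ, E) f y : E →L[ℝ] E) := by
    rintro f x _ rfl
    rfl
  have e1 := key σ (g * 1 * g⁻¹) 1 (by group)
  have e2 := key (fun k : H => g * k * g⁻¹) (σ 1) 1 (map_one σ)
  have h3 := congrArg (fun L : E →L[ℝ] E => L ξ) h1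
  have h4 : (mfderiv 𝓘(ℝ, E) 𝓘(ℝ, E) (fun k : H => g * k * g⁻¹) (σ 1) : E →L[ℝ] E)
      ((mfderiv 𝓘(ℝ, E) 𝓘(ℝ, E) σ (1 : H) : E →L[ℝ] E) ξ)
      = (mfderiv 𝓘(ℝ, E) 𝓘(ℝ, E) σ (g * 1 * g⁻¹) : E →L[ℝ] E)
        ((mfderiv 𝓘(ℝ, E) 𝓘(ℝ, E) (fun k : H => g * k * g⁻¹) (1 : H) : E →L[ℝ] E) ξ) := h3
  rw [e1, e2] at h4
  have h5 : (mfderiv 𝓘(ℝ, E) 𝓘(ℝ, E) σ (1 : H) : E →L[ℝ] E) ξ = ξ := hξ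
  rw [h5] at h4
  exact h4.symm

/-- A Legendrian structure for `(H, σ)`: a nondegenerate symmetric bilinear form on `𝔥` for which `s`
is skew-symmetric and which is invariant under the adjoint actions of `𝔥` and of `H`. -/
structure IsLegendrianForm [LieGroup 𝓘(ℝ, E) ∞ H] [FiniteDimensional ℝ E] (σ : H ≃* H)
    (Λ : LinearMap.BilinForm ℝ (GroupLieAlgebra 𝓘(ℝ, E) H)) : Prop where
  nondegenerate : Λ.Nondegenerate
  symm : ∀ x y, Λ x y = Λ y x
  skew : ∀ x y, Λ (dInvolution σ x) y = -Λ x (dInvolution σ y)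
  ad_invariant : ∀ x y z : GroupLieAlgebra 𝓘(ℝ, E) H, Λ ⁅x, y⁆ z = -Λ y ⁅x, z⁆
  Ad_invariant : ∀ (h : H) (x y : GroupLieAlgebra 𝓘(ℝ, E) H), Λ (Ad h x) y = Λ x (Ad h⁻¹ y)

/-- The `𝔭`-part `π = ((1 - s) / 2) θ` of the Maurer–Cartan form. -/
noncomputable def piForm (σ : H ≃* H) (h : H) :
    TangentSpace 𝓘(ℝ, E) h →L[ℝ] GroupLieAlgebra 𝓘(ℝ, E) H :=
  (1 / 2 : ℝ) • (maurerCartan h - (dInvolution σ).comp (maurerCartan h))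

variable [FiniteDimensional ℝ E]

instance (p : H) : FiniteDimensional ℝ (TangentSpace 𝓘(ℝ, E) p) :=
  inferInstanceAs (FiniteDimensional ℝ E)

instance (p : H) : T2Space (TangentSpace 𝓘(ℝ, E) p) :=
  inferInstanceAs (T2Space E)

/-- The one-form `β(ξ)_h = Λ(ξ, Ad_h π_h)` on `H`. -/
noncomputable def betaForm (σ : H ≃* H)
    (Λ : LinearMap.BilinForm ℝ (GroupLieAlgebra 𝓘(ℝ, E) H)) (ξ : GroupLieAlgebra 𝓘(ℝ, E) H) :
    DiffForm E H 1 := fun h =>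
  ContinuousAlternatingMap.ofSubsingleton ℝ (TangentSpace 𝓘(ℝ, E) h) ℝ (0 : Fin 1)
    ((LinearMap.toContinuousLinearMap (Λ ξ)).comp ((Ad h).comp (piForm σ h)))

/-- The trilinear form `(x, y, z) ↦ Λ(x, [y, z])` on `𝔥`. -/
noncomputable def lieTrilinear [LieGroup 𝓘(ℝ, E) ∞ H]
    (Λ : LinearMap.BilinForm ℝ (GroupLieAlgebra 𝓘(ℝ, E) H)) :
    ContinuousMultilinearMap ℝ (fun _ : Fin 3 => GroupLieAlgebra 𝓘(ℝ, E) H) ℝ where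
  toFun v := Λ (v 0) ⁅v 1, v 2⁆
  map_update_add' := by
    intro inst v i x y
    obtain rfl := Subsingleton.elim inst (instDecidableEqFin 3)
    obtain rfl | rfl | rfl : i = 0 ∨ i = 1 ∨ i = 2 := by omega
    · simp
    · simp
    · simp
  map_update_smul' := by
    intro inst v i c x
    obtain rfl := Subsingleton.elim inst (instDecidableEqFin 3)
    obtain rfl | rfl | rfl : i = 0 ∨ i = 1 ∨ i = 2 := by omega
    · simp
    · simp
    · simp
  cont := by
    let b : E →ₗ[ℝ] E →ₗ[ℝ] E :=
      ((LieModule.toEnd ℝ (GroupLieAlgebra 𝓘(ℝ, E) H) (GroupLieAlgebra 𝓘(ℝ, E) H) :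
        GroupLieAlgebra 𝓘(ℝ, E) H →ₗ[ℝ] GroupLieAlgebra 𝓘(ℝ, E) H →ₗ[ℝ]
          GroupLieAlgebra 𝓘(ℝ, E) H))
    let l : E →ₗ[ℝ] E →ₗ[ℝ] ℝ := Λ
    have h : Continuous fun v : Fin 3 → E =>
        l.toContinuousBilinearMap (v 0) (b.toContinuousBilinearMap (v 1) (v 2)) := by
      fun_prop
    exact h

/-- The three-form `Υ = (1/3) Λ(π, [π, π])` on `H`, where `Λ(π, [π, π])` denotes, at `h`, the
skew-symmetrization `∑_{ε ∈ S₃} sgn(ε) Λ(π v_{ε 0}, [π v_{ε 1}, π v_{ε 2}])`. -/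
noncomputable def upsilonForm [LieGroup 𝓘(ℝ, E) ∞ H] (σ : H ≃* H)
    (Λ : LinearMap.BilinForm ℝ (GroupLieAlgebra 𝓘(ℝ, E) H)) : DiffForm E H 3 := fun h =>
  (1 / 3 : ℝ) • (ContinuousMultilinearMap.alternatization (lieTrilinear Λ)).compContinuousLinearMap
    (piForm σ h)

/-- A form on `H` is basic for the right action of `G`: it is `G`-invariant and horizontal. The
fundamental vector field of `η ∈ 𝔤` for the right action is the left-invariant field of `η`. -/
structure IsRightBasic (σ : H ≃* H) (G : Subgroup H) {k : ℕ} (α : DiffForm E H (k + 1)) : Prop where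
  invariant : ∀ g ∈ G, DiffForm.pullback (fun h : H => h * g) α = α
  horizontal : ∀ η ∈ gPart E σ, DiffForm.contract (mulInvariantVectorField η) α = 0

end LieGroups

section Quotient

variable {E : Type*} [NormedAddCommGroup E] [NormedSpace ℝ E] [FiniteDimensional ℝ E]
  {H : Type*} [TopologicalSpace H] [ChartedSpace E H] [Group H] [LieGroup 𝓘(ℝ, E) ∞ H]
  {F : Type*} [NormedAddCommGroup F] [NormedSpace ℝ F]

variable (E F) in
/-- The charts given on the coset space `H ⧸ G` (with its quotient topology) make it a smooth manifold
for which the quotient map `j : H → H ⧸ G` is a smooth submersion. This is the standard smooth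
structure of a homogeneous space. -/
structure IsHomogeneousManifold (G : Subgroup H) [ChartedSpace F (H ⧸ G)] : Prop where
  isManifold : IsManifold 𝓘(ℝ, F) ∞ (H ⧸ G)
  submersion : Manifold.IsSubmersion 𝓘(ℝ, E) 𝓘(ℝ, F) ∞ (QuotientGroup.mk : H → H ⧸ G)

/-- `α` is the descent of the form `υ` on `H` along `j : H → H ⧸ G`, i.e. the unique smooth form on
`H ⧸ G` with `j^* α = υ`. -/
structure IsDescent (G : Subgroup H) [ChartedSpace F (H ⧸ G)] {k : ℕ} (υ : DiffForm E H k)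
    (α : DiffForm F (H ⧸ G) k) : Prop where
  isSmooth : α.IsSmooth
  pullback_eq : DiffForm.pullback (QuotientGroup.mk : H → H ⧸ G) α = υ
  unique : ∀ α' : DiffForm F (H ⧸ G) k, α'.IsSmooth →
    DiffForm.pullback (QuotientGroup.mk : H → H ⧸ G) α' = υ → α' = α

variable {P : Type*} [TopologicalSpace P] [ChartedSpace F P] [MulAction H P]

/-- `Ξ + τ` is a `G`-equivariant three-form on `P`, i.e. an element of
`Ω³(P)^G ⊕ (Ω¹(P) ⊗ 𝔤^*)^G`. -/
structure IsEquivariantThreeForm {σ : H ≃* H} {G : Subgroup H} (hσ : IsSymmetricPair E σ G)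
    (Ξ : DiffForm F P 3) (τ : gPart E σ →ₗ[ℝ] DiffForm F P 1) : Prop where
  smooth_inv : Ξ.IsSmooth
  smooth_equiv : ∀ ξ, (τ ξ).IsSmooth
  invariant : ∀ g ∈ G, DiffForm.pullback (fun p : P => g • p) Ξ = Ξ
  equivariant : ∀ (g : H) (hg : g ∈ G) (ξ : gPart E σ),
    τ ⟨Ad g ξ, Ad_mem_gPart hσ hg ξ.2⟩ = DiffForm.pullback (fun p : P => g⁻¹ • p) (τ ξ)

/-- `Ξ + τ` is closed for the Cartan differential `(d_G α)(ξ) = d(α(ξ)) - ι_ξ α(ξ)`: the three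
homogeneous components of `d_G (Ξ + τ)` vanish. -/
structure IsEquivariantlyClosed {σ : H ≃* H}
    (Ξ : DiffForm F P 3) (τ : gPart E σ →ₗ[ℝ] DiffForm F P 1) : Prop where
  d_inv : Ξ.d = 0
  contract_inv : ∀ ξ : gPart E σ,
    DiffForm.contract (fundamentalField (ξ : GroupLieAlgebra 𝓘(ℝ, E) H)) Ξ = (τ ξ).d
  contract_equiv : ∀ ξ : gPart E σ,
    DiffForm.contract (fundamentalField (ξ : GroupLieAlgebra 𝓘(ℝ, E) H)) (τ ξ) = 0

/-- `(P, Ξ + τ)` is a premoment space for `G`: `P` is a smooth manifold on which `G` acts smoothly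
(here through a smooth action of the ambient group `H`) and `Ξ + τ` is an equivariantly closed
`G`-equivariant three-form. -/
structure IsPremomentSpace {σ : H ≃* H} {G : Subgroup H} (hσ : IsSymmetricPair E σ G)
    (Ξ : DiffForm F P 3) (τ : gPart E σ →ₗ[ℝ] DiffForm F P 1) : Prop where
  isManifold : IsManifold 𝓘(ℝ, F) ∞ P
  smooth_action : ContMDiffSMul 𝓘(ℝ, E) 𝓘(ℝ, F) ∞ H P
  equivariant : IsEquivariantThreeForm hσ Ξ τ
  closed : IsEquivariantlyClosed Ξ τ

end Quotient

/-! Left translation and pullback along `j` reduce every identity between forms to algebra in `𝔥`.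
Since `s` is skew for `Λ`, both `𝔤` and `𝔭` are isotropic. Since `Λ` is symmetric and invariant,
`Λ(x, [y, z])` is totally skew and invariant under `ad` and `Ad`. Since `s` is an automorphism, `[𝔤,
𝔤]` and `[𝔭, 𝔭]` lie in `𝔤`, while `[𝔤, 𝔭]` lies in `𝔭`.

Closedness on `H`: write `x = x_𝔤 + x_𝔭`. The `𝔭`-part of the Maurer–Cartan equation is `dπ(x, y) =
-[x_𝔤, y_𝔭] + [y_𝔤, x_𝔭]`, so `π` changes only by an infinitesimal action of `𝔤`, and invariance of
the trilinear form gives `dΥ = 0` (`d_upsilonForm`). In `dβ(ξ)` the derivative of `Ad_h` adds `[x,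
y_𝔭] - [y, x_𝔭]`; the mixed terms cancel and `2 Λ(Ad_{h⁻¹} ξ, [π, π])` remains (`d_betaForm_apply`).
The fundamental field of left multiplication is right-invariant, so `θ` takes the value `ζ =
Ad_{h⁻¹} ξ` on it. As `[𝔭, 𝔭] ⊆ 𝔤` is isotropic to `𝔤`, the `𝔤`-part of `ζ` is invisible and `ι_ξ Υ
= dβ(ξ)`. Finally `ι_ξ β(ξ) = Λ(ζ, ζ_𝔭) = ½ Λ(ζ, ζ) = ½ Λ(ξ, ξ) = 0`.

Descent: a submersion has smooth local sections, and a basic form pulled back along them does not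
depend on the section (`IsRightBasic.exists_isDescent`). Pullback along the surjective submersion
`j` is injective, so uniqueness, linearity, equivariance and closedness on `H ⧸ G` all follow from
the identities on `H`.

The manifold structure rests on the symmetrization `h ↦ h σ(h)⁻¹`, which is right `G`-invariant, has
the cosets of `H^σ` as fibres, and has differential `1 - s` at `1`. Read in an odd chart that
intertwines `σ` with `s`, it takes values in `𝔭`. Together with the `𝔤`-part of that chart it forms
a chart of `H` at `1`, whose `𝔭`-coordinate is a coordinate on cosets. The same chart linearizes
`σ`, so that the fixed points near `1` form a connected set and lie in `G`. Left translates of this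
one slice give the atlas. -/

set_option linter.unusedSectionVars false

/-! ### Smooth dependence of alternating forms on parameters -/

section AlternatingSmooth

open scoped Nat

variable {X E F : Type*} [NormedAddCommGroup X] [NormedSpace ℝ X]
  [NormedAddCommGroup E] [NormedSpace ℝ E] [NormedAddCommGroup F] [NormedSpace ℝ F]

/-- Alternatization as a continuous linear map. -/
noncomputable def ContinuousMultilinearMap.alternatizationL (k : ℕ) :
    ContinuousMultilinearMap ℝ (fun _ : Fin k => E) ℝ →L[ℝ] E [⋀^Fin k]→L[ℝ] ℝ :=
  LinearMap.mkContinuous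
    { toFun := ContinuousMultilinearMap.alternatization
      map_add' := map_add _
      map_smul' := fun c f => by
        ext v
        simp [ContinuousMultilinearMap.alternatization_apply_apply, Finset.mul_sum,
          mul_left_comm, Units.smul_def] } (k ! : ℝ) <| fun f => by
    refine ContinuousAlternatingMap.opNorm_le_bound _ (by positivity) fun v => ?_
    change ‖ContinuousMultilinearMap.alternatization f v‖ ≤ _
    rw [ContinuousMultilinearMap.alternatization_apply_apply]
    refine (norm_sum_le _ _).trans ?_
    -- Each of the `k!` permutations contributes at most `‖f‖ ∏ ‖v i‖`, which is the source of the
    -- bound `k!`.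
    have h : ∀ p ∈ (Finset.univ : Finset (Equiv.Perm (Fin k))),
        ‖Equiv.Perm.sign p • f (v ∘ p)‖ ≤ ‖f‖ * ∏ i, ‖v i‖ := fun p _ => by
      have h1 : ‖Equiv.Perm.sign p • f (v ∘ p)‖ = ‖f (v ∘ p)‖ := by
        rcases Int.units_eq_one_or (Equiv.Perm.sign p) with h | h <;> simp [h]
      rw [h1]
      refine (f.le_opNorm _).trans_eq ?_
      congr 1
      exact Equiv.prod_comp p fun i => ‖v i‖
    refine (Finset.sum_le_card_nsmul _ _ _ h).trans_eq ?_
    rw [Finset.card_univ, Fintype.card_perm, Fintype.card_fin, nsmul_eq_mul, mul_assoc]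

theorem ContinuousMultilinearMap.alternatization_toContinuousMultilinearMap {k : ℕ}
    (f : E [⋀^Fin k]→L[ℝ] ℝ) :
    ContinuousMultilinearMap.alternatization f.toContinuousMultilinearMap = (k ! : ℝ) • f := by
  ext v
  have h := congrArg (fun g : E [⋀^Fin k]→ₗ[ℝ] ℝ => g v)
    (AlternatingMap.coe_alternatization f.toAlternatingMap)
  simpa [ContinuousMultilinearMap.alternatization_apply_apply,
    MultilinearMap.alternatization_apply, Nat.cast_smul_eq_nsmul, Function.comp_def] using h

/-- Alternatization divided by `k!` is a continuous linear retraction of the inclusion into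
multilinear maps, so smoothness may be tested after forgetting alternation. -/
theorem contDiffAt_toContinuousMultilinearMap_iff {k : ℕ} {n : WithTop ℕ∞}
    {f : X → E [⋀^Fin k]→L[ℝ] ℝ} {x : X} :
    ContDiffAt ℝ n (fun y => (f y).toContinuousMultilinearMap) x ↔ ContDiffAt ℝ n f x := by
  refine ⟨fun h => ?_, fun h => ?_⟩
  · have h1 : ContDiffAt ℝ n (fun y => ((k ! : ℝ)⁻¹) •
        ContinuousMultilinearMap.alternatizationL k (f y).toContinuousMultilinearMap) x :=
      ((ContinuousMultilinearMap.alternatizationL k).contDiff.contDiffAt.comp x h).const_smul _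
    convert h1 using 2 with y
    have h2 := ContinuousMultilinearMap.alternatization_toContinuousMultilinearMap (f y)
    have h3 : (k ! : ℝ) ≠ 0 := by positivity
    change _ = _ • ContinuousMultilinearMap.alternatization (f y).toContinuousMultilinearMap
    rw [h2, smul_smul, inv_mul_cancel₀ h3, one_smul]
  · exact (ContinuousAlternatingMap.toContinuousMultilinearMapCLM ℝ :
      E [⋀^Fin k]→L[ℝ] ℝ →L[ℝ] _).contDiff.contDiffAt.comp x h

/-- For multilinear maps, precomposition is linear in `f` and multilinear in the `k` copies of `g`,
hence smooth in the pair. -/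
theorem ContDiffAt.compContinuousLinearMap {k : ℕ} {n : WithTop ℕ∞}
    {f : X → F [⋀^Fin k]→L[ℝ] ℝ} {g : X → E →L[ℝ] F} {x : X} (hf : ContDiffAt ℝ n f x)
    (hg : ContDiffAt ℝ n g x) :
    ContDiffAt ℝ n (fun y => (f y).compContinuousLinearMap (g y)) x := by
  rw [← contDiffAt_toContinuousMultilinearMap_iff] at hf ⊢
  have h1 : ContDiffAt ℝ n (fun y =>
      ContinuousMultilinearMap.compContinuousLinearMapContinuousMultilinear ℝ
        (fun _ : Fin k => E) (fun _ => F) ℝ (fun _ => g y)) x :=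
    (ContinuousMultilinearMap.contDiff _).contDiffAt.comp x (contDiffAt_pi.2 fun _ => hg)
  exact h1.clm_apply hf

end AlternatingSmooth

/-! ### Derivatives between manifolds as maps of model spaces -/

section ModelDeriv

variable {E : Type*} [NormedAddCommGroup E] [NormedSpace ℝ E]
  {M : Type*} [TopologicalSpace M] [ChartedSpace E M]
  {F : Type*} [NormedAddCommGroup F] [NormedSpace ℝ F]
  {N : Type*} [TopologicalSpace N] [ChartedSpace F N]
  {E' : Type*} [NormedAddCommGroup E'] [NormedSpace ℝ E']
  {L : Type*} [TopologicalSpace L] [ChartedSpace E' L]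

variable (E F) in
/-- The derivative of a map between manifolds, as a linear map between the model spaces (to which
the tangent spaces are definitionally equal). -/
noncomputable def modelDeriv (f : M → N) (p : M) : E →L[ℝ] F :=
  mfderiv 𝓘(ℝ, E) 𝓘(ℝ, F) f p

/-- The intermediate point is known only up to an equation, so that `a * 1` can be replaced by `a`
without transporting along tangent spaces. -/
theorem modelDeriv_comp {f : M → N} {g : N → L} {p : M} {q : N} (hq : f p = q)
    (hg : MDifferentiableAt 𝓘(ℝ, F) 𝓘(ℝ, E') g q)
    (hf : MDifferentiableAt 𝓘(ℝ, E) 𝓘(ℝ, F) f p) :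
    modelDeriv E E' (g ∘ f) p = (modelDeriv F E' g q).comp (modelDeriv E F f p) := by
  subst hq
  exact mfderiv_comp p hg hf

theorem modelDeriv_eq_fderiv (f : E → F) (y : E) : modelDeriv E F f y = fderiv ℝ f y :=
  mfderiv_eq_fderiv

theorem modelDeriv_congr {f g : M → N} {p : M} (h : f =ᶠ[nhds p] g) :
    modelDeriv E F f p = modelDeriv E F g p :=
  h.mfderiv_eq

theorem modelDeriv_id (p : M) : modelDeriv E E (fun q : M => q) p = ContinuousLinearMap.id ℝ E :=
  mfderiv_id

theorem modelDeriv_const (q : N) (p : M) : modelDeriv E F (fun _ : M => q) p = 0 :=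
  mfderiv_const

theorem modelDeriv_extChartAt_self [IsManifold 𝓘(ℝ, E) ∞ M] (p : M) :
    modelDeriv E E (extChartAt 𝓘(ℝ, E) p) p = ContinuousLinearMap.id ℝ E := by
  have : IsManifold 𝓘(ℝ, E) 1 M := .of_le (n := ∞) (by simp)
  exact mfderiv_extChartAt_self

theorem modelDeriv_extChartAt_symm_self [IsManifold 𝓘(ℝ, E) ∞ M] (p : M) :
    modelDeriv E E (extChartAt 𝓘(ℝ, E) p).symm (extChartAt 𝓘(ℝ, E) p p) =
      ContinuousLinearMap.id ℝ E := by
  have : IsManifold 𝓘(ℝ, E) 1 M := .of_le (n := ∞) (by simp)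
  have h : (mfderivWithin 𝓘(ℝ, E) 𝓘(ℝ, E) (extChartAt 𝓘(ℝ, E) p).symm (Set.range 𝓘(ℝ, E))
      (extChartAt 𝓘(ℝ, E) p p) : E →L[ℝ] E) = ContinuousLinearMap.id ℝ E :=
    mfderivWithin_range_extChartAt_symm
  rw [modelWithCornersSelf_coe, Set.range_id, mfderivWithin_univ] at h
  exact h

theorem contMDiffAt_extChartAt_symm [IsManifold 𝓘(ℝ, E) ∞ M] (p : M) {y : E}
    (hy : y ∈ (extChartAt 𝓘(ℝ, E) p).target) :
    ContMDiffAt 𝓘(ℝ, E) 𝓘(ℝ, E) ∞ (extChartAt 𝓘(ℝ, E) p).symm y :=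
  (contMDiffOn_extChartAt_symm p).contMDiffAt ((isOpen_extChartAt_target p).mem_nhds hy)

/-- Being `C^∞` at a point provides, for each finite order, a neighbourhood that may shrink with the
order. Order `1` is enough here. -/
theorem ContMDiffAt.eventually_mdifferentiableAt [IsManifold 𝓘(ℝ, E) ∞ M]
    [IsManifold 𝓘(ℝ, F) ∞ N] {f : M → N} {p : M}
    (hf : ContMDiffAt 𝓘(ℝ, E) 𝓘(ℝ, F) ∞ f p) :
    ∀ᶠ q in nhds p, MDifferentiableAt 𝓘(ℝ, E) 𝓘(ℝ, F) f q := by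
  have : IsManifold 𝓘(ℝ, E) 1 M := .of_le (n := ∞) (by simp)
  have : IsManifold 𝓘(ℝ, F) 1 N := .of_le (n := ∞) (by simp)
  have h := (contMDiffAt_iff_contMDiffAt_nhds (by simp)).1 (hf.of_le (m := 1) (by simp))
  filter_upwards [h] with q hq
  exact hq.mdifferentiableAt one_ne_zero

end ModelDeriv

/-! ### Pullback, exterior derivative and contraction of forms -/

namespace DiffForm

variable {E : Type*} [NormedAddCommGroup E] [NormedSpace ℝ E]
  {M : Type*} [TopologicalSpace M] [ChartedSpace E M]
  {F : Type*} [NormedAddCommGroup F] [NormedSpace ℝ F]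
  {N : Type*} [TopologicalSpace N] [ChartedSpace F N]
  {E' : Type*} [NormedAddCommGroup E'] [NormedSpace ℝ E']
  {L : Type*} [TopologicalSpace L] [ChartedSpace E' L]

theorem ext_model {k : ℕ} {α β : DiffForm E M k} (h : ∀ (p : M) (v : Fin k → E),
    (α p : E [⋀^Fin k]→L[ℝ] ℝ) v = (β p : E [⋀^Fin k]→L[ℝ] ℝ) v) : α = β :=
  funext fun p => ContinuousAlternatingMap.ext (h p)

theorem pullback_apply_model {k : ℕ} (f : M → N) (α : DiffForm F N k) (p : M) (v : Fin k → E) :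
    (pullback (E := E) f α p : E [⋀^Fin k]→L[ℝ] ℝ) v =
      (α (f p) : F [⋀^Fin k]→L[ℝ] ℝ) (fun i => modelDeriv E F f p (v i)) := rfl

theorem contract_apply_model {k : ℕ} (X : ∀ p : M, TangentSpace 𝓘(ℝ, E) p)
    (α : DiffForm E M (k + 1)) (p : M) {x : E} (hx : X p = x) (v : Fin k → E) :
    (contract X α p : E [⋀^Fin k]→L[ℝ] ℝ) v =
      (α p : E [⋀^Fin (k + 1)]→L[ℝ] ℝ) (Matrix.vecCons x v) := by
  subst hx
  rfl

theorem isSmooth_iff {k : ℕ} {α : DiffForm E M k} :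
    α.IsSmooth ↔ ∀ p : M, ∀ y ∈ (extChartAt 𝓘(ℝ, E) p).target,
      ContDiffAt ℝ ∞ (α.inChart p) y := by
  refine forall_congr' fun p => ⟨fun h y hy => ?_, fun h y hy => (h y hy).contDiffWithinAt⟩
  exact h.contDiffAt ((isOpen_extChartAt_target p).mem_nhds hy)

/-- The fibre containing `α a` depends on `a`, so base point and linear map have to be replaced
together. -/
theorem compContinuousLinearMap_congr {k : ℕ} (α : DiffForm F N k) {a b : N} (hab : a = b)
    {f g : E →L[ℝ] F} (hfg : f = g) :
    ((α a : F [⋀^Fin k]→L[ℝ] ℝ).compContinuousLinearMap f : E [⋀^Fin k]→L[ℝ] ℝ) =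
      (α b : F [⋀^Fin k]→L[ℝ] ℝ).compContinuousLinearMap g := by
  subst hab hfg
  rfl

variable (E F) in
/-- A map read in the preferred charts around `p` and `q`. -/
noncomputable def inCharts (f : M → N) (p : M) (q : N) (y : E) : F :=
  extChartAt 𝓘(ℝ, F) q (f ((extChartAt 𝓘(ℝ, E) p).symm y))

theorem contDiffAt_inCharts [IsManifold 𝓘(ℝ, E) ∞ M] [IsManifold 𝓘(ℝ, F) ∞ N]
    {f : M → N} {p : M} {q : N} {y : E} (hy : y ∈ (extChartAt 𝓘(ℝ, E) p).target)
    (hf : ContMDiffAt 𝓘(ℝ, E) 𝓘(ℝ, F) ∞ f ((extChartAt 𝓘(ℝ, E) p).symm y))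
    (hq : f ((extChartAt 𝓘(ℝ, E) p).symm y) ∈ (extChartAt 𝓘(ℝ, F) q).source) :
    ContDiffAt ℝ ∞ (inCharts E F f p q) y := by
  rw [← contMDiffAt_iff_contDiffAt]
  have h1 : ContMDiffAt 𝓘(ℝ, F) 𝓘(ℝ, F) ∞ (extChartAt 𝓘(ℝ, F) q)
      (f ((extChartAt 𝓘(ℝ, E) p).symm y)) := contMDiffAt_extChartAt' (by simpa using hq)
  exact h1.comp y (hf.comp y (contMDiffAt_extChartAt_symm p hy))

/-- The chart expression of a pullback near a point. -/
theorem inChart_pullback_eventuallyEq [IsManifold 𝓘(ℝ, E) ∞ M] [IsManifold 𝓘(ℝ, F) ∞ N]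
    {k : ℕ} (α : DiffForm F N k)
    {f : M → N} {p : M} {q : N} {y : E} (hy : y ∈ (extChartAt 𝓘(ℝ, E) p).target)
    (hf : ContMDiffAt 𝓘(ℝ, E) 𝓘(ℝ, F) ∞ f ((extChartAt 𝓘(ℝ, E) p).symm y))
    (hq : f ((extChartAt 𝓘(ℝ, E) p).symm y) ∈ (extChartAt 𝓘(ℝ, F) q).source) :
    (pullback (E := E) f α).inChart p =ᶠ[nhds y] fun z =>
      (α.inChart q (inCharts E F f p q z)).compContinuousLinearMap (fderiv ℝ (inCharts E F f p q) z) := by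
  have hψ := contMDiffAt_extChartAt_symm (M := M) p hy
  have h1 : ∀ᶠ z in nhds y, z ∈ (extChartAt 𝓘(ℝ, E) p).target :=
    (isOpen_extChartAt_target p).mem_nhds hy
  have hc : ContinuousAt (fun z => f ((extChartAt 𝓘(ℝ, E) p).symm z)) y :=
    (hf.comp y hψ).continuousAt
  have h2 : ∀ᶠ z in nhds y, f ((extChartAt 𝓘(ℝ, E) p).symm z) ∈ (extChartAt 𝓘(ℝ, F) q).source :=
    hc.eventually ((isOpen_extChartAt_source q).mem_nhds hq)
  have h3 : ∀ᶠ z in nhds y, MDifferentiableAt 𝓘(ℝ, E) 𝓘(ℝ, F) f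
      ((extChartAt 𝓘(ℝ, E) p).symm z) :=
     hψ.continuousAt.eventually hf.eventually_mdifferentiableAt
  filter_upwards [h1, h2.eventually_nhds, h3] with z hz1 hz2' hz3
  have hz2 := hz2'.self_of_nhds
  have hψz : MDifferentiableAt 𝓘(ℝ, E) 𝓘(ℝ, E) (extChartAt 𝓘(ℝ, E) p).symm z :=
    (contMDiffAt_extChartAt_symm p hz1).mdifferentiableAt (by simp)
  have hfz : MDifferentiableAt 𝓘(ℝ, E) 𝓘(ℝ, F) (f ∘ (extChartAt 𝓘(ℝ, E) p).symm) z :=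
    hz3.comp z hψz
  have hχ : MDifferentiableAt 𝓘(ℝ, F) 𝓘(ℝ, F) (extChartAt 𝓘(ℝ, F) q)
      (f ((extChartAt 𝓘(ℝ, E) p).symm z)) := mdifferentiableAt_extChartAt (by simpa using hz2)
  have hF : MDifferentiableAt 𝓘(ℝ, E) 𝓘(ℝ, F) (inCharts E F f p q) z := hχ.comp z hfz
  have hFt : inCharts E F f p q z ∈ (extChartAt 𝓘(ℝ, F) q).target :=
    (extChartAt 𝓘(ℝ, F) q).map_source hz2
  have hχs : MDifferentiableAt 𝓘(ℝ, F) 𝓘(ℝ, F) (extChartAt 𝓘(ℝ, F) q).symm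
      (inCharts E F f p q z) := (contMDiffAt_extChartAt_symm q hFt).mdifferentiableAt (by simp)
  -- Near `z`, the map `f ∘ φ⁻¹` equals `χ⁻¹ ∘ F`, where `F` is `f` read in the charts.
  -- Differentiating both factorizations identifies the two pulled-back forms.
  have e1 := modelDeriv_comp rfl hz3 hψz
  have e2 := modelDeriv_comp rfl hχs hF
  have e3 : ((extChartAt 𝓘(ℝ, F) q).symm ∘ inCharts E F f p q) =ᶠ[nhds z]
      (f ∘ (extChartAt 𝓘(ℝ, E) p).symm) := by
    filter_upwards [hz2'] with w hw
    exact (extChartAt 𝓘(ℝ, F) q).left_inv hw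
  rw [modelDeriv_congr e3, modelDeriv_eq_fderiv] at e2
  exact compContinuousLinearMap_congr α (e3.self_of_nhds).symm (e1.symm.trans e2)

theorem contDiffAt_inChart_pullback [IsManifold 𝓘(ℝ, E) ∞ M] [IsManifold 𝓘(ℝ, F) ∞ N]
    {k : ℕ} {α : DiffForm F N k} (hα : α.IsSmooth)
    {f : M → N} {p : M} {y : E} (hy : y ∈ (extChartAt 𝓘(ℝ, E) p).target)
    (hf : ContMDiffAt 𝓘(ℝ, E) 𝓘(ℝ, F) ∞ f ((extChartAt 𝓘(ℝ, E) p).symm y)) :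
    ContDiffAt ℝ ∞ ((pullback (E := E) f α).inChart p) y := by
  set q := f ((extChartAt 𝓘(ℝ, E) p).symm y) with hq
  have hqs : f ((extChartAt 𝓘(ℝ, E) p).symm y) ∈ (extChartAt 𝓘(ℝ, F) q).source :=
    mem_extChartAt_source q
  have hF := contDiffAt_inCharts hy hf hqs
  refine ContDiffAt.congr_of_eventuallyEq ?_ (inChart_pullback_eventuallyEq α hy hf hqs)
  refine ContDiffAt.compContinuousLinearMap ?_ (hF.fderiv_right (by simp))
  exact (isSmooth_iff.1 hα q _ ((extChartAt 𝓘(ℝ, F) q).map_source hqs)).comp y hF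

/-- A preferred chart has derivative the identity at its own base point, so the chart correction in
the definition of `d` disappears. -/
theorem d_apply [IsManifold 𝓘(ℝ, E) ∞ M] {k : ℕ} (α : DiffForm E M k) (p : M) :
    (α.d p : E [⋀^Fin (k + 1)]→L[ℝ] ℝ) =
      extDeriv (α.inChart p) (extChartAt 𝓘(ℝ, E) p p) := by
  have h := modelDeriv_extChartAt_self (E := E) p
  change (extDeriv (α.inChart p) (extChartAt 𝓘(ℝ, E) p p)).compContinuousLinearMap
    (modelDeriv E E (extChartAt 𝓘(ℝ, E) p) p) = _
  rw [h]
  ext v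
  rfl

/-- The exterior derivative commutes with pullbacks. -/
theorem d_pullback [IsManifold 𝓘(ℝ, E) ∞ M] [IsManifold 𝓘(ℝ, F) ∞ N]
    {k : ℕ} {α : DiffForm F N k} (hα : α.IsSmooth)
    {f : M → N} (hf : ContMDiff 𝓘(ℝ, E) 𝓘(ℝ, F) ∞ f) :
    (DiffForm.pullback (E := E) f α).d = DiffForm.pullback (E := E) f α.d := by
  have : IsManifold 𝓘(ℝ, E) 1 M := .of_le (n := ∞) (by simp)
  have : IsManifold 𝓘(ℝ, F) 1 N := .of_le (n := ∞) (by simp)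
  funext p
  have hy := mem_extChartAt_target (I := 𝓘(ℝ, E)) p
  have hp := extChartAt_to_inv (I := 𝓘(ℝ, E)) p
  have hqs : f ((extChartAt 𝓘(ℝ, E) p).symm (extChartAt 𝓘(ℝ, E) p p)) ∈
      (extChartAt 𝓘(ℝ, F) (f p)).source := by
    rw [hp]; exact mem_extChartAt_source (f p)
  have hF := contDiffAt_inCharts hy (hf _) hqs
  have hFp : inCharts E F f p (f p) (extChartAt 𝓘(ℝ, E) p p) = extChartAt 𝓘(ℝ, F) (f p) (f p) := by
    rw [inCharts, hp]
  have hα' : DifferentiableAt ℝ (α.inChart (f p))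
      (inCharts E F f p (f p) (extChartAt 𝓘(ℝ, E) p p)) :=
    (isSmooth_iff.1 hα (f p) _
      ((extChartAt 𝓘(ℝ, F) (f p)).map_source hqs)).differentiableAt (by simp)
  have hD : (fderiv ℝ (inCharts E F f p (f p)) (extChartAt 𝓘(ℝ, E) p p) : E →L[ℝ] F) =
      mfderiv 𝓘(ℝ, E) 𝓘(ℝ, F) f p := by
    rw [(hf.mdifferentiableAt (by simp)).mfderiv]
    simp only [modelWithCornersSelf_coe, Set.range_id, fderivWithin_univ]
    rfl
  -- The exterior derivative depends only on the germ of the form, so naturality on the model spaces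
  -- applies to the local chart expression.
  have h1 := (inChart_pullback_eventuallyEq α hy (hf _) hqs).extDeriv_eq
  rw [extDeriv_pullback hα' hF
    (by rw [minSmoothness_of_isRCLikeNormedField]; exact WithTop.coe_le_coe.2 le_top), hFp, hD] at h1
  exact (d_apply (DiffForm.pullback (E := E) f α) p).trans (h1.trans
    (congrArg (fun A : F [⋀^Fin (k + 1)]→L[ℝ] ℝ =>
      A.compContinuousLinearMap (modelDeriv E F f p)) (d_apply α (f p)).symm))

theorem pullback_pullback {k : ℕ} (α : DiffForm E' L k) {f : M → N} {g : N → L}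
    (hg : MDifferentiable 𝓘(ℝ, F) 𝓘(ℝ, E') g) (hf : MDifferentiable 𝓘(ℝ, E) 𝓘(ℝ, F) f) :
    DiffForm.pullback (E := E) f (DiffForm.pullback (E := F) g α) =
      DiffForm.pullback (E := E) (g ∘ f) α := by
  funext p
  have h := modelDeriv_comp rfl (hg (f p)) (hf p)
  ext v
  change (α (g (f p)) : E' [⋀^Fin k]→L[ℝ] ℝ) _ =
    (α (g (f p)) : E' [⋀^Fin k]→L[ℝ] ℝ) (fun i => modelDeriv E E' (g ∘ f) p (v i))
  rw [h]
  rfl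

theorem pullback_injective {k : ℕ} {f : M → N} (hf : Function.Surjective f)
    (hf' : ∀ p, Function.Surjective (mfderiv 𝓘(ℝ, E) 𝓘(ℝ, F) f p)) :
    Function.Injective (DiffForm.pullback f : DiffForm F N k → DiffForm E M k) := by
  intro α β h
  funext q
  obtain ⟨p, rfl⟩ := hf q
  ext v
  choose w hw using fun i => hf' p (v i)
  have h1 : (DiffForm.pullback f α p) w = (DiffForm.pullback f β p) w := by rw [h]
  change α (f p) (fun i => mfderiv 𝓘(ℝ, E) 𝓘(ℝ, F) f p (w i)) =
    β (f p) (fun i => mfderiv 𝓘(ℝ, E) 𝓘(ℝ, F) f p (w i)) at h1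
  simpa only [hw] using h1

/-- Contraction commutes with pullback for related vector fields. -/
theorem contract_pullback {k : ℕ} (α : DiffForm F N (k + 1)) {f : M → N}
    {X : ∀ p : M, TangentSpace 𝓘(ℝ, E) p} {Y : ∀ q : N, TangentSpace 𝓘(ℝ, F) q}
    (h : ∀ p, mfderiv 𝓘(ℝ, E) 𝓘(ℝ, F) f p (X p) = Y (f p)) :
    contract X (DiffForm.pullback f α) = DiffForm.pullback f (contract Y α) := by
  funext p
  ext v
  change α (f p) (fun i => mfderiv 𝓘(ℝ, E) 𝓘(ℝ, F) f p (Matrix.vecCons (X p) v i)) =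
    α (f p) (Matrix.vecCons (Y (f p)) (fun i => mfderiv 𝓘(ℝ, E) 𝓘(ℝ, F) f p (v i)))
  congr 1
  funext i
  refine Fin.cases ?_ (fun i => ?_) i
  · exact h p
  · rfl

end DiffForm

/-! ### Maurer–Cartan forms and the adjoint representation -/

section LieGroupCalculus

variable {E : Type*} [NormedAddCommGroup E] [NormedSpace ℝ E]
  {H : Type*} [TopologicalSpace H] [ChartedSpace E H] [Group H]

variable (E) in
/-- The right-invariant Maurer–Cartan form, on the model space. -/
noncomputable def rightMaurerCartan (h : H) : E →L[ℝ] E :=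
  modelDeriv E E (fun k : H => k * h⁻¹) h

variable (E) in
/-- The left-invariant Maurer–Cartan form, on the model space. -/
noncomputable def leftMaurerCartan (h : H) : E →L[ℝ] E :=
  modelDeriv E E (fun k : H => h⁻¹ * k) h

variable (E) in
/-- The adjoint representation, on the model space. -/
noncomputable def adjointRep (h : H) : E →L[ℝ] E :=
  modelDeriv E E (fun k : H => h * k * h⁻¹) 1

theorem leftMaurerCartan_one : leftMaurerCartan E (1 : H) = ContinuousLinearMap.id ℝ E := by
  rw [leftMaurerCartan, ← modelDeriv_id (1 : H)]
  congr 1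
  simp

theorem adjointRep_one : adjointRep E (1 : H) = ContinuousLinearMap.id ℝ E := by
  rw [adjointRep, ← modelDeriv_id (1 : H)]
  congr 1
  funext k
  simp

variable [LieGroup 𝓘(ℝ, E) ∞ H]

theorem mdifferentiableAt_leftTranslation (a h : H) :
    MDifferentiableAt 𝓘(ℝ, E) 𝓘(ℝ, E) (fun k : H => a * k) h :=
  (contMDiff_mul_left (I := 𝓘(ℝ, E)) (n := ∞)).mdifferentiableAt (by simp)

theorem mdifferentiableAt_rightTranslation (a h : H) :
    MDifferentiableAt 𝓘(ℝ, E) 𝓘(ℝ, E) (fun k : H => k * a) h :=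
  (contMDiff_mul_right (I := 𝓘(ℝ, E)) (n := ∞)).mdifferentiableAt (by simp)

theorem mdifferentiableAt_conj (a h : H) :
    MDifferentiableAt 𝓘(ℝ, E) 𝓘(ℝ, E) (fun k : H => a * k * a⁻¹) h :=
  (mdifferentiableAt_rightTranslation a⁻¹ (a * h)).comp h (mdifferentiableAt_leftTranslation a h)

theorem leftMaurerCartan_comp_mul_left (a h : H) :
    (leftMaurerCartan E (a * h)).comp (modelDeriv E E (fun k : H => a * k) h) =
      leftMaurerCartan E h := by
  rw [leftMaurerCartan, ← modelDeriv_comp rfl (mdifferentiableAt_leftTranslation _ _)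
    (mdifferentiableAt_leftTranslation _ _), leftMaurerCartan]
  congr 1
  funext k
  simp [mul_assoc]

/-- Differentiate `(h g)⁻¹ (k g) = g⁻¹ (h⁻¹ k) g` at `k = h`. -/
theorem leftMaurerCartan_comp_mul_right (h g : H) :
    (leftMaurerCartan E (h * g)).comp (modelDeriv E E (fun k : H => k * g) h) =
      (adjointRep E g⁻¹).comp (leftMaurerCartan E h) := by
  rw [leftMaurerCartan, ← modelDeriv_comp rfl (mdifferentiableAt_leftTranslation _ _)
    (mdifferentiableAt_rightTranslation _ _), leftMaurerCartan, adjointRep,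
    ← modelDeriv_comp (by simp) (mdifferentiableAt_conj _ _) (mdifferentiableAt_leftTranslation _ _)]
  congr 1
  funext k
  simp [mul_assoc]

theorem leftMaurerCartan_comp_mul_left_one (h : H) :
    (leftMaurerCartan E h).comp (modelDeriv E E (fun k : H => h * k) 1) =
      ContinuousLinearMap.id ℝ E := by
  have h1 := leftMaurerCartan_comp_mul_left (E := E) h 1
  rwa [mul_one, leftMaurerCartan_one] at h1

theorem mul_left_one_comp_leftMaurerCartan (h : H) :
    (modelDeriv E E (fun k : H => h * k) 1).comp (leftMaurerCartan E h) =
      ContinuousLinearMap.id ℝ E := by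
  rw [leftMaurerCartan, ← modelDeriv_comp (by simp) (mdifferentiableAt_leftTranslation _ _)
    (mdifferentiableAt_leftTranslation _ _), ← modelDeriv_id h]
  congr 1
  funext k
  simp

theorem rightMaurerCartan_comp_mul_right_one (h : H) :
    (rightMaurerCartan E h).comp (modelDeriv E E (fun k : H => k * h) 1) =
      ContinuousLinearMap.id ℝ E := by
  rw [rightMaurerCartan, ← modelDeriv_comp (by simp) (mdifferentiableAt_rightTranslation _ _)
    (mdifferentiableAt_rightTranslation _ _), ← modelDeriv_id (1 : H)]
  congr 1
  funext k
  simp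

/-- Differentiate `k h⁻¹ = h (h⁻¹ k) h⁻¹` at `k = h`. -/
theorem rightMaurerCartan_eq (h : H) :
    rightMaurerCartan E h = (adjointRep E h).comp (leftMaurerCartan E h) := by
  rw [leftMaurerCartan, adjointRep, rightMaurerCartan, ← modelDeriv_comp (by simp)
    (mdifferentiableAt_conj _ _) (mdifferentiableAt_leftTranslation _ _)]
  congr 1
  funext k
  simp

/-- This evaluates `θ` on right-invariant fields, which are the fundamental fields of left
multiplication. -/
theorem leftMaurerCartan_comp_mul_right_one (h : H) :
    (leftMaurerCartan E h).comp (modelDeriv E E (fun k : H => k * h) 1) = adjointRep E h⁻¹ := by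
  have h1 := leftMaurerCartan_comp_mul_right (E := E) 1 h
  rwa [one_mul, leftMaurerCartan_one, ContinuousLinearMap.comp_id] at h1

theorem adjointRep_mul (a b : H) :
    adjointRep E (a * b) = (adjointRep E a).comp (adjointRep E b) := by
  rw [adjointRep, adjointRep, adjointRep, ← modelDeriv_comp (by simp)
    (mdifferentiableAt_conj _ _) (mdifferentiableAt_conj _ _)]
  congr 1
  funext k
  simp [mul_assoc]

/-- A smooth binary operation, read in the preferred charts around `p`, `q` and `r`. -/
noncomputable def binaryInCharts (f : H × H → H) (p q r : H) (x : E × E) : E :=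
  extChartAt 𝓘(ℝ, E) r
    (f ((extChartAt 𝓘(ℝ, E) p).symm x.1, (extChartAt 𝓘(ℝ, E) q).symm x.2))

theorem contDiffAt_binaryInCharts {f : H × H → H}
    (hf : ContMDiff (𝓘(ℝ, E).prod 𝓘(ℝ, E)) 𝓘(ℝ, E) ∞ f) {p q r : H} {y z : E}
    (hy : y ∈ (extChartAt 𝓘(ℝ, E) p).target) (hz : z ∈ (extChartAt 𝓘(ℝ, E) q).target)
    (hr : f ((extChartAt 𝓘(ℝ, E) p).symm y, (extChartAt 𝓘(ℝ, E) q).symm z) ∈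
      (extChartAt 𝓘(ℝ, E) r).source) :
    ContDiffAt ℝ ∞ (binaryInCharts f p q r) (y, z) := by
  rw [← contMDiffAt_iff_contDiffAt]
  have h1 : ContMDiffAt 𝓘(ℝ, E) 𝓘(ℝ, E) ∞ (extChartAt 𝓘(ℝ, E) r)
      (f ((extChartAt 𝓘(ℝ, E) p).symm y, (extChartAt 𝓘(ℝ, E) q).symm z)) :=
    contMDiffAt_extChartAt' (by simpa using hr)
  have h2 : ContMDiffAt 𝓘(ℝ, E × E) 𝓘(ℝ, E) ∞
      (fun x : E × E => (extChartAt 𝓘(ℝ, E) p).symm x.1) (y, z) :=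
    (contMDiffAt_extChartAt_symm p hy).comp (y, z)
      (contMDiffAt_iff_contDiffAt.2 contDiffAt_fst)
  have h3 : ContMDiffAt 𝓘(ℝ, E × E) 𝓘(ℝ, E) ∞
      (fun x : E × E => (extChartAt 𝓘(ℝ, E) q).symm x.2) (y, z) :=
    (contMDiffAt_extChartAt_symm q hz).comp (y, z)
      (contMDiffAt_iff_contDiffAt.2 contDiffAt_snd)
  exact h1.comp (y, z) (hf.contMDiffAt.comp (y, z) (h2.prodMk h3))

/-- Both `θ` and `Ad` are partial derivatives, in the second variable, of a smooth operation of two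
variables. Their smooth dependence on the base point is an instance of this statement. -/
theorem contDiffAt_fderiv_binaryInCharts {f : H × H → H}
    (hf : ContMDiff (𝓘(ℝ, E).prod 𝓘(ℝ, E)) 𝓘(ℝ, E) ∞ f) {p q r : H} {y : E} {g : E → E}
    (hg : ContDiffAt ℝ ∞ g y)
    (hy : y ∈ (extChartAt 𝓘(ℝ, E) p).target) (hz : g y ∈ (extChartAt 𝓘(ℝ, E) q).target)
    (hr : f ((extChartAt 𝓘(ℝ, E) p).symm y, (extChartAt 𝓘(ℝ, E) q).symm (g y)) ∈
      (extChartAt 𝓘(ℝ, E) r).source) :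
    ContDiffAt ℝ ∞ (fun x => fderiv ℝ (fun z => binaryInCharts f p q r (x, z)) (g x)) y :=
  ContDiffAt.fderiv (f := fun x z => binaryInCharts f p q r (x, z))
    (contDiffAt_binaryInCharts hf hy hz hr) hg (by simp)

/-- The target chart is centred at the value `q`, where its derivative is the identity, and so it
leaves no trace on the left. -/
theorem modelDeriv_eq_fderiv_inCharts {f : H → H} {p q : H} {y : E}
    (hy : y ∈ (extChartAt 𝓘(ℝ, E) p).target)
    (hf : MDifferentiableAt 𝓘(ℝ, E) 𝓘(ℝ, E) f ((extChartAt 𝓘(ℝ, E) p).symm y))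
    (hq : f ((extChartAt 𝓘(ℝ, E) p).symm y) = q) :
    (modelDeriv E E f ((extChartAt 𝓘(ℝ, E) p).symm y)).comp
      (modelDeriv E E (extChartAt 𝓘(ℝ, E) p).symm y) =
    fderiv ℝ (fun z => extChartAt 𝓘(ℝ, E) q (f ((extChartAt 𝓘(ℝ, E) p).symm z))) y := by
  have h1 : MDifferentiableAt 𝓘(ℝ, E) 𝓘(ℝ, E) (extChartAt 𝓘(ℝ, E) p).symm y :=
    (contMDiffAt_extChartAt_symm p hy).mdifferentiableAt (by simp)
  have h2 : MDifferentiableAt 𝓘(ℝ, E) 𝓘(ℝ, E) (extChartAt 𝓘(ℝ, E) q) q :=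
    mdifferentiableAt_extChartAt (by simp)
  rw [← modelDeriv_comp rfl hf h1, ← modelDeriv_eq_fderiv]
  have h3 := modelDeriv_comp (f := f ∘ (extChartAt 𝓘(ℝ, E) p).symm) hq h2 (hf.comp y h1)
  rw [modelDeriv_extChartAt_self, ContinuousLinearMap.id_comp] at h3
  exact h3.symm

variable (E) in
/-- The left-invariant Maurer–Cartan form in the preferred chart around `p`. -/
noncomputable def leftMaurerCartanInChart (p : H) (y : E) : E →L[ℝ] E :=
  (leftMaurerCartan E ((extChartAt 𝓘(ℝ, E) p).symm y)).comp
    (modelDeriv E E (extChartAt 𝓘(ℝ, E) p).symm y)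

theorem contDiffAt_leftMaurerCartanInChart (p : H) {y : E}
    (hy : y ∈ (extChartAt 𝓘(ℝ, E) p).target) :
    ContDiffAt ℝ ∞ (leftMaurerCartanInChart E p) y := by
  -- `θ` is the second partial derivative of `(a, b) ↦ a⁻¹ b` along the diagonal, where the value is
  -- constantly `1`.
  have hf : ContMDiff (𝓘(ℝ, E).prod 𝓘(ℝ, E)) 𝓘(ℝ, E) ∞ (fun x : H × H => x.1⁻¹ * x.2) :=
    contMDiff_fst.inv.mul contMDiff_snd
  refine (contDiffAt_fderiv_binaryInCharts hf (p := p) (q := p) (r := 1) (g := fun x => x)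
    contDiffAt_id hy hy (by simp)).congr_of_eventuallyEq ?_
  filter_upwards [(isOpen_extChartAt_target (I := 𝓘(ℝ, E)) p).mem_nhds hy] with x hx
  exact modelDeriv_eq_fderiv_inCharts hx (mdifferentiableAt_leftTranslation _ _) (by simp)

theorem contDiffAt_adjointRep (p : H) {y : E} (hy : y ∈ (extChartAt 𝓘(ℝ, E) p).target) :
    ContDiffAt ℝ ∞ (fun x => adjointRep E ((extChartAt 𝓘(ℝ, E) p).symm x)) y := by
  have hf : ContMDiff (𝓘(ℝ, E).prod 𝓘(ℝ, E)) 𝓘(ℝ, E) ∞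
      (fun x : H × H => x.1 * x.2 * x.1⁻¹) :=
    (contMDiff_fst.mul contMDiff_snd).mul contMDiff_fst.inv
  have h1 := mem_extChartAt_target (I := 𝓘(ℝ, E)) (1 : H)
  have h2 := extChartAt_to_inv (I := 𝓘(ℝ, E)) (1 : H)
  refine (contDiffAt_fderiv_binaryInCharts hf (p := p) (q := 1) (r := 1)
    (g := fun _ => extChartAt 𝓘(ℝ, E) (1 : H) 1)
    contDiffAt_const hy h1 (by simp)).congr_of_eventuallyEq ?_
  filter_upwards [(isOpen_extChartAt_target (I := 𝓘(ℝ, E)) p).mem_nhds hy] with x hx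
  have h3 := modelDeriv_eq_fderiv_inCharts (p := 1) (q := 1) h1
    (mdifferentiableAt_conj ((extChartAt 𝓘(ℝ, E) p).symm x)
      ((extChartAt 𝓘(ℝ, E) (1 : H)).symm (extChartAt 𝓘(ℝ, E) (1 : H) 1))) (by simp)
  rw [modelDeriv_extChartAt_symm_self, ContinuousLinearMap.comp_id, h2] at h3
  exact h3

theorem contMDiff_of_inChart {X : Type*} [NormedAddCommGroup X] [NormedSpace ℝ X]
    {M : Type*} [TopologicalSpace M] [ChartedSpace E M] [IsManifold 𝓘(ℝ, E) ∞ M]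
    {f : M → X} (h : ∀ p : M, ∀ y ∈ (extChartAt 𝓘(ℝ, E) p).target,
      ContDiffAt ℝ ∞ (fun x => f ((extChartAt 𝓘(ℝ, E) p).symm x)) y) :
    ContMDiff 𝓘(ℝ, E) 𝓘(ℝ, X) ∞ f := by
  intro p
  have h1 : ContMDiffAt 𝓘(ℝ, E) 𝓘(ℝ, X) ∞ (fun x => f ((extChartAt 𝓘(ℝ, E) p).symm x))
      (extChartAt 𝓘(ℝ, E) p p) := (h p _ (mem_extChartAt_target p)).contMDiffAt
  refine (h1.comp p (contMDiffAt_extChartAt (I := 𝓘(ℝ, E)) (x := p))).congr_of_eventuallyEq ?_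
  filter_upwards [extChartAt_source_mem_nhds (I := 𝓘(ℝ, E)) p] with q hq
  simp only [Function.comp_apply]
  rw [(extChartAt 𝓘(ℝ, E) p).left_inv hq]

theorem contMDiff_adjointRep : ContMDiff 𝓘(ℝ, E) 𝓘(ℝ, E →L[ℝ] E) ∞ (adjointRep E : H → _) :=
  contMDiff_of_inChart fun p _ hy => contDiffAt_adjointRep p hy

end LieGroupCalculus

/-! ### The Lie bracket, the Maurer–Cartan equation and the derivative of `Ad` -/

section LieBracket

variable {E : Type*} [NormedAddCommGroup E] [NormedSpace ℝ E]
  {H : Type*} [TopologicalSpace H] [ChartedSpace E H] [Group H]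

theorem modelDeriv_symm_comp_extChartAt {M : Type*} [TopologicalSpace M] [ChartedSpace E M]
    [IsManifold 𝓘(ℝ, E) ∞ M] (p : M) {y : E} (hy : y ∈ (extChartAt 𝓘(ℝ, E) p).target) :
    (modelDeriv E E (extChartAt 𝓘(ℝ, E) p).symm y).comp
      (modelDeriv E E (extChartAt 𝓘(ℝ, E) p) ((extChartAt 𝓘(ℝ, E) p).symm y)) =
      ContinuousLinearMap.id ℝ E := by
  have h0 := (extChartAt 𝓘(ℝ, E) p).map_target hy
  have h1 : MDifferentiableAt 𝓘(ℝ, E) 𝓘(ℝ, E) (extChartAt 𝓘(ℝ, E) p)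
      ((extChartAt 𝓘(ℝ, E) p).symm y) :=
    (contMDiffAt_extChartAt' (n := ∞) (by simpa using h0)).mdifferentiableAt (by simp)
  have h2 : MDifferentiableAt 𝓘(ℝ, E) 𝓘(ℝ, E) (extChartAt 𝓘(ℝ, E) p).symm y :=
    (contMDiffAt_extChartAt_symm p hy).mdifferentiableAt (by simp)
  rw [← modelDeriv_comp ((extChartAt 𝓘(ℝ, E) p).right_inv hy) h2 h1,
    ← modelDeriv_id ((extChartAt 𝓘(ℝ, E) p).symm y)]
  refine modelDeriv_congr ?_
  filter_upwards [(isOpen_extChartAt_source p).mem_nhds h0] with q hq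
  exact (extChartAt 𝓘(ℝ, E) p).left_inv hq

theorem modelDeriv_extChartAt_comp_symm {M : Type*} [TopologicalSpace M] [ChartedSpace E M]
    [IsManifold 𝓘(ℝ, E) ∞ M] (p : M) {y : E} (hy : y ∈ (extChartAt 𝓘(ℝ, E) p).target) :
    (modelDeriv E E (extChartAt 𝓘(ℝ, E) p) ((extChartAt 𝓘(ℝ, E) p).symm y)).comp
      (modelDeriv E E (extChartAt 𝓘(ℝ, E) p).symm y) =
      ContinuousLinearMap.id ℝ E := by
  have h0 := (extChartAt 𝓘(ℝ, E) p).map_target hy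
  have h1 : MDifferentiableAt 𝓘(ℝ, E) 𝓘(ℝ, E) (extChartAt 𝓘(ℝ, E) p)
      ((extChartAt 𝓘(ℝ, E) p).symm y) :=
    (contMDiffAt_extChartAt' (n := ∞) (by simpa using h0)).mdifferentiableAt (by simp)
  have h2 : MDifferentiableAt 𝓘(ℝ, E) 𝓘(ℝ, E) (extChartAt 𝓘(ℝ, E) p).symm y :=
    (contMDiffAt_extChartAt_symm p hy).mdifferentiableAt (by simp)
  rw [← modelDeriv_comp rfl h1 h2, ← modelDeriv_id y]
  refine modelDeriv_congr ?_
  filter_upwards [(isOpen_extChartAt_target p).mem_nhds hy] with q hq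
  exact (extChartAt 𝓘(ℝ, E) p).right_inv hq

/-- At `x` both factors are the identity, so the product rule for `A B = 1` reads `A' + B' = 0`. -/
theorem fderiv_comp_eq_id {X : Type*} [NormedAddCommGroup X] [NormedSpace ℝ X]
    {A B : X → E →L[ℝ] E} {x : X} (hA : DifferentiableAt ℝ A x) (hB : DifferentiableAt ℝ B x)
    (hAx : A x = ContinuousLinearMap.id ℝ E)
    (h : ∀ᶠ y in nhds x, (A y).comp (B y) = ContinuousLinearMap.id ℝ E) (η : X) (ζ : E) :
    fderiv ℝ A x η ζ = -fderiv ℝ B x η ζ := by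
  have hBx : B x = ContinuousLinearMap.id ℝ E := by simpa [hAx] using h.self_of_nhds
  have h1 := (hA.hasFDerivAt.clm_comp hB.hasFDerivAt).fderiv
  have h2 : (fun y => (A y).comp (B y)) =ᶠ[nhds x] fun _ => ContinuousLinearMap.id ℝ E := h
  rw [h2.fderiv_eq, hAx, hBx] at h1
  have h3 := congrArg (fun L : X →L[ℝ] E →L[ℝ] E => L η ζ) h1
  simp only [fderiv_fun_const, Pi.zero_apply] at h3
  rw [eq_neg_iff_add_eq_zero]
  simpa [add_comm] using h3.symm

variable (E H) in
/-- The coordinates of `1` in the preferred chart around `1`. -/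
noncomputable def oneInChart : E := extChartAt 𝓘(ℝ, E) (1 : H) 1

theorem oneInChart_mem : oneInChart E H ∈ (extChartAt 𝓘(ℝ, E) (1 : H)).target :=
  mem_extChartAt_target (1 : H)

theorem extChartAt_symm_oneInChart :
    (extChartAt 𝓘(ℝ, E) (1 : H)).symm (oneInChart E H) = 1 :=
  extChartAt_to_inv (1 : H)

variable [FiniteDimensional ℝ E] [LieGroup 𝓘(ℝ, E) ∞ H]

variable (E H) in
/-- The Lie bracket of the Lie algebra of `H`, on the model space. -/
noncomputable def lieBracketL : E →L[ℝ] E →L[ℝ] E :=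
  LinearMap.toContinuousBilinearMap
    ((LieModule.toEnd ℝ (GroupLieAlgebra 𝓘(ℝ, E) H) (GroupLieAlgebra 𝓘(ℝ, E) H) :
      GroupLieAlgebra 𝓘(ℝ, E) H →ₗ[ℝ] GroupLieAlgebra 𝓘(ℝ, E) H →ₗ[ℝ]
        GroupLieAlgebra 𝓘(ℝ, E) H) : E →ₗ[ℝ] E →ₗ[ℝ] E)

theorem lieBracketL_skew (x y : E) : lieBracketL E H x y = -lieBracketL E H y x :=
  (lie_skew (L := GroupLieAlgebra 𝓘(ℝ, E) H) x y).symm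

theorem lieBracketL_jacobi (x y z : E) :
    lieBracketL E H x (lieBracketL E H y z) =
      lieBracketL E H (lieBracketL E H x y) z + lieBracketL E H y (lieBracketL E H x z) :=
  LieRing.leibniz_lie (L := GroupLieAlgebra 𝓘(ℝ, E) H) x y z

variable (E H) in
/-- Multiplication in the preferred chart around `1`. -/
noncomputable def mulInChart (x : E × E) : E :=
  binaryInCharts (fun x : H × H => x.1 * x.2) 1 1 1 x

theorem contDiffAt_mulInChart :
    ContDiffAt ℝ ∞ (mulInChart E H) (oneInChart E H, oneInChart E H) :=
  contDiffAt_binaryInCharts (contMDiff_fst.mul contMDiff_snd) oneInChart_mem oneInChart_mem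
    (by
      rw [extChartAt_symm_oneInChart]
      change (1 * 1 : H) ∈ _
      rw [mul_one]
      exact mem_extChartAt_source (1 : H))

variable (E H) in
/-- The differential at `1` of left translations, in the preferred chart around `1`. -/
noncomputable def leftTranslationInChart (y : E) : E →L[ℝ] E :=
  fderiv ℝ (fun z => mulInChart E H (y, z)) (oneInChart E H)

variable (E H) in
/-- The differential at `1` of right translations, in the preferred chart around `1`. -/
noncomputable def rightTranslationInChart (y : E) : E →L[ℝ] E :=
  fderiv ℝ (fun z => mulInChart E H (z, y)) (oneInChart E H)

/-- Writing the partial derivative through the full derivative of the multiplication turns the next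
derivative into a mixed second derivative. -/
theorem leftTranslationInChart_eventuallyEq :
    leftTranslationInChart E H =ᶠ[nhds (oneInChart E H)] fun y =>
      (fderiv ℝ (mulInChart E H) (y, oneInChart E H)).comp (ContinuousLinearMap.inr ℝ E E) := by
  have h := (contDiffAt_mulInChart (E := E) (H := H)).of_le (m := 1) (by simp)
  have h1 : ContinuousAt (fun y : E => (y, oneInChart E H)) (oneInChart E H) := by fun_prop
  filter_upwards [h1.eventually (h.eventually (by simp))] with y hy
  have h2 : HasFDerivAt (fun z : E => (y, z)) (ContinuousLinearMap.inr ℝ E E) (oneInChart E H) :=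
    hasFDerivAt_prodMk_right _ _
  exact ((hy.differentiableAt (by simp)).hasFDerivAt.comp (oneInChart E H) h2).fderiv

theorem rightTranslationInChart_eventuallyEq :
    rightTranslationInChart E H =ᶠ[nhds (oneInChart E H)] fun y =>
      (fderiv ℝ (mulInChart E H) (oneInChart E H, y)).comp (ContinuousLinearMap.inl ℝ E E) := by
  have h := (contDiffAt_mulInChart (E := E) (H := H)).of_le (m := 1) (by simp)
  have h1 : ContinuousAt (fun y : E => (oneInChart E H, y)) (oneInChart E H) := by fun_prop
  filter_upwards [h1.eventually (h.eventually (by simp))] with y hy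
  have h2 : HasFDerivAt (fun z : E => (z, y)) (ContinuousLinearMap.inl ℝ E E) (oneInChart E H) :=
    hasFDerivAt_prodMk_left _ _
  exact ((hy.differentiableAt (by simp)).hasFDerivAt.comp (oneInChart E H) h2).fderiv

/-- The second derivative of the multiplication. -/
theorem hasFDerivAt_fderiv_mulInChart :
    HasFDerivAt (fderiv ℝ (mulInChart E H))
      (fderiv ℝ (fderiv ℝ (mulInChart E H)) (oneInChart E H, oneInChart E H))
      (oneInChart E H, oneInChart E H) :=
  ((contDiffAt_mulInChart.fderiv_right (m := ∞) (by simp)).differentiableAt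
    (by simp)).hasFDerivAt

theorem differentiableAt_leftTranslationInChart :
    DifferentiableAt ℝ (leftTranslationInChart E H) (oneInChart E H) := by
  refine DifferentiableAt.congr_of_eventuallyEq ?_ leftTranslationInChart_eventuallyEq
  have h1 : DifferentiableAt ℝ (fun y : E => (y, oneInChart E H)) (oneInChart E H) := by fun_prop
  exact (DifferentiableAt.comp (f := fun y : E => (y, oneInChart E H)) (oneInChart E H)
    hasFDerivAt_fderiv_mulInChart.differentiableAt h1).clm_comp (differentiableAt_const _)

theorem differentiableAt_rightTranslationInChart :
    DifferentiableAt ℝ (rightTranslationInChart E H) (oneInChart E H) := by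
  refine DifferentiableAt.congr_of_eventuallyEq ?_ rightTranslationInChart_eventuallyEq
  have h1 : DifferentiableAt ℝ (Prod.mk (oneInChart E H)) (oneInChart E H) :=
    (hasFDerivAt_prodMk_right _ _).differentiableAt
  exact (hasFDerivAt_fderiv_mulInChart.differentiableAt.comp (oneInChart E H) h1).clm_comp
    (differentiableAt_const _)

theorem fderiv_leftTranslationInChart (η ζ : E) :
    fderiv ℝ (leftTranslationInChart E H) (oneInChart E H) η ζ =
      fderiv ℝ (fderiv ℝ (mulInChart E H)) (oneInChart E H, oneInChart E H) (η, 0) (0, ζ) := by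
  have h2 : HasFDerivAt (fun z : E => (z, oneInChart E H)) (ContinuousLinearMap.inl ℝ E E)
      (oneInChart E H) := hasFDerivAt_prodMk_left _ _
  have h3 := hasFDerivAt_fderiv_mulInChart.comp (oneInChart E H) h2
  have h4 := h3.clm_comp (hasFDerivAt_const (ContinuousLinearMap.inr ℝ E E) (oneInChart E H))
  rw [leftTranslationInChart_eventuallyEq.fderiv_eq]
  have h5 := h4.fderiv
  simp only [Function.comp_def] at h5
  rw [h5]
  simp

/-- Both sides are mixed second derivatives of the multiplication at `(1, 1)`; the symmetry of the
second derivative exchanges them. -/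
theorem fderiv_rightTranslationInChart (η ζ : E) :
    fderiv ℝ (rightTranslationInChart E H) (oneInChart E H) η ζ =
      fderiv ℝ (leftTranslationInChart E H) (oneInChart E H) ζ η := by
  have h2 : HasFDerivAt (fun z : E => (oneInChart E H, z)) (ContinuousLinearMap.inr ℝ E E)
      (oneInChart E H) := hasFDerivAt_prodMk_right _ _
  have h3 := hasFDerivAt_fderiv_mulInChart.comp (oneInChart E H) h2
  have h4 := h3.clm_comp (hasFDerivAt_const (ContinuousLinearMap.inl ℝ E E) (oneInChart E H))
  rw [rightTranslationInChart_eventuallyEq.fderiv_eq, fderiv_leftTranslationInChart]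
  have h5 := h4.fderiv
  simp only [Function.comp_def] at h5
  rw [h5]
  have h6 : IsSymmSndFDerivAt ℝ (mulInChart E H) (oneInChart E H, oneInChart E H) :=
    contDiffAt_mulInChart.isSymmSndFDerivAt (by
      rw [minSmoothness_of_isRCLikeNormedField]; exact WithTop.coe_le_coe.2 le_top)
  simpa using h6 (0, η) (ζ, 0)

theorem leftTranslationInChart_eq {y : E} (hy : y ∈ (extChartAt 𝓘(ℝ, E) (1 : H)).target) :
    leftTranslationInChart E H y =
      (modelDeriv E E (extChartAt 𝓘(ℝ, E) (1 : H)) ((extChartAt 𝓘(ℝ, E) (1 : H)).symm y)).comp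
        (modelDeriv E E (fun k : H => (extChartAt 𝓘(ℝ, E) (1 : H)).symm y * k) 1) := by
  set h := (extChartAt 𝓘(ℝ, E) (1 : H)).symm y with hh
  have h0 : h ∈ (extChartAt 𝓘(ℝ, E) (1 : H)).source := (extChartAt 𝓘(ℝ, E) (1 : H)).map_target hy
  have h1 : MDifferentiableAt 𝓘(ℝ, E) 𝓘(ℝ, E) (extChartAt 𝓘(ℝ, E) (1 : H)) h :=
    mdifferentiableAt_extChartAt (by simpa using h0)
  have h2 : MDifferentiableAt 𝓘(ℝ, E) 𝓘(ℝ, E) (extChartAt 𝓘(ℝ, E) (1 : H)).symm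
      (oneInChart E H) :=
    (contMDiffAt_extChartAt_symm (1 : H) oneInChart_mem).mdifferentiableAt (by simp)
  have h3 := mdifferentiableAt_leftTranslation (E := E) h 1
  have h4 := modelDeriv_comp (f := fun k : H => h * k) (mul_one h) h1 h3
  have h5 := modelDeriv_comp extChartAt_symm_oneInChart
    (MDifferentiableAt.comp_of_eq (I' := 𝓘(ℝ, E)) 1 h1 h3 (mul_one h)) h2
  rw [oneInChart, modelDeriv_extChartAt_symm_self, ContinuousLinearMap.comp_id,
    modelDeriv_eq_fderiv, h4] at h5
  exact h5

theorem rightTranslationInChart_eq {y : E} (hy : y ∈ (extChartAt 𝓘(ℝ, E) (1 : H)).target) :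
    rightTranslationInChart E H y =
      (modelDeriv E E (extChartAt 𝓘(ℝ, E) (1 : H)) ((extChartAt 𝓘(ℝ, E) (1 : H)).symm y)).comp
        (modelDeriv E E (fun k : H => k * (extChartAt 𝓘(ℝ, E) (1 : H)).symm y) 1) := by
  set h := (extChartAt 𝓘(ℝ, E) (1 : H)).symm y with hh
  have h0 : h ∈ (extChartAt 𝓘(ℝ, E) (1 : H)).source := (extChartAt 𝓘(ℝ, E) (1 : H)).map_target hy
  have h1 : MDifferentiableAt 𝓘(ℝ, E) 𝓘(ℝ, E) (extChartAt 𝓘(ℝ, E) (1 : H)) h :=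
    mdifferentiableAt_extChartAt (by simpa using h0)
  have h2 : MDifferentiableAt 𝓘(ℝ, E) 𝓘(ℝ, E) (extChartAt 𝓘(ℝ, E) (1 : H)).symm
      (oneInChart E H) :=
    (contMDiffAt_extChartAt_symm (1 : H) oneInChart_mem).mdifferentiableAt (by simp)
  have h3 := mdifferentiableAt_rightTranslation (E := E) h 1
  have h4 := modelDeriv_comp (f := fun k : H => k * h) (one_mul h) h1 h3
  have h5 := modelDeriv_comp extChartAt_symm_oneInChart
    (MDifferentiableAt.comp_of_eq (I' := 𝓘(ℝ, E)) 1 h1 h3 (one_mul h)) h2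
  rw [oneInChart, modelDeriv_extChartAt_symm_self, ContinuousLinearMap.comp_id,
    modelDeriv_eq_fderiv, h4] at h5
  exact h5

theorem leftMaurerCartanInChart_comp {y : E}
    (hy : y ∈ (extChartAt 𝓘(ℝ, E) (1 : H)).target) :
    (leftMaurerCartanInChart E (1 : H) y).comp (leftTranslationInChart E H y) =
      ContinuousLinearMap.id ℝ E := by
  rw [leftTranslationInChart_eq hy, leftMaurerCartanInChart, ContinuousLinearMap.comp_assoc,
    ← ContinuousLinearMap.comp_assoc _ _ (modelDeriv E E (fun k : H => _ * k) 1),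
    modelDeriv_symm_comp_extChartAt _ hy, ContinuousLinearMap.id_comp,
    leftMaurerCartan_comp_mul_left_one]

/-- `Ad_h θ_h` is the right-invariant Maurer–Cartan form, which inverts the differential of right
translation. -/
theorem adjointRep_comp_leftMaurerCartanInChart_comp {y : E}
    (hy : y ∈ (extChartAt 𝓘(ℝ, E) (1 : H)).target) :
    ((adjointRep E ((extChartAt 𝓘(ℝ, E) (1 : H)).symm y)).comp
      (leftMaurerCartanInChart E (1 : H) y)).comp (rightTranslationInChart E H y) =
      ContinuousLinearMap.id ℝ E := by
  rw [rightTranslationInChart_eq hy, leftMaurerCartanInChart,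
    ← ContinuousLinearMap.comp_assoc (adjointRep E _), ← rightMaurerCartan_eq,
    ContinuousLinearMap.comp_assoc, ← ContinuousLinearMap.comp_assoc _ _ (modelDeriv E E (fun k : H => k * _) 1),
    modelDeriv_symm_comp_extChartAt _ hy, ContinuousLinearMap.id_comp,
    rightMaurerCartan_comp_mul_right_one]

/-- In the chart at `1` the left-invariant field of `v` is `y ↦ L(y) v`, with `L` the identity at
`1`, and the bracket of vector fields `V`, `W` is `DW(V) - DV(W)`. -/
theorem lieBracketL_eq_fderiv (η ζ : E) :
    lieBracketL E H η ζ =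
      fderiv ℝ (leftTranslationInChart E H) (oneInChart E H) η ζ -
        fderiv ℝ (leftTranslationInChart E H) (oneInChart E H) ζ η := by
  -- The first component unfolds the definition of the bracket. The fields are kept abstract, as
  -- only their germs at `1` matter.
  obtain ⟨V, hV, key⟩ : ∃ V : E → E → E,
      lieBracketL E H η ζ = (modelDeriv E E (extChartAt 𝓘(ℝ, E) (1 : H)) 1).inverse
        (VectorField.lieBracketWithin ℝ (V η) (V ζ)
          ((extChartAt 𝓘(ℝ, E) (1 : H)).symm ⁻¹' Set.univ ∩ Set.range 𝓘(ℝ, E))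
          (oneInChart E H)) ∧
      ∀ v, V v =ᶠ[nhds (oneInChart E H)] fun y => leftTranslationInChart E H y v := by
    refine ⟨fun v => VectorField.mpullbackWithin 𝓘(ℝ, E) 𝓘(ℝ, E)
      (extChartAt 𝓘(ℝ, E) (1 : H)).symm
      (mulInvariantVectorField (v : GroupLieAlgebra 𝓘(ℝ, E) H)) (Set.range 𝓘(ℝ, E)),
      rfl, fun v => ?_⟩
    filter_upwards [(isOpen_extChartAt_target (I := 𝓘(ℝ, E)) (1 : H)).mem_nhds oneInChart_mem]
      with y hy
    have h1 : (modelDeriv E E (extChartAt 𝓘(ℝ, E) (1 : H)).symm y).inverse =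
        modelDeriv E E (extChartAt 𝓘(ℝ, E) (1 : H)) ((extChartAt 𝓘(ℝ, E) (1 : H)).symm y) :=
      ContinuousLinearMap.inverse_eq (modelDeriv_symm_comp_extChartAt _ hy)
        (modelDeriv_extChartAt_comp_symm _ hy)
    have h2 : VectorField.mpullbackWithin 𝓘(ℝ, E) 𝓘(ℝ, E) (extChartAt 𝓘(ℝ, E) (1 : H)).symm
        (mulInvariantVectorField (v : GroupLieAlgebra 𝓘(ℝ, E) H)) (Set.range 𝓘(ℝ, E)) y =
        (modelDeriv E E (extChartAt 𝓘(ℝ, E) (1 : H)).symm y).inverse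
          (modelDeriv E E (fun k : H => (extChartAt 𝓘(ℝ, E) (1 : H)).symm y * k) 1 v) := by
      rw [modelWithCornersSelf_coe, Set.range_id, VectorField.mpullbackWithin_univ]
      rfl
    rw [h2, h1, leftTranslationInChart_eq hy]
    rfl
  rw [hV, modelDeriv_extChartAt_self, ContinuousLinearMap.inverse_id, ContinuousLinearMap.id_apply,
    modelWithCornersSelf_coe, Set.range_id, Set.preimage_univ, Set.inter_univ,
    VectorField.lieBracketWithin_univ]
  refine (Filter.EventuallyEq.lieBracket_vectorField_eq (key η) (key ζ)).trans ?_
  have hD := differentiableAt_leftTranslationInChart (E := E) (H := H)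
  have h4 : leftTranslationInChart E H (oneInChart E H) = ContinuousLinearMap.id ℝ E := by
    have := leftMaurerCartanInChart_comp (E := E) (H := H) oneInChart_mem
    rwa [leftMaurerCartanInChart, extChartAt_symm_oneInChart, leftMaurerCartan_one, oneInChart,
      modelDeriv_extChartAt_symm_self] at this
  rw [VectorField.lieBracket, h4, fderiv_clm_apply hD (differentiableAt_const _),
    fderiv_clm_apply hD (differentiableAt_const _)]
  simp

theorem leftMaurerCartanInChart_one :
    leftMaurerCartanInChart E (1 : H) (oneInChart E H) = ContinuousLinearMap.id ℝ E := by
  rw [leftMaurerCartanInChart, extChartAt_symm_oneInChart, leftMaurerCartan_one, oneInChart,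
      modelDeriv_extChartAt_symm_self, ContinuousLinearMap.comp_id]

theorem differentiableAt_leftMaurerCartanInChart :
    DifferentiableAt ℝ (leftMaurerCartanInChart E (1 : H)) (oneInChart E H) :=
  (contDiffAt_leftMaurerCartanInChart 1 oneInChart_mem).differentiableAt (by simp)

theorem fderiv_leftMaurerCartanInChart (η ζ : E) :
    fderiv ℝ (leftMaurerCartanInChart E (1 : H)) (oneInChart E H) η ζ =
      -fderiv ℝ (leftTranslationInChart E H) (oneInChart E H) η ζ := by
  refine fderiv_comp_eq_id differentiableAt_leftMaurerCartanInChart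
    differentiableAt_leftTranslationInChart leftMaurerCartanInChart_one ?_ η ζ
  filter_upwards [(isOpen_extChartAt_target (I := 𝓘(ℝ, E)) (1 : H)).mem_nhds oneInChart_mem]
    with y hy
  exact leftMaurerCartanInChart_comp hy

/-- The Maurer–Cartan equation at `1`. -/
theorem maurerCartan_equation (η ζ : E) :
    fderiv ℝ (leftMaurerCartanInChart E (1 : H)) (oneInChart E H) η ζ -
      fderiv ℝ (leftMaurerCartanInChart E (1 : H)) (oneInChart E H) ζ η =
      -lieBracketL E H η ζ := by
  rw [fderiv_leftMaurerCartanInChart, fderiv_leftMaurerCartanInChart, lieBracketL_eq_fderiv]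
  abel

variable (E H) in
/-- The adjoint representation in the preferred chart around `1`. -/
noncomputable def adjointRepInChart (y : E) : E →L[ℝ] E :=
  adjointRep E ((extChartAt 𝓘(ℝ, E) (1 : H)).symm y)

theorem differentiableAt_adjointRepInChart :
    DifferentiableAt ℝ (adjointRepInChart E H) (oneInChart E H) :=
  (contDiffAt_adjointRep 1 oneInChart_mem).differentiableAt (by simp)

theorem adjointRepInChart_one :
    adjointRepInChart E H (oneInChart E H) = ContinuousLinearMap.id ℝ E := by
  rw [adjointRepInChart, extChartAt_symm_oneInChart, adjointRep_one]

/-- The differential of the adjoint representation of `H` is that of its Lie algebra. -/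
theorem fderiv_adjointRepInChart (η ζ : E) :
    fderiv ℝ (adjointRepInChart E H) (oneInChart E H) η ζ = lieBracketL E H η ζ := by
  have hA := differentiableAt_adjointRepInChart (E := E) (H := H)
  have hθ := differentiableAt_leftMaurerCartanInChart (E := E) (H := H)
  -- From `Ad θ R = 1` near `1` one gets `Ad' + θ' = -R'`. Here `θ' = -L'` and `R'(η) ζ = L'(ζ) η`,
  -- hence `Ad'(η) ζ = L'(η) ζ - L'(ζ) η`.
  have h1 := fderiv_comp_eq_id (hA.clm_comp hθ)
    differentiableAt_rightTranslationInChart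
    (by rw [adjointRepInChart_one, leftMaurerCartanInChart_one, ContinuousLinearMap.comp_id])
    (by
      filter_upwards [(isOpen_extChartAt_target (I := 𝓘(ℝ, E)) (1 : H)).mem_nhds oneInChart_mem]
        with y hy
      exact adjointRep_comp_leftMaurerCartanInChart_comp hy) η ζ
  rw [(hA.hasFDerivAt.clm_comp hθ.hasFDerivAt).fderiv, adjointRepInChart_one,
    leftMaurerCartanInChart_one, fderiv_rightTranslationInChart] at h1
  simp only [_root_.add_apply, ContinuousLinearMap.comp_apply,
    ContinuousLinearMap.compL_apply, ContinuousLinearMap.flip_apply,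
    ContinuousLinearMap.id_comp, ContinuousLinearMap.comp_id,
    fderiv_leftMaurerCartanInChart] at h1
  rw [lieBracketL_eq_fderiv, sub_eq_neg_add, ← h1]
  abel

theorem modelDeriv_adjointRep_one (η ζ : E) :
    modelDeriv E (E →L[ℝ] E) (adjointRep E : H → E →L[ℝ] E) 1 η ζ = lieBracketL E H η ζ := by
  have h1 : MDifferentiableAt 𝓘(ℝ, E) 𝓘(ℝ, E →L[ℝ] E) (adjointRep E : H → E →L[ℝ] E) 1 :=
    contMDiff_adjointRep.mdifferentiableAt (by simp)
  have h2 : MDifferentiableAt 𝓘(ℝ, E) 𝓘(ℝ, E) (extChartAt 𝓘(ℝ, E) (1 : H)).symm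
      (oneInChart E H) :=
    (contMDiffAt_extChartAt_symm (1 : H) oneInChart_mem).mdifferentiableAt (by simp)
  have h3 := modelDeriv_comp extChartAt_symm_oneInChart h1 h2
  rw [oneInChart, modelDeriv_extChartAt_symm_self, ContinuousLinearMap.comp_id] at h3
  rw [← fderiv_adjointRepInChart, ← h3, modelDeriv_eq_fderiv]
  rfl

end LieBracket

/-! ### The splitting of `𝔥` by the involution -/

section Involution

variable {E : Type*} [NormedAddCommGroup E] [NormedSpace ℝ E]
  {H : Type*} [TopologicalSpace H] [ChartedSpace E H] [Group H]

variable (E) in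
/-- The differential of the involution, on the model space. -/
noncomputable def involutionDeriv (σ : H ≃* H) : E →L[ℝ] E := modelDeriv E E σ 1

variable (E) in
/-- The projection to `𝔭` along `𝔤`. -/
noncomputable def pProj (σ : H ≃* H) : E →L[ℝ] E :=
  (1 / 2 : ℝ) • (ContinuousLinearMap.id ℝ E - involutionDeriv E σ)

variable (E) in
/-- The projection to `𝔤` along `𝔭`. -/
noncomputable def gProj (σ : H ≃* H) : E →L[ℝ] E :=
  (1 / 2 : ℝ) • (ContinuousLinearMap.id ℝ E + involutionDeriv E σ)

theorem pProj_apply (σ : H ≃* H) (x : E) :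
    pProj E σ x = (1 / 2 : ℝ) • (x - involutionDeriv E σ x) := rfl

theorem gProj_apply (σ : H ≃* H) (x : E) :
    gProj E σ x = (1 / 2 : ℝ) • (x + involutionDeriv E σ x) := rfl

theorem gProj_add_pProj (σ : H ≃* H) (x : E) : gProj E σ x + pProj E σ x = x := by
  rw [pProj_apply, gProj_apply]
  module

theorem mem_gPart_iff {σ : H ≃* H} {x : E} : x ∈ gPart E σ ↔ involutionDeriv E σ x = x := by
  have h : x ∈ gPart E σ ↔ involutionDeriv E σ x = (1 : ℝ) • x :=
    Module.End.mem_eigenspace_iff (f := (dInvolution (E := E) σ).toLinearMap) (μ := 1) (x := x)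
  rwa [one_smul] at h

theorem mem_pPart_iff {σ : H ≃* H} {x : E} : x ∈ pPart E σ ↔ involutionDeriv E σ x = -x := by
  have h : x ∈ pPart E σ ↔ involutionDeriv E σ x = (-1 : ℝ) • x :=
    Module.End.mem_eigenspace_iff (f := (dInvolution (E := E) σ).toLinearMap) (μ := -1) (x := x)
  rwa [neg_one_smul] at h

theorem mem_gPart_iff_pProj {σ : H ≃* H} {x : E} : x ∈ gPart E σ ↔ pProj E σ x = 0 := by
  rw [mem_gPart_iff, pProj_apply, smul_eq_zero, sub_eq_zero, eq_comm]
  simp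

variable {σ : H ≃* H} {G : Subgroup H}

theorem IsSymmetricPair.mdifferentiableAt (hσ : IsSymmetricPair E σ G) (h : H) :
    MDifferentiableAt 𝓘(ℝ, E) 𝓘(ℝ, E) σ h := hσ.smooth.mdifferentiableAt (by simp)

theorem IsSymmetricPair.involutionDeriv_involutionDeriv (hσ : IsSymmetricPair E σ G) (x : E) :
    involutionDeriv E σ (involutionDeriv E σ x) = x := by
  have h := modelDeriv_comp (map_one σ) (hσ.mdifferentiableAt 1) (hσ.mdifferentiableAt 1)
  have h1 : (σ ∘ σ : H → H) = fun h => h := funext hσ.involutive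
  rw [h1, modelDeriv_id] at h
  exact (congrArg (fun L : E →L[ℝ] E => L x) h).symm

theorem IsSymmetricPair.involutionDeriv_pProj (hσ : IsSymmetricPair E σ G) (x : E) :
    involutionDeriv E σ (pProj E σ x) = -pProj E σ x := by
  rw [pProj_apply, map_smul, map_sub, hσ.involutionDeriv_involutionDeriv]
  module

theorem IsSymmetricPair.involutionDeriv_gProj (hσ : IsSymmetricPair E σ G) (x : E) :
    involutionDeriv E σ (gProj E σ x) = gProj E σ x := by
  rw [gProj_apply, map_smul, map_add, hσ.involutionDeriv_involutionDeriv]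
  module

variable [LieGroup 𝓘(ℝ, E) ∞ H]

theorem IsSymmetricPair.adjointRep_comp_involutionDeriv (hσ : IsSymmetricPair E σ G) (h : H) :
    (adjointRep E (σ h)).comp (involutionDeriv E σ) =
      (involutionDeriv E σ).comp (adjointRep E h) := by
  rw [adjointRep, adjointRep, involutionDeriv,
    ← modelDeriv_comp (map_one σ) (mdifferentiableAt_conj _ _) (hσ.mdifferentiableAt 1),
    ← modelDeriv_comp (by simp) (hσ.mdifferentiableAt 1) (mdifferentiableAt_conj _ _)]
  congr 1
  funext k
  simp

/-- Since `σ g = g`, conjugation by `g` commutes with `σ`, so `Ad_g` commutes with `s` and with the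
projections built from it. -/
theorem IsSymmetricPair.pProj_adjointRep (hσ : IsSymmetricPair E σ G) {g : H} (hg : g ∈ G)
    (x : E) : pProj E σ (adjointRep E g x) = adjointRep E g (pProj E σ x) := by
  have h := congrArg (fun L : E →L[ℝ] E => L x) (hσ.adjointRep_comp_involutionDeriv g)
  simp only [ContinuousLinearMap.comp_apply, hσ.le_fixed g hg] at h
  rw [pProj_apply, pProj_apply, map_smul, map_sub, h]

variable [FiniteDimensional ℝ E]

/-- The differential at `1` of an endomorphism of a Lie group respects the Lie bracket. -/
theorem modelDeriv_monoidHom_lieBracketL (τ : H →* H)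
    (hτ : MDifferentiableAt 𝓘(ℝ, E) 𝓘(ℝ, E) τ 1) (x y : E) :
    modelDeriv E E τ 1 (lieBracketL E H x y) =
      lieBracketL E H (modelDeriv E E τ 1 x) (modelDeriv E E τ 1 y) := by
  have hA : MDifferentiable 𝓘(ℝ, E) 𝓘(ℝ, E →L[ℝ] E) (adjointRep E : H → E →L[ℝ] E) :=
    contMDiff_adjointRep.mdifferentiable (by simp)
  set s := modelDeriv E E τ 1 with hs
  -- The identity `τ(h k h⁻¹) = τ(h) τ(k) τ(h)⁻¹` is differentiated first in `k`, here, and then in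
  -- `h`, where the derivative of `Ad` produces the bracket.
  have h0 : ∀ h : H, (adjointRep E (τ h)).comp s = s.comp (adjointRep E h) := fun h => by
    rw [adjointRep, adjointRep, hs,
      ← modelDeriv_comp (map_one τ) (mdifferentiableAt_conj _ _) hτ,
      ← modelDeriv_comp (by simp) hτ (mdifferentiableAt_conj _ _)]
    congr 1
    funext k
    simp
  have h1 := modelDeriv_comp (map_one τ) (hA 1) hτ
  let R : (E →L[ℝ] E) →L[ℝ] (E →L[ℝ] E) := (ContinuousLinearMap.compL ℝ E E E).flip s
  let S : (E →L[ℝ] E) →L[ℝ] (E →L[ℝ] E) := ContinuousLinearMap.compL ℝ E E E s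
  have hR : modelDeriv (E →L[ℝ] E) (E →L[ℝ] E) R (adjointRep E (1 : H)) = R := by
    rw [modelDeriv_eq_fderiv, R.fderiv]
  have hS : modelDeriv (E →L[ℝ] E) (E →L[ℝ] E) S (adjointRep E (1 : H)) = S := by
    rw [modelDeriv_eq_fderiv, S.fderiv]
  have h2 := modelDeriv_comp (f := adjointRep E ∘ τ) (p := (1 : H))
    (q := adjointRep E (1 : H)) (by simp)
    R.differentiableAt.mdifferentiableAt ((hA _).comp 1 hτ)
  have h3 := modelDeriv_comp (f := (adjointRep E : H → E →L[ℝ] E)) (p := (1 : H)) rfl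
    S.differentiableAt.mdifferentiableAt (hA 1)
  have h4 : R ∘ (adjointRep E ∘ τ) = S ∘ (adjointRep E : H → E →L[ℝ] E) := funext h0
  rw [h4, h3, hS, hR, h1] at h2
  have h5 := congrArg (fun L : E →L[ℝ] E →L[ℝ] E => L x y) h2
  have h6 : s (modelDeriv E (E →L[ℝ] E) (adjointRep E : H → E →L[ℝ] E) 1 x y) =
    modelDeriv E (E →L[ℝ] E) (adjointRep E : H → E →L[ℝ] E) 1 (s x) (s y) := h5
  rwa [modelDeriv_adjointRep_one, modelDeriv_adjointRep_one] at h6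

theorem IsSymmetricPair.involutionDeriv_lieBracketL (hσ : IsSymmetricPair E σ G) (x y : E) :
    involutionDeriv E σ (lieBracketL E H x y) =
      lieBracketL E H (involutionDeriv E σ x) (involutionDeriv E σ y) :=
  modelDeriv_monoidHom_lieBracketL σ.toMonoidHom (hσ.mdifferentiableAt 1) x y

theorem adjointRep_lieBracketL (g : H) (x y : E) :
    adjointRep E g (lieBracketL E H x y) =
      lieBracketL E H (adjointRep E g x) (adjointRep E g y) :=
  modelDeriv_monoidHom_lieBracketL (MulAut.conj g).toMonoidHom (mdifferentiableAt_conj g 1) x y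

/-- `s` is an automorphism, so the brackets `[𝔤, 𝔤]` and `[𝔭, 𝔭]` lie in `𝔤`; only mixed brackets
reach `𝔭`. -/
theorem IsSymmetricPair.pProj_lieBracketL (hσ : IsSymmetricPair E σ G) (x y : E) :
    pProj E σ (lieBracketL E H x y) =
      lieBracketL E H (gProj E σ x) (pProj E σ y) -
        lieBracketL E H (gProj E σ y) (pProj E σ x) := by
  conv_lhs => rw [pProj_apply, hσ.involutionDeriv_lieBracketL]
  rw [lieBracketL_skew (gProj E σ y)]
  simp only [pProj_apply, gProj_apply, map_smul, map_sub, map_add, _root_.smul_apply,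
    _root_.add_apply, _root_.sub_apply]
  module

end Involution

/-! ### Algebra of the Legendrian form -/

section Legendrian

variable {E : Type*} [NormedAddCommGroup E] [NormedSpace ℝ E] [FiniteDimensional ℝ E]
  {H : Type*} [TopologicalSpace H] [ChartedSpace E H] [Group H] [LieGroup 𝓘(ℝ, E) ∞ H]
  {σ : H ≃* H} {G : Subgroup H}
  {Λ : LinearMap.BilinForm ℝ (GroupLieAlgebra 𝓘(ℝ, E) H)}

variable (Λ) in
/-- A bilinear form on the Lie algebra, as a form on the model space. -/
def formOnModel : E →ₗ[ℝ] E →ₗ[ℝ] ℝ := Λ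

variable (Λ) in
/-- The trilinear form `Λ(x, [y, z])`, on the model space. -/
noncomputable def trilin (x y z : E) : ℝ := formOnModel Λ x (lieBracketL E H y z)

theorem trilin_add_left (x x' y z : E) :
    trilin Λ (x + x') y z = trilin Λ x y z + trilin Λ x' y z := by
  simp [trilin]

theorem trilin_sub_left (x x' y z : E) :
    trilin Λ (x - x') y z = trilin Λ x y z - trilin Λ x' y z := by
  simp [trilin]

theorem trilin_swap_right (x y z : E) : trilin Λ x y z = -trilin Λ x z y := by
  rw [trilin, trilin, lieBracketL_skew, map_neg]

theorem IsLegendrianForm.form_symm (hΛ : IsLegendrianForm σ Λ) (x y : E) :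
    formOnModel Λ x y = formOnModel Λ y x := hΛ.symm x y

theorem IsLegendrianForm.form_skew (hΛ : IsLegendrianForm σ Λ) (x y : E) :
    formOnModel Λ (involutionDeriv E σ x) y = -formOnModel Λ x (involutionDeriv E σ y) :=
  hΛ.skew x y

theorem IsLegendrianForm.form_lieBracketL (hΛ : IsLegendrianForm σ Λ) (x y z : E) :
    formOnModel Λ (lieBracketL E H x y) z = -formOnModel Λ y (lieBracketL E H x z) :=
  hΛ.ad_invariant x y z

theorem IsLegendrianForm.form_adjointRep (hΛ : IsLegendrianForm σ Λ) (h : H) (x y : E) :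
    formOnModel Λ (adjointRep E h x) y = formOnModel Λ x (adjointRep E h⁻¹ y) :=
  hΛ.Ad_invariant h x y

/-- Skewness of `s` gives `Λ(x, y) = -Λ(x, y)`. The same sign argument works on `𝔭`, where the two
minus signs cancel. -/
theorem IsLegendrianForm.form_fixed (hΛ : IsLegendrianForm σ Λ) {x y : E}
    (hx : involutionDeriv E σ x = x) (hy : involutionDeriv E σ y = y) :
    formOnModel Λ x y = 0 := by
  have h := hΛ.form_skew x y
  rw [hx, hy] at h
  linarith

theorem IsLegendrianForm.form_antifixed (hΛ : IsLegendrianForm σ Λ) {x y : E}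
    (hx : involutionDeriv E σ x = -x) (hy : involutionDeriv E σ y = -y) :
    formOnModel Λ x y = 0 := by
  have h := hΛ.form_skew x y
  rw [hx, hy, map_neg, map_neg, LinearMap.neg_apply] at h
  linarith

/-- Invariance and symmetry of `Λ` combine; with `trilin_swap_right` the trilinear form becomes
totally skew. -/
theorem IsLegendrianForm.trilin_swap_left (hΛ : IsLegendrianForm σ Λ) (x y z : E) :
    trilin Λ x y z = -trilin Λ y x z := by
  have h := hΛ.form_lieBracketL z x y
  rw [hΛ.form_symm] at h
  rw [trilin_swap_right, trilin_swap_right y, trilin, trilin, h, neg_neg]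

/-- `ad u` is skew for `Λ` and, by the Jacobi identity, a derivation of the bracket. -/
theorem IsLegendrianForm.trilin_invariant (hΛ : IsLegendrianForm σ Λ) (u x y z : E) :
    trilin Λ (lieBracketL E H u x) y z + trilin Λ x (lieBracketL E H u y) z +
      trilin Λ x y (lieBracketL E H u z) = 0 := by
  rw [trilin, trilin, trilin, hΛ.form_lieBracketL, lieBracketL_jacobi, map_add]
  ring

/-- For `ζ ∈ 𝔥` the `𝔤`-part of `ζ` does not contribute to `Λ(ζ, [x, y])`, `x, y ∈ 𝔭`. -/
theorem IsLegendrianForm.trilin_pProj_left (hΛ : IsLegendrianForm σ Λ)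
    (hσ : IsSymmetricPair E σ G) (ζ x y : E) :
    trilin Λ (pProj E σ ζ) (pProj E σ x) (pProj E σ y) =
      trilin Λ ζ (pProj E σ x) (pProj E σ y) := by
  conv_rhs => rw [← gProj_add_pProj σ ζ, trilin_add_left]
  -- The bracket of two elements of `𝔭` lies in `𝔤`, and `𝔤` is isotropic.
  have h : trilin Λ (gProj E σ ζ) (pProj E σ x) (pProj E σ y) = 0 := by
    refine hΛ.form_fixed (hσ.involutionDeriv_gProj ζ) ?_
    rw [hσ.involutionDeriv_lieBracketL, hσ.involutionDeriv_pProj, hσ.involutionDeriv_pProj]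
    simp
  rw [h, zero_add]

/-- The Lie algebra identity behind the closedness of the three-form `Λ(π, [π, π])`. -/
theorem IsLegendrianForm.sum_trilin_lieBracketL (hΛ : IsLegendrianForm σ Λ)
    (hσ : IsSymmetricPair E σ G) (a b c d : E) :
    let p := pProj E σ
    let K := fun x y => p (lieBracketL E H x y)
    trilin Λ (K a b) (p c) (p d) - trilin Λ (K a c) (p b) (p d) +
      trilin Λ (K a d) (p b) (p c) + trilin Λ (K b c) (p a) (p d) -
      trilin Λ (K b d) (p a) (p c) + trilin Λ (K c d) (p a) (p b) = 0 := by
  intro p K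
  have hK : ∀ x y, K x y = lieBracketL E H (gProj E σ x) (p y) -
      lieBracketL E H (gProj E σ y) (p x) := hσ.pProj_lieBracketL
  have hI : ∀ u x y z, trilin Λ (lieBracketL E H u x) y z - trilin Λ (lieBracketL E H u y) x z +
      trilin Λ (lieBracketL E H u z) x y = 0 := by
    intro u x y z
    have h1 := hΛ.trilin_invariant u x y z
    have h2 := hΛ.trilin_swap_left x (lieBracketL E H u y) z
    have h3 := trilin_swap_right (Λ := Λ) x y (lieBracketL E H u z)
    have h4 := hΛ.trilin_swap_left x (lieBracketL E H u z) y
    linarith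
  simp only [hK, trilin_sub_left]
  -- The twelve terms are grouped by which argument supplies its `𝔤`-part; each group of three
  -- vanishes by invariance under that element.
  have h1 := hI (gProj E σ a) (p b) (p c) (p d)
  have h2 := hI (gProj E σ b) (p a) (p c) (p d)
  have h3 := hI (gProj E σ c) (p a) (p b) (p d)
  have h4 := hI (gProj E σ d) (p a) (p b) (p c)
  linarith

end Legendrian

/-! ### The forms `β(ξ)` and `Υ` on the group -/

section GroupForms

variable {E : Type*} [NormedAddCommGroup E] [NormedSpace ℝ E] [FiniteDimensional ℝ E]
  {H : Type*} [TopologicalSpace H] [ChartedSpace E H] [Group H] [LieGroup 𝓘(ℝ, E) ∞ H]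
  {σ : H ≃* H} {G : Subgroup H}
  {Λ : LinearMap.BilinForm ℝ (GroupLieAlgebra 𝓘(ℝ, E) H)}

theorem betaForm_apply (ξ : E) (h : H) (v : Fin 1 → E) :
    (betaForm σ Λ ξ h : E [⋀^Fin 1]→L[ℝ] ℝ) v =
      formOnModel Λ ξ (adjointRep E h (pProj E σ (leftMaurerCartan E h (v 0)))) := rfl

/-- By total skewness the six permutations contribute equally, and `6 · (1/3) = 2`. -/
theorem IsLegendrianForm.upsilonForm_apply (hΛ : IsLegendrianForm σ Λ) (h : H) (v : Fin 3 → E) :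
    (upsilonForm σ Λ h : E [⋀^Fin 3]→L[ℝ] ℝ) v =
      2 * trilin Λ (pProj E σ (leftMaurerCartan E h (v 0)))
        (pProj E σ (leftMaurerCartan E h (v 1))) (pProj E σ (leftMaurerCartan E h (v 2))) := by
  set w : Fin 3 → E := fun i => pProj E σ (leftMaurerCartan E h (v i)) with hw
  have h1 : (upsilonForm σ Λ h : E [⋀^Fin 3]→L[ℝ] ℝ) v =
      (1 / 3 : ℝ) * ∑ ε : Equiv.Perm (Fin 3), Equiv.Perm.sign ε •
        trilin Λ (w (ε 0)) (w (ε 1)) (w (ε 2)) := by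
    have h2 := ContinuousMultilinearMap.alternatization_apply_apply
      (f := (lieTrilinear Λ : ContinuousMultilinearMap ℝ (fun _ : Fin 3 => E) ℝ)) (v := w)
    exact congrArg (fun t : ℝ => (1 / 3 : ℝ) * t) h2
  have hsl := hΛ.trilin_swap_left
  have hsr := trilin_swap_right (Λ := Λ)
  have e1 := hsl (w 1) (w 0) (w 2)
  have e2 := hsr (w 0) (w 2) (w 1)
  have e3 := hsr (w 1) (w 2) (w 0)
  have e4 := hsl (w 2) (w 0) (w 1)
  have e5 := hsr (w 2) (w 1) (w 0)
  have hu : (Finset.univ : Finset (Equiv.Perm (Fin 3))) =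
      {1, Equiv.swap 0 1, Equiv.swap 0 2, Equiv.swap 1 2, Equiv.swap 0 1 * Equiv.swap 1 2,
        Equiv.swap 1 2 * Equiv.swap 0 1} := by decide
  rw [h1, hu, Finset.sum_insert (by decide), Finset.sum_insert (by decide),
    Finset.sum_insert (by decide), Finset.sum_insert (by decide), Finset.sum_insert (by decide),
    Finset.sum_singleton]
  have t1 : Equiv.swap (0 : Fin 3) 1 2 = 2 := by decide
  have t2 : Equiv.swap (0 : Fin 3) 2 1 = 1 := by decide
  have t3 : Equiv.swap (1 : Fin 3) 2 0 = 0 := by decide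
  have n1 : (0 : Fin 3) ≠ 1 := by decide
  have n2 : (0 : Fin 3) ≠ 2 := by decide
  have n3 : (1 : Fin 3) ≠ 2 := by decide
  simp only [Equiv.Perm.sign_one, Equiv.Perm.sign_swap n1, Equiv.Perm.sign_swap n2,
    Equiv.Perm.sign_swap n3, map_mul, Equiv.Perm.one_apply, Equiv.Perm.mul_apply,
    Equiv.swap_apply_left, Equiv.swap_apply_right, t1, t2, t3, one_smul, neg_mul_neg, mul_one,
    Units.neg_smul]
  change _ = 2 * trilin Λ (w 0) (w 1) (w 2)
  linarith

theorem betaForm_isSmooth (ξ : E) : (betaForm σ Λ ξ).IsSmooth := by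
  refine DiffForm.isSmooth_iff.2 fun p y hy => ?_
  have h1 : ContDiffAt ℝ ∞ (fun x => ContinuousAlternatingMap.ofSubsingletonLIE (𝕜 := ℝ) (E := E)
      (F := ℝ) (0 : Fin 1)
      ((LinearMap.toContinuousLinearMap (formOnModel Λ ξ)).comp
        ((adjointRep E ((extChartAt 𝓘(ℝ, E) p).symm x)).comp
          ((pProj E σ).comp (leftMaurerCartanInChart E p x))))) y := by
    have h2 := (contDiffAt_const (c := LinearMap.toContinuousLinearMap (formOnModel Λ ξ))).clm_comp
      ((contDiffAt_adjointRep p hy).clm_comp ((contDiffAt_const (c := pProj E σ)).clm_comp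
        (contDiffAt_leftMaurerCartanInChart p hy)))
    exact (ContinuousAlternatingMap.ofSubsingletonLIE (𝕜 := ℝ) (E := E) (F := ℝ)
      (0 : Fin 1)).toContinuousLinearEquiv.contDiff.contDiffAt.comp y h2
  exact h1

theorem upsilonForm_isSmooth : (upsilonForm σ Λ).IsSmooth := by
  refine DiffForm.isSmooth_iff.2 fun p y hy => ?_
  let U : E [⋀^Fin 3]→L[ℝ] ℝ := (1 / 3 : ℝ) • ContinuousMultilinearMap.alternatization
    (lieTrilinear Λ : ContinuousMultilinearMap ℝ (fun _ : Fin 3 => E) ℝ)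
  have h1 : ContDiffAt ℝ ∞ (fun x => U.compContinuousLinearMap
      ((pProj E σ).comp (leftMaurerCartanInChart E p x))) y :=
    contDiffAt_const.compContinuousLinearMap ((contDiffAt_const (c := pProj E σ)).clm_comp
        (contDiffAt_leftMaurerCartanInChart p hy))
  exact h1

theorem leftMaurerCartan_mul_left_apply (a h : H) (x : E) :
    leftMaurerCartan E (a * h) (modelDeriv E E (fun k : H => a * k) h x) =
      leftMaurerCartan E h x :=
  congrArg (fun L : E →L[ℝ] E => L x) (leftMaurerCartan_comp_mul_left a h)

theorem leftMaurerCartan_mul_right_apply (h g : H) (x : E) :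
    leftMaurerCartan E (h * g) (modelDeriv E E (fun k : H => k * g) h x) =
      adjointRep E g⁻¹ (leftMaurerCartan E h x) :=
  congrArg (fun L : E →L[ℝ] E => L x) (leftMaurerCartan_comp_mul_right h g)

theorem adjointRep_mul_apply (a b : H) (x : E) :
    adjointRep E (a * b) x = adjointRep E a (adjointRep E b x) :=
  congrArg (fun L : E →L[ℝ] E => L x) (adjointRep_mul a b)

theorem adjointRep_one_apply (x : E) : adjointRep E (1 : H) x = x :=
  congrArg (fun L : E →L[ℝ] E => L x) adjointRep_one

/-- `θ` is left-invariant, and the factor `Ad_a` crosses `Λ` as `Ad_{a⁻¹}`. Allowing all `a ∈ H` and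
`ξ ∈ 𝔥` is what later permits computing `dβ(ξ)` at `1` only. -/
theorem IsLegendrianForm.pullback_mul_left_betaForm (hΛ : IsLegendrianForm σ Λ) (a : H) (ξ : E) :
    DiffForm.pullback (E := E) (fun h : H => a * h) (betaForm σ Λ ξ) =
      betaForm σ Λ (adjointRep E a⁻¹ ξ) := by
  refine DiffForm.ext_model fun h v => ?_
  rw [DiffForm.pullback_apply_model, betaForm_apply, betaForm_apply,
    leftMaurerCartan_mul_left_apply, adjointRep_mul_apply, hΛ.form_adjointRep, inv_inv]

theorem IsLegendrianForm.pullback_mul_left_upsilonForm (hΛ : IsLegendrianForm σ Λ) (a : H) :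
    DiffForm.pullback (E := E) (fun h : H => a * h) (upsilonForm σ Λ) = upsilonForm σ Λ := by
  refine DiffForm.ext_model fun h v => ?_
  simp only [DiffForm.pullback_apply_model, hΛ.upsilonForm_apply, leftMaurerCartan_mul_left_apply]

theorem leftMaurerCartan_mul_left_one_apply (η : E) (h : H) :
    leftMaurerCartan E h (modelDeriv E E (fun k : H => h * k) 1 η) = η :=
  congrArg (fun L : E →L[ℝ] E => L η) (leftMaurerCartan_comp_mul_left_one h)

theorem contract_betaForm_apply (X : ∀ h : H, TangentSpace 𝓘(ℝ, E) h) (ξ : E) {h : H} {x : E}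
    (hx : X h = x) (v : Fin 0 → E) :
    (DiffForm.contract X (betaForm σ Λ ξ) h : E [⋀^Fin 0]→L[ℝ] ℝ) v =
      formOnModel Λ ξ (adjointRep E h (pProj E σ (leftMaurerCartan E h x))) :=
  (DiffForm.contract_apply_model X (betaForm σ Λ ξ) h hx v).trans (betaForm_apply _ _ _)

theorem IsLegendrianForm.contract_upsilonForm_apply (hΛ : IsLegendrianForm σ Λ)
    (X : ∀ h : H, TangentSpace 𝓘(ℝ, E) h) {h : H} {x : E} (hx : X h = x) (v : Fin 2 → E) :
    (DiffForm.contract X (upsilonForm σ Λ) h : E [⋀^Fin 2]→L[ℝ] ℝ) v =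
      2 * trilin Λ (pProj E σ (leftMaurerCartan E h x))
        (pProj E σ (leftMaurerCartan E h (v 0))) (pProj E σ (leftMaurerCartan E h (v 1))) :=
  (DiffForm.contract_apply_model X (upsilonForm σ Λ) h hx v).trans (hΛ.upsilonForm_apply _ _)

theorem mulInvariantVectorField_eq (η : E) (h : H) :
    mulInvariantVectorField (I := 𝓘(ℝ, E)) (G := H) η h =
      modelDeriv E E (fun k : H => h * k) 1 η := rfl

theorem pProj_leftMaurerCartan_mul_right (hσ : IsSymmetricPair E σ G) {g : H} (hg : g ∈ G)
    (h : H) (x : E) :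
    pProj E σ (leftMaurerCartan E (h * g) (modelDeriv E E (fun k : H => k * g) h x)) =
      adjointRep E g⁻¹ (pProj E σ (leftMaurerCartan E h x)) := by
  rw [leftMaurerCartan_mul_right_apply, hσ.pProj_adjointRep (G.inv_mem hg)]

theorem adjointRep_adjointRep_inv (g : H) (x : E) :
    adjointRep E g (adjointRep E g⁻¹ x) = x := by
  rw [← adjointRep_mul_apply, mul_inv_cancel, adjointRep_one_apply]

/-- Under right translation by `g` the form `π` acquires `Ad_{g⁻¹}`, which cancels against `Ad_{h
g}`; and `π` vanishes on the left-invariant fields of `𝔤`. -/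
theorem isRightBasic_betaForm (hσ : IsSymmetricPair E σ G) (ξ : E) :
    IsRightBasic σ G (betaForm σ Λ ξ) where
  invariant g hg := by
    refine DiffForm.ext_model fun h v => ?_
    rw [DiffForm.pullback_apply_model, betaForm_apply, betaForm_apply,
      pProj_leftMaurerCartan_mul_right hσ hg, adjointRep_mul_apply, adjointRep_adjointRep_inv]
  horizontal η hη := by
    refine DiffForm.ext_model fun h v => ?_
    refine (contract_betaForm_apply _ ξ (mulInvariantVectorField_eq (E := E) η h) v).trans ?_
    have h1 : pProj E σ (leftMaurerCartan E h (modelDeriv E E (fun k : H => h * k) 1 η)) = 0 :=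
      (congrArg (pProj E σ) (leftMaurerCartan_mul_left_one_apply (E := E) η h)).trans
        (mem_gPart_iff_pProj.1 hη)
    exact (congrArg (fun x => formOnModel Λ ξ (adjointRep E h x)) h1).trans (by simp; rfl)

/-- `Ad_g` preserves both the bracket and `Λ`. -/
theorem IsLegendrianForm.trilin_adjointRep (hΛ : IsLegendrianForm σ Λ) (g : H) (x y z : E) :
    trilin Λ (adjointRep E g x) (adjointRep E g y) (adjointRep E g z) = trilin Λ x y z := by
  rw [trilin, ← adjointRep_lieBracketL, hΛ.form_adjointRep, ← adjointRep_mul_apply,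
    inv_mul_cancel, adjointRep_one_apply, trilin]

theorem IsLegendrianForm.isRightBasic_upsilonForm (hΛ : IsLegendrianForm σ Λ)
    (hσ : IsSymmetricPair E σ G) : IsRightBasic σ G (upsilonForm σ Λ) where
  invariant g hg := by
    refine DiffForm.ext_model fun h v => ?_
    simp only [DiffForm.pullback_apply_model, hΛ.upsilonForm_apply,
      pProj_leftMaurerCartan_mul_right hσ hg, hΛ.trilin_adjointRep]
  horizontal η hη := by
    refine DiffForm.ext_model fun h v => ?_
    refine (hΛ.contract_upsilonForm_apply _ (mulInvariantVectorField_eq (E := E) η h) v).trans ?_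
    have h1 : pProj E σ (leftMaurerCartan E h (modelDeriv E E (fun k : H => h * k) 1 η)) = 0 :=
      (congrArg (pProj E σ) (leftMaurerCartan_mul_left_one_apply (E := E) η h)).trans
        (mem_gPart_iff_pProj.1 hη)
    exact (congrArg (fun x => 2 * trilin Λ x (pProj E σ (leftMaurerCartan E h (v 0)))
      (pProj E σ (leftMaurerCartan E h (v 1)))) h1).trans (by simp [trilin]; rfl)

theorem mdifferentiable_leftTranslation (a : H) :
    MDifferentiable 𝓘(ℝ, E) 𝓘(ℝ, E) (fun k : H => a * k) :=
  fun h => mdifferentiableAt_leftTranslation a h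

theorem mul_left_one_leftMaurerCartan_apply (x : E) (h : H) :
    modelDeriv E E (fun k : H => h * k) 1 (leftMaurerCartan E h x) = x :=
  congrArg (fun L : E →L[ℝ] E => L x) (mul_left_one_comp_leftMaurerCartan h)

/-- The differential of a form is determined at `1` by the pullback under a left translation. -/
theorem d_apply_eq_d_pullback_apply_one {k : ℕ} {α : DiffForm E H k} (hα : α.IsSmooth) (h : H)
    (v : Fin (k + 1) → E) :
    (α.d h : E [⋀^Fin (k + 1)]→L[ℝ] ℝ) v =
      ((DiffForm.pullback (E := E) (fun k : H => h * k) α).d 1 : E [⋀^Fin (k + 1)]→L[ℝ] ℝ)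
        (fun i => leftMaurerCartan E h (v i)) := by
  rw [DiffForm.d_pullback hα contMDiff_mul_left, DiffForm.pullback_apply_model]
  simp only [mul_left_one_leftMaurerCartan_apply]
  have key : ∀ a b : H, a = b → (α.d a : E [⋀^Fin (k + 1)]→L[ℝ] ℝ) v =
      (α.d b : E [⋀^Fin (k + 1)]→L[ℝ] ℝ) v := by
    rintro a _ rfl
    rfl
  exact key _ _ (mul_one h).symm

theorem d_apply_one {k : ℕ} {α : DiffForm E H k} (hα : α.IsSmooth) (v : Fin (k + 1) → E) :
    (α.d 1 : E [⋀^Fin (k + 1)]→L[ℝ] ℝ) v = ∑ i, (-1) ^ i.val •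
      fderiv ℝ (fun y => α.inChart 1 y (i.removeNth v)) (oneInChart E H) (v i) := by
  have h1 : DifferentiableAt ℝ (α.inChart 1) (oneInChart E H) :=
    (DiffForm.isSmooth_iff.1 hα 1 _ oneInChart_mem).differentiableAt (by simp)
  refine (congrArg (fun A : E [⋀^Fin (k + 1)]→L[ℝ] ℝ => A v) (DiffForm.d_apply α 1)).trans ?_
  exact extDeriv_apply h1 v

theorem hasFDerivAt_leftMaurerCartanInChart_apply (x : E) :
    HasFDerivAt (fun y => leftMaurerCartanInChart E (1 : H) y x)
      ((fderiv ℝ (leftMaurerCartanInChart E (1 : H)) (oneInChart E H)).flip x)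
      (oneInChart E H) :=
  ((ContinuousLinearMap.apply ℝ E x).hasFDerivAt.comp (oneInChart E H)
    differentiableAt_leftMaurerCartanInChart.hasFDerivAt)

/-- Product rule for `Ad_h π` at `1`, where `Ad` and `θ` are the identity: the first summand comes
from `Ad' = ad`, the second from `θ'`. -/
theorem fderiv_betaForm_inChart (ξ η ζ : E) (w : Fin 1 → E) (hw : w 0 = ζ) :
    fderiv ℝ (fun y => (betaForm σ Λ ξ).inChart 1 y w) (oneInChart E H) η =
      formOnModel Λ ξ (lieBracketL E H η (pProj E σ ζ) +
        pProj E σ (fderiv ℝ (leftMaurerCartanInChart E (1 : H)) (oneInChart E H) η ζ)) := by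
  have h1 := (hasFDerivAt_leftMaurerCartanInChart_apply (H := H) ζ)
  have h2 := (pProj E σ).hasFDerivAt.comp (oneInChart E H) h1
  have h3 := (differentiableAt_adjointRepInChart (E := E) (H := H)).hasFDerivAt.clm_apply h2
  have h4 := (LinearMap.toContinuousLinearMap (formOnModel Λ ξ)).hasFDerivAt.comp
    (oneInChart E H) h3
  have h5 := congrArg (fun L : E →L[ℝ] ℝ => L η) h4.fderiv
  subst hw
  refine h5.trans ?_
  simp [leftMaurerCartanInChart_one, adjointRepInChart_one, fderiv_adjointRepInChart, add_comm]

theorem IsLegendrianForm.d_betaForm_apply (hΛ : IsLegendrianForm σ Λ) (hσ : IsSymmetricPair E σ G)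
    (ξ : E) (h : H) (v : Fin 2 → E) :
    ((betaForm σ Λ ξ).d h : E [⋀^Fin 2]→L[ℝ] ℝ) v =
      2 * trilin Λ (adjointRep E h⁻¹ ξ) (pProj E σ (leftMaurerCartan E h (v 0)))
        (pProj E σ (leftMaurerCartan E h (v 1))) := by
  -- The value at `1` is needed for all `ξ ∈ 𝔥`: translation from `h` to `1` replaces `ξ` by
  -- `Ad_{h⁻¹} ξ`, which need not lie in `𝔤`.
  have key : ∀ (ξ : E) (v : Fin 2 → E), ((betaForm σ Λ ξ).d 1 : E [⋀^Fin 2]→L[ℝ] ℝ) v =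
      2 * trilin Λ ξ (pProj E σ (v 0)) (pProj E σ (v 1)) := by
    intro ξ v
    have h1 := hσ.pProj_lieBracketL (v 0) (v 1)
    have h2 := congrArg (pProj E σ) (maurerCartan_equation (H := H) (v 0) (v 1))
    rw [map_sub, map_neg, h1] at h2
    rw [d_apply_one (betaForm_isSmooth ξ), Fin.sum_univ_two,
      fderiv_betaForm_inChart ξ _ (v 1) _ rfl, fderiv_betaForm_inChart ξ _ (v 0) _ rfl]
    have e0 := gProj_add_pProj σ (v 0)
    have e1 := gProj_add_pProj σ (v 1)
    set D := pProj E σ (fderiv ℝ (leftMaurerCartanInChart E (1 : H)) (oneInChart E H) (v 0) (v 1))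
    set D' := pProj E σ
      (fderiv ℝ (leftMaurerCartanInChart E (1 : H)) (oneInChart E H) (v 1) (v 0))
    -- With `x = v 0`, `y = v 1`, this is `[x, y_𝔭] - [y, x_𝔭] - [x, y]_𝔭 = 2 [x_𝔭, y_𝔭]`: the mixed
    -- brackets cancel and `[x_𝔭, y_𝔭]` occurs twice.
    have e2 : lieBracketL E H (v 0) (pProj E σ (v 1)) + D -
        (lieBracketL E H (v 1) (pProj E σ (v 0)) + D') =
        (2 : ℝ) • lieBracketL E H (pProj E σ (v 0)) (pProj E σ (v 1)) := by
      have h3 : lieBracketL E H (v 0) (pProj E σ (v 1)) =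
          lieBracketL E H (gProj E σ (v 0)) (pProj E σ (v 1)) +
            lieBracketL E H (pProj E σ (v 0)) (pProj E σ (v 1)) := by
        conv_lhs => rw [← e0, map_add, _root_.add_apply]
      have h4 : lieBracketL E H (v 1) (pProj E σ (v 0)) =
          lieBracketL E H (gProj E σ (v 1)) (pProj E σ (v 0)) -
            lieBracketL E H (pProj E σ (v 0)) (pProj E σ (v 1)) := by
        conv_lhs => rw [← e1, map_add, _root_.add_apply]
        rw [lieBracketL_skew (pProj E σ (v 1)), sub_eq_add_neg]
      rw [h3, h4, eq_add_of_sub_eq h2]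
      module
    have e3 := congrArg (formOnModel Λ ξ) e2
    rw [map_sub, map_smul] at e3
    rw [trilin, ← smul_eq_mul, ← e3]
    simp
    ring
  rw [d_apply_eq_d_pullback_apply_one (betaForm_isSmooth ξ), hΛ.pullback_mul_left_betaForm, key]

theorem IsLegendrianForm.upsilonForm_inChart_apply (hΛ : IsLegendrianForm σ Λ) (w : Fin 3 → E) :
    (fun y => (upsilonForm σ Λ).inChart 1 y w) = fun y => 2 * trilin Λ
      (pProj E σ (leftMaurerCartanInChart E (1 : H) y (w 0)))
      (pProj E σ (leftMaurerCartanInChart E (1 : H) y (w 1)))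
      (pProj E σ (leftMaurerCartanInChart E (1 : H) y (w 2))) :=
  funext fun y => hΛ.upsilonForm_apply ((extChartAt 𝓘(ℝ, E) (1 : H)).symm y)
    (fun i => modelDeriv E E (extChartAt 𝓘(ℝ, E) (1 : H)).symm y (w i))

variable (Λ) in
/-- The differential of `trilin Λ a b c` when `a`, `b`, `c` vary. -/
noncomputable def trilinDeriv (a b c : E) (a' b' c' : E →L[ℝ] E) : E →L[ℝ] ℝ :=
  LinearMap.toContinuousLinearMap
    ((formOnModel Λ).flip (lieBracketL E H b c) ∘ₗ a'.toLinearMap +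
      formOnModel Λ a ∘ₗ ((lieBracketL E H).flip c ∘L b' + lieBracketL E H b ∘L c').toLinearMap)

theorem trilinDeriv_apply (a b c : E) (a' b' c' : E →L[ℝ] E) (η : E) :
    trilinDeriv Λ a b c a' b' c' η =
      trilin Λ (a' η) b c + trilin Λ a (b' η) c + trilin Λ a b (c' η) := by
  simp [trilinDeriv, trilin, add_assoc]

theorem hasFDerivAt_trilin {a b c : E → E} {a' b' c' : E →L[ℝ] E} {y : E}
    (ha : HasFDerivAt a a' y) (hb : HasFDerivAt b b' y) (hc : HasFDerivAt c c' y) :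
    HasFDerivAt (fun z => trilin Λ (a z) (b z) (c z))
      (trilinDeriv Λ (a y) (b y) (c y) a' b' c') y := by
  have h1 := ((lieBracketL E H).hasFDerivAt.comp y hb).clm_apply hc
  have h2 := ((LinearMap.toContinuousBilinearMap (formOnModel Λ)).hasFDerivAt.comp y ha).clm_apply
    h1
  refine h2.congr_fderiv (ContinuousLinearMap.ext fun η => ?_)
  rw [trilinDeriv_apply]
  simp [trilin]
  ring

theorem IsLegendrianForm.fderiv_upsilonForm_inChart (hΛ : IsLegendrianForm σ Λ) (η a b c : E)
    (w : Fin 3 → E) (ha : w 0 = a) (hb : w 1 = b) (hc : w 2 = c) :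
    let D := fun x => pProj E σ
      (fderiv ℝ (leftMaurerCartanInChart E (1 : H)) (oneInChart E H) η x)
    fderiv ℝ (fun y => (upsilonForm σ Λ).inChart 1 y w) (oneInChart E H) η =
      2 * (trilin Λ (D a) (pProj E σ b) (pProj E σ c) +
        trilin Λ (pProj E σ a) (D b) (pProj E σ c) +
        trilin Λ (pProj E σ a) (pProj E σ b) (D c)) := by
  intro D
  subst ha hb hc
  rw [hΛ.upsilonForm_inChart_apply w]
  have hp : ∀ x, HasFDerivAt (fun y => pProj E σ (leftMaurerCartanInChart E (1 : H) y x))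
      ((pProj E σ).comp ((fderiv ℝ (leftMaurerCartanInChart E (1 : H)) (oneInChart E H)).flip x))
      (oneInChart E H) := fun x =>
    (pProj E σ).hasFDerivAt.comp (oneInChart E H) (hasFDerivAt_leftMaurerCartanInChart_apply x)
  rw [((hasFDerivAt_trilin (hp (w 0)) (hp (w 1)) (hp (w 2))).const_mul 2).fderiv]
  simp [leftMaurerCartanInChart_one, D, trilinDeriv_apply]

theorem IsLegendrianForm.d_upsilonForm (hΛ : IsLegendrianForm σ Λ) (hσ : IsSymmetricPair E σ G) :
    (upsilonForm σ Λ).d = 0 := by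
  refine DiffForm.ext_model fun h v => ?_
  rw [d_apply_eq_d_pullback_apply_one upsilonForm_isSmooth, hΛ.pullback_mul_left_upsilonForm]
  generalize (fun i => leftMaurerCartan E h (v i)) = w
  change _ = (0 : ℝ)
  rw [d_apply_one upsilonForm_isSmooth, Fin.sum_univ_four,
    hΛ.fderiv_upsilonForm_inChart _ (w 1) (w 2) (w 3) _ rfl rfl rfl,
    hΛ.fderiv_upsilonForm_inChart _ (w 0) (w 2) (w 3) _ rfl rfl rfl,
    hΛ.fderiv_upsilonForm_inChart _ (w 0) (w 1) (w 3) _ rfl rfl rfl,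
    hΛ.fderiv_upsilonForm_inChart _ (w 0) (w 1) (w 2) _ rfl rfl rfl]
  set D : E → E → E := fun η x => pProj E σ
    (fderiv ℝ (leftMaurerCartanInChart E (1 : H)) (oneInChart E H) η x) with hD
  set p := pProj E σ
  -- The `𝔭`-part of the Maurer–Cartan equation: after alternation only the `𝔭`-parts of brackets
  -- survive of `D`.
  have hK : ∀ x y, D y x = D x y + p (lieBracketL E H x y) := fun x y => by
    have h2 := congrArg p (maurerCartan_equation (H := H) x y)
    rw [map_sub, map_neg] at h2
    have h3 : D x y - D y x = - p (lieBracketL E H x y) := h2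
    rw [sub_eq_iff_eq_add] at h3
    rw [h3]
    abel
  have hsum : trilin Λ (p (lieBracketL E H (w 0) (w 1))) (p (w 2)) (p (w 3)) -
      trilin Λ (p (lieBracketL E H (w 0) (w 2))) (p (w 1)) (p (w 3)) +
      trilin Λ (p (lieBracketL E H (w 0) (w 3))) (p (w 1)) (p (w 2)) +
      trilin Λ (p (lieBracketL E H (w 1) (w 2))) (p (w 0)) (p (w 3)) -
      trilin Λ (p (lieBracketL E H (w 1) (w 3))) (p (w 0)) (p (w 2)) +
      trilin Λ (p (lieBracketL E H (w 2) (w 3))) (p (w 0)) (p (w 1)) = 0 :=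
    hΛ.sum_trilin_lieBracketL hσ (w 0) (w 1) (w 2) (w 3)
  -- `m` and `l` bring the differentiated entry to the front from the second and third slot, so that
  -- the twelve terms pair up as in `hsum`.
  have m : ∀ a x b, trilin Λ a x b = -trilin Λ x a b := hΛ.trilin_swap_left
  have l : ∀ a b x, trilin Λ a b x = trilin Λ x a b := fun a b x => by
    rw [trilin_swap_right, m, neg_neg]
  change (-1) ^ (0 : ℕ) • (2 * (trilin Λ (D (w 0) (w 1)) (p (w 2)) (p (w 3)) +
      trilin Λ (p (w 1)) (D (w 0) (w 2)) (p (w 3)) +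
      trilin Λ (p (w 1)) (p (w 2)) (D (w 0) (w 3)))) +
    (-1) ^ (1 : ℕ) • (2 * (trilin Λ (D (w 1) (w 0)) (p (w 2)) (p (w 3)) +
      trilin Λ (p (w 0)) (D (w 1) (w 2)) (p (w 3)) +
      trilin Λ (p (w 0)) (p (w 2)) (D (w 1) (w 3)))) +
    (-1) ^ (2 : ℕ) • (2 * (trilin Λ (D (w 2) (w 0)) (p (w 1)) (p (w 3)) +
      trilin Λ (p (w 0)) (D (w 2) (w 1)) (p (w 3)) +
      trilin Λ (p (w 0)) (p (w 1)) (D (w 2) (w 3)))) +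
    (-1) ^ (3 : ℕ) • (2 * (trilin Λ (D (w 3) (w 0)) (p (w 1)) (p (w 2)) +
      trilin Λ (p (w 0)) (D (w 3) (w 1)) (p (w 2)) +
      trilin Λ (p (w 0)) (p (w 1)) (D (w 3) (w 2)))) = 0
  rw [m _ (D (w 0) (w 2)), l _ _ (D (w 0) (w 3)), m _ (D (w 1) (w 2)), l _ _ (D (w 1) (w 3)),
    m _ (D (w 2) (w 1)), l _ _ (D (w 2) (w 3)), m _ (D (w 3) (w 1)), l _ _ (D (w 3) (w 2)),
    hK (w 0) (w 1), hK (w 0) (w 2), hK (w 0) (w 3), hK (w 1) (w 2), hK (w 1) (w 3),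
    hK (w 2) (w 3)]
  simp only [trilin_add_left, pow_zero, pow_one, Int.reduceNeg, Int.reducePow, one_smul, neg_smul]
  linarith

theorem fundamentalField_apply_model (ξ : E) (h : H) :
    fundamentalField (E := E) (H := H) (P := H) (F := E) ξ h =
      modelDeriv E E (fun k : H => k * h) 1 ξ := rfl

theorem leftMaurerCartan_mul_right_one_apply (ξ : E) (h : H) :
    leftMaurerCartan E h (modelDeriv E E (fun k : H => k * h) 1 ξ) = adjointRep E h⁻¹ ξ :=
  congrArg (fun L : E →L[ℝ] E => L ξ) (leftMaurerCartan_comp_mul_right_one h)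

/-- `θ` takes the value `Ad_{h⁻¹} ξ` on the fundamental field. The two sides differ only in its
`𝔤`-part, which does not pair with `[𝔭, 𝔭]`. -/
theorem IsLegendrianForm.contract_upsilonForm (hΛ : IsLegendrianForm σ Λ)
    (hσ : IsSymmetricPair E σ G) (ξ : E) :
    DiffForm.contract (fundamentalField (E := E) (H := H) (P := H) (F := E) ξ) (upsilonForm σ Λ) =
      (betaForm σ Λ ξ).d := by
  refine DiffForm.ext_model fun h v => ?_
  refine (hΛ.contract_upsilonForm_apply _ (fundamentalField_apply_model ξ h) v).trans ?_
  refine Eq.trans ?_ (hΛ.d_betaForm_apply hσ ξ h v).symm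
  rw [leftMaurerCartan_mul_right_one_apply]
  exact congrArg (2 * ·) (hΛ.trilin_pProj_left hσ _ _ _)

/-- With `ζ = Ad_{h⁻¹} ξ` and both eigenspaces isotropic, `Λ(ζ, ζ) = 2 Λ(ζ, ζ_𝔭)`; the left side is
`Λ(ξ, ξ)`, which vanishes because `ξ ∈ 𝔤`. -/
theorem IsLegendrianForm.contract_betaForm (hΛ : IsLegendrianForm σ Λ)
    (hσ : IsSymmetricPair E σ G) {ξ : E} (hξ : ξ ∈ gPart E σ) :
    DiffForm.contract (fundamentalField (E := E) (H := H) (P := H) (F := E) ξ) (betaForm σ Λ ξ) = 0 := by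
  refine DiffForm.ext_model fun h v => ?_
  refine (contract_betaForm_apply _ ξ (fundamentalField_apply_model ξ h) v).trans ?_
  rw [leftMaurerCartan_mul_right_one_apply]
  change _ = (0 : ℝ)
  set ζ := adjointRep E h⁻¹ ξ with hζ
  have h1 : formOnModel Λ ξ (adjointRep E h (pProj E σ ζ)) = formOnModel Λ ζ (pProj E σ ζ) := by
    rw [hζ, hΛ.form_adjointRep, inv_inv]
  have h2 : formOnModel Λ ζ ζ = 0 := by
    conv_lhs => rw [hζ, hΛ.form_adjointRep, inv_inv, adjointRep_adjointRep_inv]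
    exact hΛ.form_fixed (mem_gPart_iff.1 hξ) (mem_gPart_iff.1 hξ)
  have h3 : formOnModel Λ (gProj E σ ζ) (gProj E σ ζ) = 0 :=
    hΛ.form_fixed (hσ.involutionDeriv_gProj ζ) (hσ.involutionDeriv_gProj ζ)
  have h4 : formOnModel Λ (pProj E σ ζ) (pProj E σ ζ) = 0 :=
    hΛ.form_antifixed (hσ.involutionDeriv_pProj ζ) (hσ.involutionDeriv_pProj ζ)
  have h5 := hΛ.form_symm (gProj E σ ζ) (pProj E σ ζ)
  rw [h1]
  rw [← gProj_add_pProj σ ζ] at h2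
  simp only [map_add, LinearMap.add_apply] at h2
  have h6 : formOnModel Λ ζ (pProj E σ ζ) = formOnModel Λ (gProj E σ ζ) (pProj E σ ζ) +
      formOnModel Λ (pProj E σ ζ) (pProj E σ ζ) := by
    rw [← LinearMap.add_apply, ← map_add, gProj_add_pProj]
  linarith

end GroupForms

/-! ### Derivatives of products and inverses at the identity -/

section ProductDerivative

variable {E : Type*} [NormedAddCommGroup E] [NormedSpace ℝ E]
  {H : Type*} [TopologicalSpace H] [ChartedSpace E H] [Group H] [LieGroup 𝓘(ℝ, E) ∞ H]
  {E' : Type*} [NormedAddCommGroup E'] [NormedSpace ℝ E']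
  {M : Type*} [TopologicalSpace M] [ChartedSpace E' M]

/-- The product rule, at points where both factors are `1`. -/
theorem modelDeriv_mul_of_eq_one {a b : M → H} {p : M} (ha : MDifferentiableAt 𝓘(ℝ, E') 𝓘(ℝ, E) a p)
    (hb : MDifferentiableAt 𝓘(ℝ, E') 𝓘(ℝ, E) b p) (ha1 : a p = 1) (hb1 : b p = 1) :
    modelDeriv E' E (fun x => a x * b x) p = modelDeriv E' E a p + modelDeriv E' E b p := by
  have hm : MDifferentiableAt (𝓘(ℝ, E).prod 𝓘(ℝ, E)) 𝓘(ℝ, E) (fun z : H × H => z.1 * z.2)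
      ((1 : H), (1 : H)) :=
    (contMDiff_mul 𝓘(ℝ, E) ∞).mdifferentiableAt (by simp)
  have hab : MDifferentiableAt 𝓘(ℝ, E') (𝓘(ℝ, E).prod 𝓘(ℝ, E)) (fun x => (a x, b x)) p :=
    ha.prodMk hb
  have h1 : (mfderiv 𝓘(ℝ, E') 𝓘(ℝ, E) (fun x => a x * b x) p : E' →L[ℝ] E) =
      (mfderiv (𝓘(ℝ, E).prod 𝓘(ℝ, E)) 𝓘(ℝ, E) (fun z : H × H => z.1 * z.2) ((1 : H), (1 : H)) :
        E × E →L[ℝ] E).comp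
        (mfderiv 𝓘(ℝ, E') (𝓘(ℝ, E).prod 𝓘(ℝ, E)) (fun x => (a x, b x)) p : E' →L[ℝ] E × E) :=
    by
    have h := mfderiv_comp_of_eq hm hab (by rw [ha1, hb1])
    rw [ha1, hb1] at h
    exact h
  refine h1.trans (ContinuousLinearMap.ext fun v => ?_)
  have h2 : (mfderiv 𝓘(ℝ, E') (𝓘(ℝ, E).prod 𝓘(ℝ, E)) (fun x => (a x, b x)) p : E' →L[ℝ] E × E) =
      (modelDeriv E' E a p).prod (modelDeriv E' E b p) := ha.mfderiv_prod hb
  have h3 : ∀ w : E × E, (mfderiv (𝓘(ℝ, E).prod 𝓘(ℝ, E)) 𝓘(ℝ, E) (fun z : H × H => z.1 * z.2)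
      ((1 : H), (1 : H)) : E × E →L[ℝ] E) w = w.1 + w.2 := by
    intro w
    refine (mfderiv_prod_eq_add_apply hm).trans ?_
    have h4 : modelDeriv E E (fun z : H => z * 1) 1 = ContinuousLinearMap.id ℝ E := by
      rw [← modelDeriv_id (1 : H)]
      simp
    have h5 : modelDeriv E E (fun z : H => 1 * z) 1 = ContinuousLinearMap.id ℝ E := by
      rw [← modelDeriv_id (1 : H)]
      simp
    exact congrArg₂ (· + ·) (congrArg (fun L : E →L[ℝ] E => L w.1) h4)
      (congrArg (fun L : E →L[ℝ] E => L w.2) h5)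
  refine (h3 _).trans ?_
  rw [h2]
  rfl

theorem modelDeriv_inv_of_eq_one {a : M → H} {p : M} (ha : MDifferentiableAt 𝓘(ℝ, E') 𝓘(ℝ, E) a p)
    (ha1 : a p = 1) : modelDeriv E' E (fun x => (a x)⁻¹) p = -modelDeriv E' E a p := by
  have hi : MDifferentiableAt 𝓘(ℝ, E') 𝓘(ℝ, E) (fun x => (a x)⁻¹) p :=
    ((contMDiff_inv 𝓘(ℝ, E) ∞).mdifferentiableAt (x := a p) (by simp)).comp p ha
  have h := modelDeriv_mul_of_eq_one ha hi ha1 (by rw [ha1, inv_one])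
  simp only [mul_inv_cancel] at h
  rw [modelDeriv_const] at h
  exact (neg_eq_of_add_eq_zero_right h.symm).symm

end ProductDerivative

/-! ### The symmetrization map and its kernel -/

section Symmetrization

variable {E : Type*} [NormedAddCommGroup E] [NormedSpace ℝ E]
  {H : Type*} [TopologicalSpace H] [ChartedSpace E H] [Group H]
  {σ : H ≃* H} {G : Subgroup H}

/-- The symmetrization map `h ↦ h σ(h)⁻¹` of a symmetric space. -/
def symmetrization (σ : H ≃* H) (h : H) : H := h * (σ h)⁻¹

theorem symmetrization_mul (a b : H) :
    symmetrization σ (a * b) = a * symmetrization σ b * (σ a)⁻¹ := by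
  simp [symmetrization, mul_assoc]

theorem symmetrization_one : symmetrization σ 1 = 1 := by simp [symmetrization]

/-- Rearranging `a σ(a)⁻¹ = b σ(b)⁻¹` gives `σ(a)⁻¹ σ(b) = a⁻¹ b`: the fibres are left cosets of
`H^σ`. -/
theorem map_inv_mul_of_symmetrization_eq {a b : H} (h : symmetrization σ a = symmetrization σ b) :
    σ (a⁻¹ * b) = a⁻¹ * b := by
  have h1 : b = a * (σ a)⁻¹ * σ b := by
    rw [symmetrization, symmetrization] at h
    rw [h, inv_mul_cancel_right]
  conv_rhs => rw [h1]
  rw [map_mul, map_inv]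
  group

variable [LieGroup 𝓘(ℝ, E) ∞ H] [FiniteDimensional ℝ E]

theorem IsSymmetricPair.symmetrization_mul_right (hσ : IsSymmetricPair E σ G) (h : H) {g : H}
    (hg : g ∈ G) : symmetrization σ (h * g) = symmetrization σ h := by
  simp [symmetrization, hσ.le_fixed g hg]

theorem IsSymmetricPair.contMDiff_symmetrization (hσ : IsSymmetricPair E σ G) :
    ContMDiff 𝓘(ℝ, E) 𝓘(ℝ, E) ∞ (symmetrization σ) :=
  contMDiff_id.mul hσ.smooth.inv

theorem IsSymmetricPair.modelDeriv_symmetrization_one (hσ : IsSymmetricPair E σ G) (x : E) :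
    modelDeriv E E (symmetrization σ) 1 x = (2 : ℝ) • pProj E σ x := by
  have h1 := hσ.mdifferentiableAt 1
  have h2 : MDifferentiableAt 𝓘(ℝ, E) 𝓘(ℝ, E) (fun h => (σ h)⁻¹) 1 :=
    hσ.smooth.inv.mdifferentiableAt (by simp)
  have h3 := modelDeriv_mul_of_eq_one (p := (1 : H)) mdifferentiableAt_id h2 rfl (by simp)
  rw [modelDeriv_inv_of_eq_one h1 (map_one σ)] at h3
  have h4 := congrArg (fun L : E →L[ℝ] E => L x) h3
  have h5 : modelDeriv E E (symmetrization σ) 1 x = modelDeriv E E (fun h : H => h) 1 x +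
    -involutionDeriv E σ x := h4
  rw [h5, modelDeriv_id, pProj_apply]
  simp [sub_eq_add_neg]

/-- Twisted equivariance under left translation carries the kernel at `h` to the kernel at `1`,
where the differential is twice the projection to `𝔭`. -/
theorem IsSymmetricPair.leftMaurerCartan_mem_gPart (hσ : IsSymmetricPair E σ G) {h : H} {x : E}
    (hx : modelDeriv E E (symmetrization σ) h x = 0) : leftMaurerCartan E h x ∈ gPart E σ := by
  set η := leftMaurerCartan E h x with hη
  have hx' : x = modelDeriv E E (fun k : H => h * k) 1 η :=
    (mul_left_one_leftMaurerCartan_apply x h).symm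
  have hd : ∀ k, MDifferentiableAt 𝓘(ℝ, E) 𝓘(ℝ, E) (symmetrization σ : H → H) k :=
    fun k => hσ.contMDiff_symmetrization.mdifferentiableAt (by simp)
  have h1 := modelDeriv_comp (mul_one h) (hd h) (mdifferentiableAt_leftTranslation h (1 : H))
  have h2 : MDifferentiableAt 𝓘(ℝ, E) 𝓘(ℝ, E) (fun k : H => h⁻¹ * k * σ h)
      (symmetrization σ h) :=
    (mdifferentiableAt_rightTranslation (σ h) _).comp _ (mdifferentiableAt_leftTranslation h⁻¹ _)
  have h3 : (fun k : H => h⁻¹ * k * σ h) ∘ (symmetrization σ ∘ fun k : H => h * k) =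
      symmetrization σ := by
    funext k
    simp [symmetrization_mul, mul_assoc]
  have h4 := modelDeriv_comp (p := (1 : H)) (f := symmetrization σ ∘ fun k : H => h * k)
    (by simp) h2 ((hd (h * 1)).comp 1 (mdifferentiableAt_leftTranslation h (1 : H)))
  rw [h3, h1] at h4
  have h5 := congrArg (fun L : E →L[ℝ] E => L η) h4
  have h6 : modelDeriv E E (symmetrization σ) 1 η =
      modelDeriv E E (fun k : H => h⁻¹ * k * σ h) (symmetrization σ h)
        (modelDeriv E E (symmetrization σ) h (modelDeriv E E (fun k : H => h * k) 1 η)) := h5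
  rw [← hx', hx, map_zero, hσ.modelDeriv_symmetrization_one] at h6
  exact mem_gPart_iff_pProj.2 ((smul_eq_zero_iff_right two_ne_zero).1 h6)

end Symmetrization

/-! ### Local sections of submersions -/

section LocalSections

variable {E : Type*} [NormedAddCommGroup E] [NormedSpace ℝ E]
  {M : Type*} [TopologicalSpace M] [ChartedSpace E M]
  {F : Type*} [NormedAddCommGroup F] [NormedSpace ℝ F]
  {N : Type*} [TopologicalSpace N] [ChartedSpace F N]

/-- Submersions have smooth local sections. -/
theorem Manifold.IsSubmersionAt.exists_section [IsManifold 𝓘(ℝ, E) ∞ M] [IsManifold 𝓘(ℝ, F) ∞ N]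
    {f : M → N} {x : M} (h : Manifold.IsSubmersionAt 𝓘(ℝ, E) 𝓘(ℝ, F) ∞ f x) :
    ∃ s : N → M, s (f x) = x ∧ ContMDiffAt 𝓘(ℝ, F) 𝓘(ℝ, E) ∞ s (f x) ∧
      ∀ᶠ p in nhds (f x), f (s p) = p := by
  set c := h.codChart
  set d := h.domChart
  have hd := h.mem_domChart_source
  have hc := h.mem_codChart_source
  have hw : ∀ z ∈ d.target, c (f (d.symm z)) = (h.equiv z).1 := by
    intro z hz
    have hz' : z ∈ (h.domChart.extend 𝓘(ℝ, E)).target := by simpa using hz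
    simpa using h.writtenInCharts hz'
  have hx : (h.equiv (d x)).1 = c (f x) := by
    rw [← hw _ (d.map_source hd), d.left_inv hd]
  -- In adapted charts `f` is the first projection, so a section is obtained by freezing the second
  -- coordinate at its value for `x`.
  let e : N → E := fun p => h.equiv.symm (c p, (h.equiv (d x)).2)
  have he : e (f x) = d x := by
    simp only [e, ← hx]
    exact h.equiv.symm_apply_apply _
  have hcs : ContMDiffAt 𝓘(ℝ, F) 𝓘(ℝ, F) ∞ c (f x) :=
    (contMDiffOn_of_mem_maximalAtlas h.codChart_mem_maximalAtlas).contMDiffAt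
      (c.open_source.mem_nhds hc)
  have hes : ContMDiffAt 𝓘(ℝ, F) 𝓘(ℝ, E) ∞ e (f x) := by
    have h1 : ContDiff ℝ ∞ fun y : F => h.equiv.symm (y, (h.equiv (d x)).2) := by fun_prop
    exact h1.contMDiff.contMDiffAt.comp (f x) hcs
  have hds : ContMDiffAt 𝓘(ℝ, E) 𝓘(ℝ, E) ∞ d.symm (e (f x)) := by
    rw [he]
    exact (contMDiffOn_symm_of_mem_maximalAtlas h.domChart_mem_maximalAtlas).contMDiffAt
      (d.open_target.mem_nhds (d.map_source hd))
  refine ⟨fun p => d.symm (e p), ?_, hds.comp (f x) hes, ?_⟩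
  · change d.symm (e (f x)) = x
    rw [he, d.left_inv hd]
  · have h1 : ∀ᶠ p in nhds (f x), e p ∈ d.target :=
      hes.continuousAt.eventually (d.open_target.mem_nhds (by rw [he]; exact d.map_source hd))
    filter_upwards [h1, c.open_source.mem_nhds hc] with p hp hpc
    have h2 : f (d.symm (e p)) ∈ c.source :=
      h.source_subset_preimage_source (d.map_target hp)
    refine c.injOn h2 hpc ?_
    rw [hw _ hp]
    simp [e]

end LocalSections

/-! ### Alternating forms modulo a set of null vectors -/

section AlternatingQuotient

variable {E : Type*} [NormedAddCommGroup E] [NormedSpace ℝ E]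

/-- An alternating form which vanishes when the first argument lies in `K` depends only on the
classes of its arguments modulo `K`. -/
theorem ContinuousAlternatingMap.map_congr_of_sub_mem {k : ℕ} (A : E [⋀^Fin (k + 1)]→L[ℝ] ℝ)
    {K : Set E} (hA : ∀ x ∈ K, ∀ w : Fin k → E, A (Matrix.vecCons x w) = 0)
    {v v' : Fin (k + 1) → E} (h : ∀ i, v i - v' i ∈ K) : A v = A v' := by
  have h0 : ∀ w : Fin (k + 1) → E, w 0 ∈ K → A w = 0 := fun w hw => by
    rw [← Matrix.cons_head_tail w]
    exact hA _ hw _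
  have h1 : ∀ (w : Fin (k + 1) → E) i, w i ∈ K → A w = 0 := fun w i hw => by
    rcases eq_or_ne i 0 with rfl | hi
    · exact h0 w hw
    · have h2 : A.toAlternatingMap (w ∘ Equiv.swap i 0) = -A.toAlternatingMap w :=
        A.toAlternatingMap.map_swap w hi
      have h3 : A (w ∘ Equiv.swap i 0) = 0 := h0 _ (by simpa using hw)
      exact neg_eq_zero.1 (h2.symm.trans h3)
  -- The arguments are exchanged one at a time; each exchange costs a term with an entry in `K`,
  -- which vanishes by `h1`.
  have h2 : ∀ s : Finset (Fin (k + 1)), A (s.piecewise v v') = A v' := by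
    intro s
    induction s using Finset.induction_on with
    | empty => simp
    | insert i s hi ih =>
      rw [Finset.piecewise_insert, ← ih]
      have h3 : Function.update (s.piecewise v v') i (v i) =
          Function.update (s.piecewise v v') i (v' i + (v i - v' i)) := by simp
      have h4 : Function.update (s.piecewise v v') i (v' i) = s.piecewise v v' := by
        rw [Function.update_eq_self_iff, Finset.piecewise_eq_of_notMem _ _ _ hi]
      rw [h3, A.map_update_add, h4, add_eq_left]
      exact h1 _ i (by simpa using h i)
  simpa using h2 Finset.univ

end AlternatingQuotient

/-! ### Descent of basic forms to the coset space -/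

section Descent

variable {E : Type*} [NormedAddCommGroup E] [NormedSpace ℝ E] [FiniteDimensional ℝ E]
  {H : Type*} [TopologicalSpace H] [ChartedSpace E H] [Group H] [LieGroup 𝓘(ℝ, E) ∞ H]
  {σ : H ≃* H} {G : Subgroup H}
  {F : Type*} [NormedAddCommGroup F] [NormedSpace ℝ F] [ChartedSpace F (H ⧸ G)]

theorem IsHomogeneousManifold.contMDiff_mk (hG : IsHomogeneousManifold E F G) :
    ContMDiff 𝓘(ℝ, E) 𝓘(ℝ, F) ∞ (QuotientGroup.mk : H → H ⧸ G) :=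
  hG.submersion.contMDiff

theorem IsHomogeneousManifold.mdifferentiable_mk (hG : IsHomogeneousManifold E F G) :
    MDifferentiable 𝓘(ℝ, E) 𝓘(ℝ, F) (QuotientGroup.mk : H → H ⧸ G) :=
  hG.contMDiff_mk.mdifferentiable (by simp)

theorem IsHomogeneousManifold.exists_section (hG : IsHomogeneousManifold E F G) (h : H) :
    ∃ s : H ⧸ G → H, s (h : H ⧸ G) = h ∧ ContMDiffAt 𝓘(ℝ, F) 𝓘(ℝ, E) ∞ s (h : H ⧸ G) ∧
      ∀ᶠ p in nhds (h : H ⧸ G), (s p : H ⧸ G) = p := by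
  have := hG.isManifold
  have : IsManifold 𝓘(ℝ, E) ∞ H := (inferInstance : LieGroup 𝓘(ℝ, E) ∞ H).toIsManifold
  exact (hG.submersion.isSubmersionAt h).exists_section

/-- The differential of a local section is a right inverse of the differential of `j`. -/
theorem IsHomogeneousManifold.modelDeriv_mk_section (hG : IsHomogeneousManifold E F G)
    {s : H ⧸ G → H} {x : H ⧸ G} (hs : MDifferentiableAt 𝓘(ℝ, F) 𝓘(ℝ, E) s x)
    (hs' : ∀ᶠ p in nhds x, (s p : H ⧸ G) = p) (v : F) :
    modelDeriv E F (QuotientGroup.mk : H → H ⧸ G) (s x) (modelDeriv F E s x v) = v := by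
  have h1 := modelDeriv_comp rfl (hG.mdifferentiable_mk (s x)) hs
  have h2 : (QuotientGroup.mk : H → H ⧸ G) ∘ s =ᶠ[nhds x] fun p => p := hs'
  rw [modelDeriv_congr h2, modelDeriv_id] at h1
  exact (congrArg (fun L : F →L[ℝ] F => L v) h1).symm

theorem IsHomogeneousManifold.modelDeriv_mk_surjective (hG : IsHomogeneousManifold E F G) (h : H) :
    Function.Surjective (modelDeriv E F (QuotientGroup.mk : H → H ⧸ G) h) := fun v => by
  obtain ⟨s, h1, h2, h3⟩ := hG.exists_section h
  have h4 := hG.modelDeriv_mk_section (h2.mdifferentiableAt (by simp)) h3 v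
  rw [h1] at h4
  exact ⟨_, h4⟩

/-- Because of this, every identity of forms on `H ⧸ G` may be checked on `H`. -/
theorem IsHomogeneousManifold.pullback_mk_injective (hG : IsHomogeneousManifold E F G) {k : ℕ} :
    Function.Injective (DiffForm.pullback (QuotientGroup.mk : H → H ⧸ G) :
      DiffForm F (H ⧸ G) k → DiffForm E H k) :=
  DiffForm.pullback_injective QuotientGroup.mk_surjective hG.modelDeriv_mk_surjective

/-- Through a local section of `j` the symmetrization factors over `j` near `h`, so `ker dj` lies in
the kernel of its differential. The tangent space of `G` itself never enters. -/
theorem IsHomogeneousManifold.leftMaurerCartan_mem_gPart (hG : IsHomogeneousManifold E F G)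
    (hσ : IsSymmetricPair E σ G) {h : H} {x : E}
    (hx : modelDeriv E F (QuotientGroup.mk : H → H ⧸ G) h x = 0) :
    leftMaurerCartan E h x ∈ gPart E σ := by
  refine hσ.leftMaurerCartan_mem_gPart ?_
  obtain ⟨s, h1, h2, h3⟩ := hG.exists_section h
  have h4 : (symmetrization σ : H → H) =ᶠ[nhds h]
      (symmetrization σ ∘ s) ∘ (QuotientGroup.mk : H → H ⧸ G) := by
    filter_upwards [(hG.contMDiff_mk.continuous.tendsto h).eventually h3] with k hk
    have h5 : (s (k : H ⧸ G))⁻¹ * k ∈ G := QuotientGroup.eq.1 hk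
    have h6 := hσ.symmetrization_mul_right (s (k : H ⧸ G)) h5
    rw [mul_inv_cancel_left] at h6
    exact h6
  have h5 : MDifferentiableAt 𝓘(ℝ, F) 𝓘(ℝ, E) (symmetrization σ ∘ s) (h : H ⧸ G) :=
    (hσ.contMDiff_symmetrization.mdifferentiableAt (by simp)).comp _
      (h2.mdifferentiableAt (by simp))
  rw [modelDeriv_congr h4, modelDeriv_comp rfl h5 (hG.mdifferentiable_mk h)]
  refine (congrArg (modelDeriv F E (symmetrization σ ∘ s) (h : H ⧸ G)) hx).trans ?_
  exact map_zero _

/-- The values of a basic form depend only on the images of the arguments in the quotient. -/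
theorem IsRightBasic.apply_eq {k : ℕ} {α : DiffForm E H (k + 1)} (hα : IsRightBasic σ G α)
    (hσ : IsSymmetricPair E σ G) (hG : IsHomogeneousManifold E F G) {h h' : H}
    (hh : (h : H ⧸ G) = h') {v v' : Fin (k + 1) → E}
    (hv : ∀ i, modelDeriv E F (QuotientGroup.mk : H → H ⧸ G) h (v i) =
      modelDeriv E F (QuotientGroup.mk : H → H ⧸ G) h' (v' i)) :
    (α h : E [⋀^Fin (k + 1)]→L[ℝ] ℝ) v = (α h' : E [⋀^Fin (k + 1)]→L[ℝ] ℝ) v' := by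
  obtain ⟨g, hg, rfl⟩ : ∃ g ∈ G, h' = h * g :=
    ⟨h⁻¹ * h', QuotientGroup.eq.1 hh, (mul_inv_cancel_left _ _).symm⟩
  have h1 : (α h : E [⋀^Fin (k + 1)]→L[ℝ] ℝ) v = (α (h * g) : E [⋀^Fin (k + 1)]→L[ℝ] ℝ)
      (fun i => modelDeriv E E (fun k : H => k * g) h (v i)) :=
    (congrArg (fun β : DiffForm E H (k + 1) => (β h : E [⋀^Fin (k + 1)]→L[ℝ] ℝ) v)
      (hα.invariant g hg)).symm
  rw [h1]
  -- After right translation by `g` both families sit at the same point and have equal images under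
  -- `dj`; their differences are vertical and do not affect a horizontal form.
  refine ContinuousAlternatingMap.map_congr_of_sub_mem _
    (K := {x | leftMaurerCartan E (h * g) x ∈ gPart E σ}) (fun x hx w => ?_) fun i => ?_
  · have h2 := congrArg (fun β : DiffForm E H k => (β (h * g) : E [⋀^Fin k]→L[ℝ] ℝ) w)
      (hα.horizontal _ hx)
    refine (DiffForm.contract_apply_model _ α (h * g) ?_ w).symm.trans h2
    exact (mulInvariantVectorField_eq (E := E) _ _).trans (mul_left_one_leftMaurerCartan_apply x _)
  · refine hG.leftMaurerCartan_mem_gPart hσ ?_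
    have h2 := modelDeriv_comp (f := fun k : H => k * g) rfl (hG.mdifferentiable_mk (h * g))
      (mdifferentiableAt_rightTranslation (E := E) g h)
    have h3 : (QuotientGroup.mk : H → H ⧸ G) ∘ (fun k : H => k * g) = QuotientGroup.mk :=
      funext fun k => QuotientGroup.mk_mul_of_mem k hg
    rw [h3] at h2
    rw [map_sub, ← hv, h2]
    exact sub_self _

/-- Basic forms descend to the quotient. -/
theorem IsRightBasic.exists_isDescent {k : ℕ} {α : DiffForm E H (k + 1)} (hα : IsRightBasic σ G α)
    (hα' : α.IsSmooth) (hσ : IsSymmetricPair E σ G) (hG : IsHomogeneousManifold E F G) :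
    ∃ β : DiffForm F (H ⧸ G) (k + 1), IsDescent G α β := by
  have := hG.isManifold
  have : IsManifold 𝓘(ℝ, E) ∞ H := (inferInstance : LieGroup 𝓘(ℝ, E) ∞ H).toIsManifold
  choose s h1 h2 h3 using hG.exists_section (E := E) (F := F) (G := G)
  -- The section varies with `p` here, so smoothness is not visible from the definition. `hβ` shows
  -- that the value is independent of the section, and `h4` then replaces it near a point by a
  -- single one.
  let β : DiffForm F (H ⧸ G) (k + 1) := fun p => DiffForm.pullback (E := F) (s p.out) α p
  have hβ : ∀ (h : H) (v : Fin (k + 1) → E), (β (h : H ⧸ G) : F [⋀^Fin (k + 1)]→L[ℝ] ℝ)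
      (fun i => modelDeriv E F (QuotientGroup.mk : H → H ⧸ G) h (v i)) =
      (α h : E [⋀^Fin (k + 1)]→L[ℝ] ℝ) v := by
    intro h v
    have e : (((h : H ⧸ G).out : H) : H ⧸ G) = h := QuotientGroup.out_eq' _
    have h2' := h2 (h : H ⧸ G).out
    have h3' := h3 (h : H ⧸ G).out
    rw [e] at h2' h3'
    exact hα.apply_eq hσ hG h3'.self_of_nhds fun i =>
      hG.modelDeriv_mk_section (h2'.mdifferentiableAt (by simp)) h3' _
  have hpb : DiffForm.pullback (QuotientGroup.mk : H → H ⧸ G) β = α :=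
    DiffForm.ext_model hβ
  refine ⟨β, DiffForm.isSmooth_iff.2 fun p y hy => ?_, hpb, fun β' _ h => ?_⟩
  · obtain ⟨h, hh⟩ := QuotientGroup.mk_surjective ((extChartAt 𝓘(ℝ, F) p).symm y)
    have h2' := h2 h
    have h3' := h3 h
    rw [hh] at h2' h3'
    refine (DiffForm.contDiffAt_inChart_pullback hα' hy h2').congr_of_eventuallyEq ?_
    have h4 : ∀ᶠ x in nhds ((extChartAt 𝓘(ℝ, F) p).symm y),
        β x = DiffForm.pullback (E := F) (s h) α x := by
      filter_upwards [h3'.eventually_nhds, h2'.eventually_mdifferentiableAt] with x hx hx'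
      refine ContinuousAlternatingMap.ext fun v => ?_
      refine Eq.trans ?_ (hβ (s h x) fun i => modelDeriv F E (s h) x (v i))
      have key : ∀ a b : H ⧸ G, a = b → ∀ w w' : Fin (k + 1) → F, w = w' →
          (β a : F [⋀^Fin (k + 1)]→L[ℝ] ℝ) w = (β b : F [⋀^Fin (k + 1)]→L[ℝ] ℝ) w' := by
        rintro a _ rfl w _ rfl
        rfl
      exact key _ _ hx.self_of_nhds.symm _ _
        (funext fun i => (hG.modelDeriv_mk_section hx' hx (v i)).symm)
    filter_upwards [((contMDiffAt_extChartAt_symm p hy).continuousAt.tendsto).eventually h4]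
      with z hz
    exact congrArg (fun A : F [⋀^Fin (k + 1)]→L[ℝ] ℝ => A.compContinuousLinearMap
      (modelDeriv F F (extChartAt 𝓘(ℝ, F) p).symm z)) hz
  · exact hG.pullback_mk_injective (h.trans hpb.symm)

/-- Locally `a • p = j(a s(p))` for a smooth section `s` of `j`. -/
theorem IsHomogeneousManifold.contMDiffSMul (hG : IsHomogeneousManifold E F G) :
    ContMDiffSMul 𝓘(ℝ, E) 𝓘(ℝ, F) ∞ H (H ⧸ G) where
  contMDiff_smul := by
    rintro ⟨a, p⟩
    obtain ⟨h, rfl⟩ := QuotientGroup.mk_surjective p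
    obtain ⟨s, h1, h2, h3⟩ := hG.exists_section h
    have h4 : (fun x : H × H ⧸ G => x.1 • x.2) =ᶠ[nhds (a, (h : H ⧸ G))]
        fun x => (QuotientGroup.mk (x.1 * s x.2) : H ⧸ G) := by
      filter_upwards [(continuous_snd.tendsto (a, (h : H ⧸ G))).eventually h3] with x hx
      conv_lhs => rw [← hx]
      rfl
    refine ContMDiffAt.congr_of_eventuallyEq ?_ h4
    refine hG.contMDiff_mk.contMDiffAt.comp _ ?_
    exact contMDiffAt_fst.mul (h2.comp (a, (h : H ⧸ G)) contMDiffAt_snd)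

theorem IsHomogeneousManifold.pullback_smul (hG : IsHomogeneousManifold E F G) (a : H) {k : ℕ}
    {α : DiffForm E H k} {β : DiffForm F (H ⧸ G) k} (h : IsDescent G α β) :
    DiffForm.pullback (QuotientGroup.mk : H → H ⧸ G)
      (DiffForm.pullback (E := F) (fun p : H ⧸ G => a • p) β) =
      DiffForm.pullback (E := E) (fun k : H => a * k) α := by
  have := hG.contMDiffSMul
  have h1 : MDifferentiable 𝓘(ℝ, F) 𝓘(ℝ, F) (fun p : H ⧸ G => a • p) := by
    have h2 : ContMDiff 𝓘(ℝ, F) 𝓘(ℝ, F) ∞ (fun p : H ⧸ G => a • p) :=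
      (contMDiff_smul (I := 𝓘(ℝ, E)) (I' := 𝓘(ℝ, F)) (n := ∞) (G := H) (M := H ⧸ G)).comp
        (contMDiff_const.prodMk contMDiff_id)
    exact h2.mdifferentiable (by simp)
  rw [DiffForm.pullback_pullback β h1 hG.mdifferentiable_mk, ← h.pullback_eq,
    DiffForm.pullback_pullback β hG.mdifferentiable_mk (mdifferentiable_leftTranslation a)]
  rfl

/-- `j` is equivariant for left multiplication, so the fundamental fields upstairs and downstairs
are `j`-related. -/
theorem IsHomogeneousManifold.pullback_contract (hG : IsHomogeneousManifold E F G) (ξ : E) {k : ℕ}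
    {α : DiffForm E H (k + 1)} {β : DiffForm F (H ⧸ G) (k + 1)} (h : IsDescent G α β) :
    DiffForm.pullback (QuotientGroup.mk : H → H ⧸ G)
      (DiffForm.contract (fundamentalField (E := E) (H := H) (P := H ⧸ G) (F := F) ξ) β) =
      DiffForm.contract (fundamentalField (E := E) (H := H) (P := H) (F := E) ξ) α := by
  rw [← h.pullback_eq]
  refine (DiffForm.contract_pullback β fun k => ?_).symm
  have h1 := modelDeriv_comp (f := fun h : H => h * k) (one_mul k) (hG.mdifferentiable_mk k)
    (mdifferentiableAt_rightTranslation (E := E) k 1)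
  exact (congrArg (fun L : E →L[ℝ] F => L ξ) h1).symm

theorem IsHomogeneousManifold.pullback_d (hG : IsHomogeneousManifold E F G) {k : ℕ}
    {α : DiffForm E H k} {β : DiffForm F (H ⧸ G) k} (h : IsDescent G α β) :
    DiffForm.pullback (QuotientGroup.mk : H → H ⧸ G) β.d = α.d := by
  have := hG.isManifold
  have : IsManifold 𝓘(ℝ, E) ∞ H := (inferInstance : LieGroup 𝓘(ℝ, E) ∞ H).toIsManifold
  rw [← h.pullback_eq, DiffForm.d_pullback h.isSmooth hG.contMDiff_mk]

end Descent

/-! ### Manifold structure on the coset space from a local slice -/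

section LocalSlice

variable {E : Type*} [NormedAddCommGroup E] [NormedSpace ℝ E]
  {H : Type*} [TopologicalSpace H] [ChartedSpace E H] [Group H]
  {G : Subgroup H}
  {Q : Type*} [NormedAddCommGroup Q] [NormedSpace ℝ Q]
  {K : Type*} [NormedAddCommGroup K] [NormedSpace ℝ K]

variable (E G Q K) in
/-- A chart of `H` at `1`, with values in `E ≃ Q × K`, whose first component is a restriction of a
right `G`-invariant map `proj` separating the cosets of `G` near `1`. -/
structure LocalSlice where
  chart : OpenPartialHomeomorph H E
  equiv : E ≃L[ℝ] Q × K
  proj : H → Q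
  one_mem : 1 ∈ chart.source
  contMDiffOn_chart : ContMDiffOn 𝓘(ℝ, E) 𝓘(ℝ, E) ∞ chart chart.source
  contMDiffOn_symm : ContMDiffOn 𝓘(ℝ, E) 𝓘(ℝ, E) ∞ chart.symm chart.target
  proj_mul : ∀ h, ∀ g ∈ G, proj (h * g) = proj h
  proj_eq : ∀ h ∈ chart.source, proj h = (equiv (chart h)).1
  slice_mem : ∀ z ∈ chart.target, equiv.symm ((equiv z).1, 0) ∈ chart.target
  mem_of_proj_eq : ∀ h ∈ chart.source, ∀ h' ∈ chart.source, proj h = proj h' → h⁻¹ * h' ∈ G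

namespace LocalSlice

variable (S : LocalSlice E G Q K)

/-- The parametrization of the slice. -/
noncomputable def parametrization (x : Q) : H := S.chart.symm (S.equiv.symm (x, 0))

theorem proj_mul_out (a h : H) : S.proj (a * (h : H ⧸ G).out) = S.proj (a * h) := by
  obtain ⟨g, hg⟩ := QuotientGroup.mk_out_eq_mul G h
  rw [hg, ← mul_assoc, S.proj_mul _ _ g.2]

theorem parametrization_mem {x : Q} (hx : S.equiv.symm (x, 0) ∈ S.chart.target) :
    S.parametrization x ∈ S.chart.source := S.chart.map_target hx

theorem proj_parametrization {x : Q} (hx : S.equiv.symm (x, 0) ∈ S.chart.target) :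
    S.proj (S.parametrization x) = x := by
  rw [S.proj_eq _ (S.parametrization_mem hx), parametrization, S.chart.right_inv hx, S.equiv.apply_symm_apply]

variable [LieGroup 𝓘(ℝ, E) ∞ H]

/-- Right invariance spreads smoothness from the chart domain to its `G`-saturation. Representatives
occurring in changes of charts are known to lie only in the latter. -/
theorem contMDiffAt_proj_mul {a : H} {g : H} (hg : g ∈ G) (ha : a ∈ S.chart.source) :
    ContMDiffAt 𝓘(ℝ, E) 𝓘(ℝ, Q) ∞ S.proj (a * g) := by
  have h1 : ContMDiffAt 𝓘(ℝ, E) 𝓘(ℝ, Q) ∞ S.proj a := by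
    have h2 : ContDiff ℝ ∞ fun z : E => (S.equiv z).1 := by fun_prop
    have h3 := h2.contMDiff.contMDiffAt.comp a
      (S.contMDiffOn_chart.contMDiffAt (S.chart.open_source.mem_nhds ha))
    refine h3.congr_of_eventuallyEq ?_
    filter_upwards [S.chart.open_source.mem_nhds ha] with h hh
    exact S.proj_eq h hh
  have h2 : S.proj = S.proj ∘ fun h => h * g⁻¹ :=
    funext fun h => (S.proj_mul h _ (G.inv_mem hg)).symm
  rw [h2]
  have h3 : a = a * g * g⁻¹ := by group
  rw [h3] at h1
  exact h1.comp (a * g) (contMDiff_mul_right.contMDiffAt)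

/-- The chart of `H ⧸ G` around the coset of `a`. -/
noncomputable def quotientChart (a : H) : OpenPartialHomeomorph (H ⧸ G) Q where
  toFun p := S.proj (a⁻¹ * p.out)
  invFun x := (QuotientGroup.mk (a * S.parametrization x) : H ⧸ G)
  source := (QuotientGroup.mk : H → H ⧸ G) '' {h | a⁻¹ * h ∈ S.chart.source}
  target := {x | S.equiv.symm (x, 0) ∈ S.chart.target}
  map_source' := by
    rintro _ ⟨h, hh, rfl⟩
    rw [S.proj_mul_out, S.proj_eq _ hh]
    exact S.slice_mem _ (S.chart.map_source hh)
  map_target' x hx := ⟨a * S.parametrization x, by simpa using S.parametrization_mem hx, rfl⟩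
  left_inv' := by
    rintro _ ⟨h, hh, rfl⟩
    rw [S.proj_mul_out]
    have h1 : S.equiv.symm (S.proj (a⁻¹ * h), 0) ∈ S.chart.target := by
      rw [S.proj_eq _ hh]
      exact S.slice_mem _ (S.chart.map_source hh)
    refine QuotientGroup.eq.2 ?_
    have h2 := S.mem_of_proj_eq _ (S.parametrization_mem h1) _ hh (S.proj_parametrization h1)
    rw [← mul_assoc] at h2
    rwa [mul_inv_rev]
  right_inv' x hx := by
    rw [S.proj_mul_out, inv_mul_cancel_left, S.proj_parametrization hx]
  open_source := by
    have := topologicalGroup_of_lieGroup 𝓘(ℝ, E) ∞ (G := H)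
    exact QuotientGroup.isOpenMap_coe _
      (S.chart.open_source.preimage (continuous_const.mul continuous_id))
  open_target := by
    refine S.chart.open_target.preimage ?_
    fun_prop
  continuousOn_toFun := by
    have := topologicalGroup_of_lieGroup 𝓘(ℝ, E) ∞ (G := H)
    rintro _ ⟨h, hh, rfl⟩
    refine ContinuousAt.continuousWithinAt ?_
    -- The representative `p.out` is not continuous in `p`; continuity is tested on `H`, where
    -- invariance of `proj` removes the choice.
    rw [← QuotientGroup.isOpenQuotientMap_mk.continuousAt_comp_iff]
    have h1 : (fun p : H ⧸ G => S.proj (a⁻¹ * p.out)) ∘ (QuotientGroup.mk : H → H ⧸ G) =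
        S.proj ∘ fun k => a⁻¹ * k := funext fun k => S.proj_mul_out _ _
    rw [h1]
    have h2 := (S.contMDiffAt_proj_mul G.one_mem hh).continuousAt
    rw [mul_one] at h2
    exact ContinuousAt.comp (f := fun k => a⁻¹ * k) h2 (by fun_prop)
  continuousOn_invFun := by
    have := topologicalGroup_of_lieGroup 𝓘(ℝ, E) ∞ (G := H)
    have h1 : Continuous fun h : H => (QuotientGroup.mk (a * h) : H ⧸ G) :=
      QuotientGroup.continuous_mk.comp (continuous_const.mul continuous_id)
    have h2 : Continuous fun x : Q => S.equiv.symm (x, 0) := by fun_prop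
    exact h1.comp_continuousOn (S.chart.continuousOn_symm.comp h2.continuousOn fun x hx => hx)

theorem quotientChart_mk (a h : H) : S.quotientChart a (h : H ⧸ G) = S.proj (a⁻¹ * h) :=
  S.proj_mul_out _ _

theorem mem_quotientChart_source (a : H) {h : H} (hh : a⁻¹ * h ∈ S.chart.source) :
    (h : H ⧸ G) ∈ (S.quotientChart a).source := ⟨h, hh, rfl⟩

theorem mem_quotientChart_source_self (a : H) : (a : H ⧸ G) ∈ (S.quotientChart a).source :=
  S.mem_quotientChart_source a (by rw [inv_mul_cancel]; exact S.one_mem)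

/-- The charted space structure on the coset space defined by a local slice. -/
noncomputable abbrev chartedSpace : ChartedSpace Q (H ⧸ G) where
  atlas := Set.range S.quotientChart
  chartAt p := S.quotientChart p.out
  mem_chart_source p := by
    have h := S.mem_quotientChart_source_self p.out
    rwa [QuotientGroup.out_eq'] at h
  chart_mem_atlas p := ⟨_, rfl⟩

/-- A change of charts is `y ↦ proj(b⁻¹ a · slice(y))`, a composite of smooth maps. -/
theorem contDiffOn_quotientChart (a b : H) :
    ContDiffOn ℝ ∞ (S.quotientChart b ∘ (S.quotientChart a).symm)
      ((S.quotientChart a).symm ≫ₕ S.quotientChart b).source := by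
  rintro x ⟨hx, hx'⟩
  refine ContDiffAt.contDiffWithinAt (contMDiffAt_iff_contDiffAt.1 ?_)
  have h1 : S.quotientChart b ∘ (S.quotientChart a).symm =
      fun y => S.proj (b⁻¹ * (a * S.parametrization y)) := funext fun y => S.quotientChart_mk _ _
  rw [h1]
  obtain ⟨h, hh, e⟩ := hx'
  have h2 : h⁻¹ * (a * S.parametrization x) ∈ G := QuotientGroup.eq.1 e
  have h3 := S.contMDiffAt_proj_mul h2 hh
  have h4 : b⁻¹ * h * (h⁻¹ * (a * S.parametrization x)) = b⁻¹ * (a * S.parametrization x) := by group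
  rw [h4] at h3
  have h5 : ContMDiffAt 𝓘(ℝ, Q) 𝓘(ℝ, E) ∞ S.parametrization x := by
    have h6 : ContDiff ℝ ∞ fun y : Q => S.equiv.symm (y, 0) := by fun_prop
    exact (S.contMDiffOn_symm.contMDiffAt (S.chart.open_target.mem_nhds hx)).comp x
      h6.contMDiff.contMDiffAt
  exact h3.comp x (contMDiffAt_const.mul (contMDiffAt_const.mul h5))

theorem isManifold : @IsManifold ℝ _ Q _ _ Q _ 𝓘(ℝ, Q) ∞ (H ⧸ G) _ S.chartedSpace := by
  let := S.chartedSpace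
  refine isManifold_of_contDiffOn 𝓘(ℝ, Q) ∞ (H ⧸ G) ?_
  rintro _ _ ⟨a, rfl⟩ ⟨b, rfl⟩
  simpa using S.contDiffOn_quotientChart a b

/-- The left translates of the chart of a local slice. -/
noncomputable def translatedChart (a : H) : OpenPartialHomeomorph H E where
  toFun h := S.chart (a⁻¹ * h)
  invFun z := a * S.chart.symm z
  source := {h | a⁻¹ * h ∈ S.chart.source}
  target := S.chart.target
  map_source' h hh := S.chart.map_source hh
  map_target' z hz := by simpa using S.chart.map_target hz
  left_inv' h hh := by simp [S.chart.left_inv hh]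
  right_inv' z hz := by simp [S.chart.right_inv hz]
  open_source := S.chart.open_source.preimage
    (contMDiff_mul_left (I := 𝓘(ℝ, E)) (n := ∞) (a := a⁻¹)).continuous
  open_target := S.chart.open_target
  continuousOn_toFun := S.chart.continuousOn.comp
    (contMDiff_mul_left (I := 𝓘(ℝ, E)) (n := ∞) (a := a⁻¹)).continuous.continuousOn fun _ h => h
  continuousOn_invFun :=
    (contMDiff_mul_left (I := 𝓘(ℝ, E)) (n := ∞) (a := a)).continuous.comp_continuousOn
      S.chart.continuousOn_symm

theorem translatedChart_mem_maximalAtlas (a : H) :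
    S.translatedChart a ∈ IsManifold.maximalAtlas 𝓘(ℝ, E) ∞ H := by
  have : IsManifold 𝓘(ℝ, E) ∞ H := (inferInstance : LieGroup 𝓘(ℝ, E) ∞ H).toIsManifold
  refine OpenPartialHomeomorph.mem_maximalAtlas_of_contMDiffOn _ ?_ ?_
  · exact S.contMDiffOn_chart.comp (contMDiff_mul_left (a := a⁻¹)).contMDiffOn fun _ h => h
  · exact (contMDiff_mul_left (a := a)).comp_contMDiffOn S.contMDiffOn_symm

/-- In the translated chart at `a` and the quotient chart at its coset, `j` is the projection `Q × K
→ Q`. -/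
theorem isHomogeneousManifold [FiniteDimensional ℝ E] :
    letI := S.chartedSpace
    IsHomogeneousManifold E Q G := by
  let := S.chartedSpace
  have := S.isManifold
  have := topologicalGroup_of_lieGroup 𝓘(ℝ, E) ∞ (G := H)
  refine ⟨S.isManifold, Manifold.IsSubmersionOfComplement.isSubmersion (F := K) fun a => ?_⟩
  refine Manifold.IsSubmersionAtOfComplement.mk_of_charts S.equiv (S.translatedChart a)
    (S.quotientChart a) ?_ (S.mem_quotientChart_source_self a)
    (S.translatedChart_mem_maximalAtlas a)
    (IsManifold.subset_maximalAtlas ⟨a, rfl⟩)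
    (fun h hh => S.mem_quotientChart_source a hh) fun z hz => ?_
  · change a⁻¹ * a ∈ S.chart.source
    rw [inv_mul_cancel]
    exact S.one_mem
  · have h1 : z ∈ (S.translatedChart a).target := by simpa using hz
    have hz' : z ∈ S.chart.target := h1
    change S.quotientChart a ((a * S.chart.symm z : H) : H ⧸ G) = (S.equiv z).1
    rw [S.quotientChart_mk, inv_mul_cancel_left, S.proj_eq _ (S.chart.map_target hz'),
      S.chart.right_inv hz']

end LocalSlice

end LocalSlice

/-! ### Equivariance and closedness on the coset space -/

section Premoment

variable {E : Type*} [NormedAddCommGroup E] [NormedSpace ℝ E] [FiniteDimensional ℝ E]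
  {H : Type*} [TopologicalSpace H] [ChartedSpace E H] [Group H] [LieGroup 𝓘(ℝ, E) ∞ H]
  {σ : H ≃* H} {G : Subgroup H} {Λ : LinearMap.BilinForm ℝ (GroupLieAlgebra 𝓘(ℝ, E) H)}
  {F : Type*} [NormedAddCommGroup F] [NormedSpace ℝ F] [ChartedSpace F (H ⧸ G)]

theorem IsLegendrianForm.pullback_inv_mul_left_betaForm (hΛ : IsLegendrianForm σ Λ) (g : H)
    (ξ : E) : DiffForm.pullback (E := E) (fun h : H => g⁻¹ * h) (betaForm σ Λ ξ) =
      betaForm σ Λ (adjointRep E g ξ) := by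
  rw [hΛ.pullback_mul_left_betaForm, inv_inv]

theorem betaForm_add (ξ η : E) : betaForm σ Λ (ξ + η) = betaForm σ Λ ξ + betaForm σ Λ η := by
  refine DiffForm.ext_model fun h v => ?_
  refine (betaForm_apply _ h v).trans ?_
  rw [map_add]
  rfl

theorem betaForm_smul (c : ℝ) (ξ : E) : betaForm σ Λ (c • ξ) = c • betaForm σ Λ ξ := by
  refine DiffForm.ext_model fun h v => ?_
  refine (betaForm_apply _ h v).trans ?_
  rw [map_smul]
  rfl

/-- The forms `β(ξ)` descend to forms depending linearly on `ξ`. -/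
theorem IsHomogeneousManifold.exists_linearMap_isDescent (hG : IsHomogeneousManifold E F G)
    (hσ : IsSymmetricPair E σ G) (Λ : LinearMap.BilinForm ℝ (GroupLieAlgebra 𝓘(ℝ, E) H)) :
    ∃ τ : gPart E σ →ₗ[ℝ] DiffForm F (H ⧸ G) 1,
      ∀ ξ : gPart E σ, IsDescent G (betaForm σ Λ (ξ : GroupLieAlgebra 𝓘(ℝ, E) H)) (τ ξ) := by
  choose τ hτ using fun ξ : gPart E σ => (isRightBasic_betaForm (Λ := Λ) hσ
    (ξ : GroupLieAlgebra 𝓘(ℝ, E) H)).exists_isDescent (betaForm_isSmooth _) hσ hG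
  -- The descents are chosen separately for each `ξ`; injectivity of pullback forces the choice to
  -- be linear.
  refine ⟨{ toFun := τ, map_add' := fun ξ η => ?_, map_smul' := fun c ξ => ?_ }, hτ⟩
  · refine hG.pullback_mk_injective ((hτ (ξ + η)).pullback_eq.trans ?_)
    refine (betaForm_add (E := E) (Λ := Λ) (σ := σ) ξ.1 η.1).trans ?_
    rw [← (hτ ξ).pullback_eq, ← (hτ η).pullback_eq]
    rfl
  · refine hG.pullback_mk_injective ((hτ (c • ξ)).pullback_eq.trans ?_)
    refine (betaForm_smul (E := E) (Λ := Λ) (σ := σ) c ξ.1).trans ?_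
    rw [← (hτ ξ).pullback_eq]
    rfl

theorem IsHomogeneousManifold.isPremomentSpace (hG : IsHomogeneousManifold E F G)
    (hσ : IsSymmetricPair E σ G) (hΛ : IsLegendrianForm σ Λ) {Ξ : DiffForm F (H ⧸ G) 3}
    {τ : gPart E σ →ₗ[ℝ] DiffForm F (H ⧸ G) 1} (hΞ : IsDescent G (upsilonForm σ Λ) Ξ)
    (hτ : ∀ ξ : gPart E σ, IsDescent G (betaForm σ Λ (ξ : GroupLieAlgebra 𝓘(ℝ, E) H)) (τ ξ)) :
    IsPremomentSpace hσ Ξ τ where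
  isManifold := hG.isManifold
  smooth_action := hG.contMDiffSMul
  equivariant :=
    { smooth_inv := hΞ.isSmooth
      smooth_equiv := fun ξ => (hτ ξ).isSmooth
      invariant := fun g _ => hG.pullback_mk_injective <| by
        rw [hG.pullback_smul g hΞ, hΛ.pullback_mul_left_upsilonForm, hΞ.pullback_eq]
      equivariant := fun g hg ξ => hG.pullback_mk_injective <| by
        rw [hG.pullback_smul g⁻¹ (hτ ξ)]
        exact (hτ _).pullback_eq.trans (hΛ.pullback_inv_mul_left_betaForm g ξ.1).symm }
  closed :=
    { d_inv := hG.pullback_mk_injective <| by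
        rw [hG.pullback_d hΞ, hΛ.d_upsilonForm hσ]
        rfl
      contract_inv := fun ξ => hG.pullback_mk_injective <| by
        rw [hG.pullback_d (hτ ξ)]
        exact (hG.pullback_contract ξ.1 hΞ).trans (hΛ.contract_upsilonForm hσ ξ.1)
      contract_equiv := fun ξ => hG.pullback_mk_injective <|
        (hG.pullback_contract ξ.1 (hτ ξ)).trans (hΛ.contract_betaForm hσ ξ.2) }

end Premoment

/-! ### The inverse function theorem on a manifold -/

section InverseFunction

variable {E : Type*} [NormedAddCommGroup E] [NormedSpace ℝ E]
  {M : Type*} [TopologicalSpace M] [ChartedSpace E M]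
  {F : Type*} [NormedAddCommGroup F] [NormedSpace ℝ F]

theorem modelDeriv_add {f g : M → F} {p : M} (hf : MDifferentiableAt 𝓘(ℝ, E) 𝓘(ℝ, F) f p)
    (hg : MDifferentiableAt 𝓘(ℝ, E) 𝓘(ℝ, F) g p) :
    modelDeriv E F (fun x => f x + g x) p = modelDeriv E F f p + modelDeriv E F g p :=
  mfderiv_add hf hg

theorem modelDeriv_sub {f g : M → F} {p : M} (hf : MDifferentiableAt 𝓘(ℝ, E) 𝓘(ℝ, F) f p)
    (hg : MDifferentiableAt 𝓘(ℝ, E) 𝓘(ℝ, F) g p) :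
    modelDeriv E F (fun x => f x - g x) p = modelDeriv E F f p - modelDeriv E F g p :=
  mfderiv_sub hf hg

theorem modelDeriv_clm_comp {F' : Type*} [NormedAddCommGroup F'] [NormedSpace ℝ F'] (A : F →L[ℝ] F')
    {f : M → F} {p : M} (hf : MDifferentiableAt 𝓘(ℝ, E) 𝓘(ℝ, F) f p) :
    modelDeriv E F' (fun x => A (f x)) p = A.comp (modelDeriv E F f p) := by
  have h := modelDeriv_comp (f := f) rfl (A.mdifferentiableAt (x := f p)) hf
  rw [modelDeriv_eq_fderiv, A.fderiv] at h
  exact h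

theorem modelDeriv_const_smul (c : ℝ) {f : M → F} {p : M}
    (hf : MDifferentiableAt 𝓘(ℝ, E) 𝓘(ℝ, F) f p) :
    modelDeriv E F (fun x => c • f x) p = c • modelDeriv E F f p :=
  (modelDeriv_clm_comp (c • ContinuousLinearMap.id ℝ F) hf).trans (by ext; simp)

/-- The inverse function theorem for maps from a manifold to its model space. -/
theorem exists_openPartialHomeomorph_of_modelDeriv_eq_id [CompleteSpace E]
    [IsManifold 𝓘(ℝ, E) ∞ M] {κ : M → E} {x : M}
    (hκ : ∀ᶠ y in nhds x, ContMDiffAt 𝓘(ℝ, E) 𝓘(ℝ, E) ∞ κ y)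
    (hx : modelDeriv E E κ x = ContinuousLinearMap.id ℝ E) :
    ∃ Φ : OpenPartialHomeomorph M E, x ∈ Φ.source ∧ (∀ y ∈ Φ.source, Φ y = κ y) ∧
      ContMDiffOn 𝓘(ℝ, E) 𝓘(ℝ, E) ∞ Φ Φ.source ∧
      ContMDiffOn 𝓘(ℝ, E) 𝓘(ℝ, E) ∞ Φ.symm Φ.target := by
  set c := chartAt E x
  have hc : x ∈ c.source := mem_chart_source E x
  have hcs : ∀ z ∈ c.target, ContMDiffAt 𝓘(ℝ, E) 𝓘(ℝ, E) ∞ c.symm z := fun z hz =>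
    contMDiffOn_chart_symm.contMDiffAt (c.open_target.mem_nhds hz)
  let u : E → E := κ ∘ c.symm
  have e1 : ∀ᶠ z in nhds (c x), z ∈ c.target := c.open_target.mem_nhds (c.map_source hc)
  have e2 : ∀ᶠ z in nhds (c x), ContDiffAt ℝ ∞ u z := by
    have h1 := c.continuousAt_symm (c.map_source hc)
    rw [ContinuousAt, c.left_inv hc] at h1
    filter_upwards [h1.eventually hκ, e1] with z hz hz'
    exact (hz.comp z (hcs z hz')).contDiffAt
  have hu := e2.self_of_nhds
  have hu' : fderiv ℝ u (c x) = ContinuousLinearMap.id ℝ E := by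
    have h1 := modelDeriv_comp (f := c.symm) (p := c x) (c.left_inv hc)
      (hκ.self_of_nhds.mdifferentiableAt (by simp))
      ((hcs _ (c.map_source hc)).mdifferentiableAt (by simp))
    have h2 : modelDeriv E E c.symm (c x) = ContinuousLinearMap.id ℝ E :=
      modelDeriv_extChartAt_symm_self x
    rw [hx, h2] at h1
    rw [← modelDeriv_eq_fderiv]
    exact h1
  -- Invertibility of the derivative is an open condition. Restricting to `R`, where it holds, makes
  -- the inverse smooth on the whole target and not only at the image of `x`.
  have e3 : ∀ᶠ z in nhds (c x),
      fderiv ℝ u z ∈ Set.range ((↑) : (E ≃L[ℝ] E) → E →L[ℝ] E) := by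
    have h1 : ContinuousAt (fderiv ℝ u) (c x) :=
      (hu.fderiv_right (m := 0) (by simp)).continuousAt
    refine h1.eventually ?_
    rw [hu']
    exact (ContinuousLinearEquiv.refl ℝ E).nhds
  obtain ⟨R, hR, hRo, hxR⟩ := mem_nhds_iff.1 (e1.and (e2.and e3))
  have hd : HasFDerivAt u ((ContinuousLinearEquiv.refl ℝ E : E ≃L[ℝ] E) : E →L[ℝ] E) (c x) :=
    (hu.differentiableAt (by simp)).hasFDerivAt.congr_fderiv hu'
  let Ψ := (hu.toOpenPartialHomeomorph u hd (by simp)).restrOpen R hRo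
  have hΨR : ∀ z ∈ Ψ.source, z ∈ R := fun z hz => hz.2
  have hΨs : ∀ y ∈ Ψ.target, ContDiffAt ℝ ∞ Ψ.symm y := by
    intro y hy
    have h1 := hR (hΨR _ (Ψ.map_target hy))
    obtain ⟨e, he⟩ := h1.2.2
    refine Ψ.contDiffAt_symm (f₀' := e) hy ?_ h1.2.1
    exact (h1.2.1.differentiableAt (by simp)).hasFDerivAt.congr_fderiv he.symm
  have hxΨ : c x ∈ Ψ.source := ⟨hu.mem_toOpenPartialHomeomorph_source hd (by simp), hxR⟩
  refine ⟨c ≫ₕ Ψ, ⟨hc, hxΨ⟩, fun y hy => ?_, ?_, ?_⟩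
  · change κ (c.symm (c y)) = κ y
    rw [c.left_inv hy.1]
  · intro y hy
    refine ContMDiffAt.contMDiffWithinAt ?_
    have h1 : ContDiffAt ℝ ∞ u (c y) := (hR (hΨR _ hy.2)).2.1
    exact h1.contMDiffAt.comp y (contMDiffOn_chart.contMDiffAt (c.open_source.mem_nhds hy.1))
  · intro y hy
    refine ContMDiffAt.contMDiffWithinAt ?_
    exact (hcs (Ψ.symm y) hy.2).comp y (hΨs y hy.1).contMDiffAt

end InverseFunction

/-! ### An equivariant chart and the local slice of a symmetric pair -/

section SymmetricChart

variable {E : Type*} [NormedAddCommGroup E] [NormedSpace ℝ E] [FiniteDimensional ℝ E]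
  {H : Type*} [TopologicalSpace H] [ChartedSpace E H] [Group H]
  {σ : H ≃* H} {G : Subgroup H}

variable (E) in
/-- The odd part of the chart at `1`. -/
noncomputable def oddChart (h : H) : E :=
  (1 / 2 : ℝ) • (extChartAt 𝓘(ℝ, E) (1 : H) h - extChartAt 𝓘(ℝ, E) (1 : H) h⁻¹)

variable (E) in
/-- A map `H → 𝔥` with differential `id` at `1`, which is odd and intertwines `σ` with its
differential. -/
noncomputable def symmetricChart (σ : H ≃* H) (h : H) : E :=
  (1 / 2 : ℝ) • (oddChart E h + involutionDeriv E σ (oddChart E (σ h)))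

theorem oddChart_inv (h : H) : oddChart E h⁻¹ = -oddChart E h := by
  rw [oddChart, oddChart, inv_inv, ← smul_neg, neg_sub]

theorem symmetricChart_inv (h : H) : symmetricChart E σ h⁻¹ = -symmetricChart E σ h := by
  simp only [symmetricChart, map_inv, oddChart_inv, map_neg, ← neg_add, smul_neg]

theorem symmetricChart_one : symmetricChart E σ 1 = 0 := by
  simp [symmetricChart, oddChart]

variable [LieGroup 𝓘(ℝ, E) ∞ H]

theorem IsSymmetricPair.symmetricChart_map (hσ : IsSymmetricPair E σ G) (h : H) :
    symmetricChart E σ (σ h) = involutionDeriv E σ (symmetricChart E σ h) := by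
  rw [symmetricChart, symmetricChart, map_smul, map_add, hσ.involutionDeriv_involutionDeriv,
    hσ.involutive, add_comm]

theorem eventually_contMDiffAt_oddChart :
    ∀ᶠ h in nhds (1 : H), ContMDiffAt 𝓘(ℝ, E) 𝓘(ℝ, E) ∞ (oddChart E : H → E) h := by
  have := topologicalGroup_of_lieGroup 𝓘(ℝ, E) ∞ (G := H)
  have h1 : ∀ᶠ h in nhds (1 : H), h ∈ (chartAt E (1 : H)).source :=
    (chartAt E (1 : H)).open_source.mem_nhds (mem_chart_source E _)
  have h2 : Filter.Tendsto (fun h : H => h⁻¹) (nhds 1) (nhds 1) := by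
    have h3 := (continuous_inv (G := H)).tendsto 1
    rwa [inv_one] at h3
  filter_upwards [h1, h2.eventually h1] with h hh hh'
  have h3 : ContMDiffAt 𝓘(ℝ, E) 𝓘(ℝ, E) ∞ (fun k : H => extChartAt 𝓘(ℝ, E) (1 : H) k -
      extChartAt 𝓘(ℝ, E) (1 : H) k⁻¹) h :=
    (contMDiffAt_extChartAt' hh).sub
      ((contMDiffAt_extChartAt' hh').comp h (contMDiff_inv 𝓘(ℝ, E) ∞).contMDiffAt)
  exact ((1 / 2 : ℝ) • ContinuousLinearMap.id ℝ E).contMDiff.contMDiffAt.comp h h3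

/-- Inversion has differential `-1` at the identity, so the odd part has differential `½ (1 + 1)`.
-/
theorem modelDeriv_oddChart_one :
    modelDeriv E E (oddChart E : H → E) 1 = ContinuousLinearMap.id ℝ E := by
  have : IsManifold 𝓘(ℝ, E) ∞ H := (inferInstance : LieGroup 𝓘(ℝ, E) ∞ H).toIsManifold
  have h1 : ContMDiffAt 𝓘(ℝ, E) 𝓘(ℝ, E) ∞ (extChartAt 𝓘(ℝ, E) (1 : H)) 1 :=
    contMDiffAt_extChartAt
  have h1' := h1.mdifferentiableAt (by simp)
  have h2 : MDifferentiableAt 𝓘(ℝ, E) 𝓘(ℝ, E) (fun h : H => h⁻¹) 1 :=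
    (contMDiff_inv 𝓘(ℝ, E) ∞).mdifferentiableAt (by simp)
  have h3 := modelDeriv_comp (f := fun h : H => h⁻¹) inv_one h1' h2
  have h4 : MDifferentiableAt 𝓘(ℝ, E) 𝓘(ℝ, E)
      (fun h : H => extChartAt 𝓘(ℝ, E) (1 : H) h⁻¹) 1 := by
    have h9 : MDifferentiableAt 𝓘(ℝ, E) 𝓘(ℝ, E) (extChartAt 𝓘(ℝ, E) (1 : H)) (1 : H)⁻¹ := by
      rw [inv_one]
      exact h1'
    exact h9.comp 1 h2
  have h5 := modelDeriv_inv_of_eq_one (E := E) (p := (1 : H)) mdifferentiableAt_id rfl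
  have h6 := modelDeriv_const_smul (1 / 2 : ℝ) (h1'.sub h4)
  have h7 := modelDeriv_sub h1' h4
  have h8 : modelDeriv E E (fun h : H => extChartAt 𝓘(ℝ, E) (1 : H) h⁻¹) 1 =
      -ContinuousLinearMap.id ℝ E := by
    refine h3.trans ?_
    rw [modelDeriv_extChartAt_self]
    refine (ContinuousLinearMap.id_comp _).trans (h5.trans ?_)
    exact congrArg Neg.neg (modelDeriv_id (1 : H))
  refine h6.trans ?_
  refine (congrArg ((1 / 2 : ℝ) • ·) h7).trans ?_
  rw [h8, modelDeriv_extChartAt_self]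
  module

theorem IsSymmetricPair.eventually_contMDiffAt_symmetricChart (hσ : IsSymmetricPair E σ G) :
    ∀ᶠ h in nhds (1 : H), ContMDiffAt 𝓘(ℝ, E) 𝓘(ℝ, E) ∞ (symmetricChart E σ) h := by
  have h1 := eventually_contMDiffAt_oddChart (E := E) (H := H)
  have h2 : Filter.Tendsto σ (nhds (1 : H)) (nhds 1) := by
    have h3 := hσ.smooth.continuous.tendsto 1
    rwa [map_one] at h3
  filter_upwards [h1, h2.eventually h1] with h hh hh'
  have h3 : ContMDiffAt 𝓘(ℝ, E) 𝓘(ℝ, E) ∞ (fun k : H => oddChart E k +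
      involutionDeriv E σ (oddChart E (σ k))) h :=
    hh.add ((involutionDeriv E σ).contMDiff.contMDiffAt.comp h
      (hh'.comp h hσ.smooth.contMDiffAt))
  exact ((1 / 2 : ℝ) • ContinuousLinearMap.id ℝ E).contMDiff.contMDiffAt.comp h h3

/-- The averaged differential is `½ (1 + s s)`, and `s s = 1`. -/
theorem IsSymmetricPair.modelDeriv_symmetricChart_one (hσ : IsSymmetricPair E σ G) :
    modelDeriv E E (symmetricChart E σ) (1 : H) = ContinuousLinearMap.id ℝ E := by
  have h1 := (eventually_contMDiffAt_oddChart (E := E) (H := H)).self_of_nhds.mdifferentiableAt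
    (by simp)
  have h2 := hσ.mdifferentiableAt 1
  have h3 := modelDeriv_comp (map_one σ) h1 h2
  have h4 : MDifferentiableAt 𝓘(ℝ, E) 𝓘(ℝ, E) (fun h : H => oddChart E (σ h)) 1 := by
    rw [← map_one σ] at h1
    exact h1.comp 1 h2
  have h5 : MDifferentiableAt 𝓘(ℝ, E) 𝓘(ℝ, E)
      (fun h : H => involutionDeriv E σ (oddChart E (σ h))) 1 :=
    ((involutionDeriv E σ).mdifferentiableAt).comp 1 h4
  refine (modelDeriv_const_smul (1 / 2 : ℝ) (h1.add h5)).trans ?_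
  refine (congrArg ((1 / 2 : ℝ) • ·) (modelDeriv_add h1 h5)).trans ?_
  rw [modelDeriv_clm_comp _ h4]
  have h6 : modelDeriv E E (fun h : H => oddChart E (σ h)) 1 = involutionDeriv E σ := by
    refine h3.trans ?_
    rw [modelDeriv_oddChart_one]
    rfl
  rw [h6, modelDeriv_oddChart_one]
  ext x
  simp [hσ.involutionDeriv_involutionDeriv]
  module

/-- The map `h ↦ ½ φ(h σ(h)⁻¹)` for `φ` the symmetric chart; it is invariant under `G` from the right
and has values in `𝔭`. -/
noncomputable def cosetMap (E : Type*) [NormedAddCommGroup E] [NormedSpace ℝ E] {H : Type*}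
    [TopologicalSpace H] [ChartedSpace E H] [Group H] (σ : H ≃* H) (h : H) : E :=
  (1 / 2 : ℝ) • symmetricChart E σ (symmetrization σ h)

theorem IsSymmetricPair.map_symmetrization (hσ : IsSymmetricPair E σ G) (h : H) :
    σ (symmetrization σ h) = (symmetrization σ h)⁻¹ := by
  simp [symmetrization, hσ.involutive]

/-- `σ` inverts `h σ(h)⁻¹`, and the symmetric chart turns `σ` into `s` and inversion into a sign, so
the value lies in `𝔭`. -/
theorem IsSymmetricPair.pProj_cosetMap (hσ : IsSymmetricPair E σ G) (h : H) :
    pProj E σ (cosetMap E σ h) = cosetMap E σ h := by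
  have h1 : involutionDeriv E σ (cosetMap E σ h) = -cosetMap E σ h := by
    rw [cosetMap, map_smul, ← hσ.symmetricChart_map, hσ.map_symmetrization, symmetricChart_inv,
      smul_neg]
  rw [pProj_apply, h1]
  module

theorem IsSymmetricPair.cosetMap_mul_right (hσ : IsSymmetricPair E σ G) (h : H) {g : H}
    (hg : g ∈ G) : cosetMap E σ (h * g) = cosetMap E σ h := by
  rw [cosetMap, cosetMap, hσ.symmetrization_mul_right h hg]

theorem IsSymmetricPair.tendsto_symmetrization (hσ : IsSymmetricPair E σ G) :
    Filter.Tendsto (symmetrization σ) (nhds (1 : H)) (nhds 1) := by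
  have h := hσ.contMDiff_symmetrization.continuous.tendsto 1
  rwa [symmetrization_one] at h

theorem IsSymmetricPair.eventually_contMDiffAt_cosetMap (hσ : IsSymmetricPair E σ G) :
    ∀ᶠ h in nhds (1 : H), ContMDiffAt 𝓘(ℝ, E) 𝓘(ℝ, E) ∞ (cosetMap E σ) h := by
  filter_upwards [hσ.tendsto_symmetrization.eventually hσ.eventually_contMDiffAt_symmetricChart]
    with h hh
  exact ((1 / 2 : ℝ) • ContinuousLinearMap.id ℝ E).contMDiff.contMDiffAt.comp h
    (hh.comp h hσ.contMDiff_symmetrization.contMDiffAt)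

theorem IsSymmetricPair.modelDeriv_cosetMap_one (hσ : IsSymmetricPair E σ G) :
    modelDeriv E E (cosetMap E σ) (1 : H) = pProj E σ := by
  have h1 := hσ.eventually_contMDiffAt_symmetricChart.self_of_nhds.mdifferentiableAt
    (by simp)
  have h2 : MDifferentiableAt 𝓘(ℝ, E) 𝓘(ℝ, E) (symmetrization σ) (1 : H) :=
    hσ.contMDiff_symmetrization.mdifferentiableAt (by simp)
  have h3 := modelDeriv_comp symmetrization_one h1 h2
  have h4 : MDifferentiableAt 𝓘(ℝ, E) 𝓘(ℝ, E)
      (fun h : H => symmetricChart E σ (symmetrization σ h)) 1 := by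
    rw [← symmetrization_one (σ := σ)] at h1
    exact h1.comp 1 h2
  refine (modelDeriv_const_smul (1 / 2 : ℝ) h4).trans ?_
  refine (congrArg ((1 / 2 : ℝ) • ·) h3).trans ?_
  rw [hσ.modelDeriv_symmetricChart_one]
  ext x
  simp [hσ.modelDeriv_symmetrization_one]

theorem IsSymmetricPair.exists_openPartialHomeomorph_symmetricChart (hσ : IsSymmetricPair E σ G) :
    ∃ Φ : OpenPartialHomeomorph H E, 1 ∈ Φ.source ∧ ∀ y ∈ Φ.source, Φ y = symmetricChart E σ y := by
  have : IsManifold 𝓘(ℝ, E) ∞ H := (inferInstance : LieGroup 𝓘(ℝ, E) ∞ H).toIsManifold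
  have : CompleteSpace E := FiniteDimensional.complete ℝ E
  obtain ⟨Φ, h1, h2, -⟩ := exists_openPartialHomeomorph_of_modelDeriv_eq_id
    hσ.eventually_contMDiffAt_symmetricChart hσ.modelDeriv_symmetricChart_one
  exact ⟨Φ, h1, h2⟩

/-- Near `1`, the fixed points of `σ` lie in `G`. -/
theorem IsSymmetricPair.eventually_mem_of_fixed (hσ : IsSymmetricPair E σ G) :
    ∀ᶠ h in nhds (1 : H), σ h = h → h ∈ G := by
  obtain ⟨Φ, h1, h2⟩ := hσ.exists_openPartialHomeomorph_symmetricChart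
  have hΦ1 : Φ 1 = 0 := by rw [h2 _ h1, symmetricChart_one]
  have h0 : (0 : E) ∈ Φ.target := hΦ1 ▸ Φ.map_source h1
  have h3 : Filter.Tendsto (fun y => σ (Φ.symm y)) (nhds 0) (nhds 1) := by
    have h4 := Φ.continuousAt_symm h0
    have h5 : Φ.symm 0 = 1 := by rw [← hΦ1, Φ.left_inv h1]
    have h6 := hσ.smooth.continuous.continuousAt.comp h4
    rw [ContinuousAt, Function.comp_apply, h5, map_one] at h6
    exact h6
  obtain ⟨r, hr, hB⟩ := Metric.eventually_nhds_iff_ball.1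
    ((Φ.open_target.eventually_mem h0).and (h3.eventually (Φ.open_source.eventually_mem h1)))
  -- In the symmetric chart `σ` is linear, so its fixed points near `1` correspond to a ball in `𝔤`.
  -- This is convex, hence its image lies in the component of `1` in `H^σ`.
  set C : Set E := Metric.ball 0 r ∩ {y | involutionDeriv E σ y = y} with hC
  have hCc : IsPreconnected C := by
    refine ((convex_ball (0 : E) r).inter ?_).isPreconnected
    exact ((involutionDeriv E σ).toLinearMap.eqLocus LinearMap.id).convex
  have hfix : Φ.symm '' C ⊆ {h : H | σ h = h} := by
    rintro _ ⟨y, ⟨hy, hy'⟩, rfl⟩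
    obtain ⟨h4, h5⟩ := hB y hy
    refine Φ.injOn h5 (Φ.map_target h4) ?_
    rw [h2 _ h5, hσ.symmetricChart_map, ← h2 _ (Φ.map_target h4), Φ.right_inv h4]
    exact hy'
  have hsub : Φ.symm '' C ⊆ G := by
    refine subset_trans ?_ hσ.component_le
    refine (hCc.image _ (Φ.continuousOn_symm.mono fun y hy => (hB y hy.1).1)).subset_connectedComponentIn
      ⟨0, ⟨Metric.mem_ball_self hr, map_zero _⟩, ?_⟩ hfix
    rw [← hΦ1, Φ.left_inv h1]
  have h4 : ∀ᶠ h in nhds (1 : H), Φ h ∈ Metric.ball (0 : E) r := by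
    have h5 := Φ.continuousAt h1
    rw [ContinuousAt, hΦ1] at h5
    exact h5.eventually (Metric.ball_mem_nhds 0 hr)
  filter_upwards [h4, Φ.open_source.eventually_mem h1] with h hh hh' hf
  refine hsub ⟨Φ h, ⟨hh, ?_⟩, Φ.left_inv hh'⟩
  change involutionDeriv E σ (Φ h) = Φ h
  rw [h2 _ hh', ← hσ.symmetricChart_map, hf]

theorem IsSymmetricPair.pProj_pProj (hσ : IsSymmetricPair E σ G) (x : E) :
    pProj E σ (pProj E σ x) = pProj E σ x := by
  rw [pProj_apply (x := pProj E σ x), hσ.involutionDeriv_pProj]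
  module

/-- The local slice of a symmetric pair, for a splitting of `𝔥` compatible with the projection
to `𝔭`. -/
theorem IsSymmetricPair.nonempty_localSlice (hσ : IsSymmetricPair E σ G)
    {Q : Type*} [NormedAddCommGroup Q] [NormedSpace ℝ Q]
    {K : Type*} [NormedAddCommGroup K] [NormedSpace ℝ K] (e : E ≃L[ℝ] Q × K)
    (he : ∀ z, e.symm ((e z).1, 0) = pProj E σ z) : Nonempty (LocalSlice E G Q K) := by
  have := topologicalGroup_of_lieGroup 𝓘(ℝ, E) ∞ (G := H)
  have : IsManifold 𝓘(ℝ, E) ∞ H := (inferInstance : LieGroup 𝓘(ℝ, E) ∞ H).toIsManifold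
  have : CompleteSpace E := FiniteDimensional.complete ℝ E
  obtain ⟨Φ, hΦ1, hΦ⟩ := hσ.exists_openPartialHomeomorph_symmetricChart
  -- The coset map supplies the `𝔭`-coordinate and the symmetric chart the `𝔤`-coordinate; the
  -- differentials at `1` are the two projections, with sum the identity.
  let κ : H → E := fun h => cosetMap E σ h + gProj E σ (symmetricChart E σ h)
  have hκs : ∀ᶠ h in nhds (1 : H), ContMDiffAt 𝓘(ℝ, E) 𝓘(ℝ, E) ∞ κ h := by
    filter_upwards [hσ.eventually_contMDiffAt_cosetMap, hσ.eventually_contMDiffAt_symmetricChart]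
      with h h1 h2
    exact h1.add ((gProj E σ).contMDiff.contMDiffAt.comp h h2)
  have hκd : modelDeriv E E κ 1 = ContinuousLinearMap.id ℝ E := by
    have h1 := hσ.eventually_contMDiffAt_cosetMap.self_of_nhds.mdifferentiableAt (by simp)
    have h2 := hσ.eventually_contMDiffAt_symmetricChart.self_of_nhds.mdifferentiableAt (by simp)
    have h3 : MDifferentiableAt 𝓘(ℝ, E) 𝓘(ℝ, E)
        (fun h : H => gProj E σ (symmetricChart E σ h)) 1 :=
      ((gProj E σ).mdifferentiableAt).comp 1 h2
    refine (modelDeriv_add h1 h3).trans ?_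
    rw [modelDeriv_clm_comp _ h2, hσ.modelDeriv_cosetMap_one, hσ.modelDeriv_symmetricChart_one]
    ext x
    simp [add_comm, gProj_add_pProj]
  obtain ⟨Ψ, hΨ1, hΨ, hΨs, hΨs'⟩ := exists_openPartialHomeomorph_of_modelDeriv_eq_id hκs hκd
  have hκ1 : Ψ 1 = 0 := by
    rw [hΨ _ hΨ1]
    simp [κ, cosetMap, symmetrization_one, symmetricChart_one]
  have hpκ : ∀ h ∈ Ψ.source, pProj E σ (Ψ h) = cosetMap E σ h := fun h hh => by
    rw [hΨ h hh]
    simp only [κ, map_add, hσ.pProj_cosetMap]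
    rw [pProj_apply, hσ.involutionDeriv_gProj, sub_self, smul_zero, add_zero]
  have heg : ∀ z w, pProj E σ z = pProj E σ w → (e z).1 = (e w).1 := fun z w h => by
    rw [← he, ← he] at h
    have h1 : ((e z).1, (0 : K)) = ((e w).1, 0) := e.symm.injective h
    exact (Prod.mk.inj h1).1
  -- `V` is to contain `h⁻¹` and `h'⁻¹`, whose quotient is `h⁻¹ h'`; this keeps `h⁻¹ h'` close
  -- enough to `1` for fixed points to lie in `G`.
  obtain ⟨V, hV, hVG⟩ := exists_nhds_split_inv hσ.eventually_mem_of_fixed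
  have hN : ∀ᶠ h in nhds (1 : H), h⁻¹ ∈ V ∧ symmetrization σ h ∈ Φ.source := by
    refine Filter.Eventually.and ?_
      (hσ.tendsto_symmetrization.eventually (Φ.open_source.eventually_mem hΦ1))
    have h1 := (continuous_inv (G := H)).tendsto 1
    rw [inv_one] at h1
    exact h1.eventually hV
  obtain ⟨N, hN, hNo, h1N⟩ := mem_nhds_iff.1 hN
  set A : Set E := Ψ.target ∩ Ψ.symm ⁻¹' N with hA
  have hAo : IsOpen A := Ψ.symm.isOpen_inter_preimage hNo
  have h0A : (0 : E) ∈ A := by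
    rw [← hκ1]
    exact ⟨Ψ.map_source hΨ1, by rwa [Set.mem_preimage, Ψ.left_inv hΨ1]⟩
  -- Intersecting with the preimage makes the chart image stable under projection to `𝔭`, as
  -- `slice_mem` demands.
  set B : Set E := A ∩ pProj E σ ⁻¹' A with hB
  have hBo : IsOpen B := hAo.inter (hAo.preimage (pProj E σ).continuous)
  have hpB : ∀ z ∈ B, pProj E σ z ∈ B := fun z hz => by
    refine ⟨hz.2, ?_⟩
    rw [Set.mem_preimage, hσ.pProj_pProj]
    exact hz.2
  have hBN : ∀ h ∈ Ψ.source, Ψ h ∈ B → h ∈ N := fun h hh hB => by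
    have h1 : Ψ.symm (Ψ h) ∈ N := hB.1.2
    rwa [Ψ.left_inv hh] at h1
  refine ⟨{
    -- Passing through the inverse restricts `Ψ` on its target, where `B` lives.
    chart := (Ψ.symm.restrOpen B hBo).symm
    equiv := e
    proj := fun h => (e (cosetMap E σ h)).1
    one_mem := ⟨hΨ1, ?_⟩
    contMDiffOn_chart := hΨs.mono fun h hh => hh.1
    contMDiffOn_symm := hΨs'.mono fun z hz => hz.1
    proj_mul := fun h g hg => by rw [hσ.cosetMap_mul_right h hg]
    proj_eq := fun h hh => heg _ _ ?_
    slice_mem := fun z hz => ?_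
    mem_of_proj_eq := fun h hh h' hh' heq => ?_ }⟩
  · change Ψ 1 ∈ B
    rw [hκ1]
    exact ⟨h0A, by rwa [Set.mem_preimage, map_zero]⟩
  · change _ = pProj E σ (Ψ h)
    rw [hpκ h hh.1, hσ.pProj_cosetMap]
  · rw [he]
    have h1 := hpB z hz.2
    exact ⟨h1.1.1, h1⟩
  · have h1 : cosetMap E σ h = cosetMap E σ h' := by
      rw [← hσ.pProj_cosetMap h, ← hσ.pProj_cosetMap h', ← he, ← he, heq]
    have h2 := hN (hBN h hh.1 hh.2)
    have h3 := hN (hBN h' hh'.1 hh'.2)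
    have h4 : symmetrization σ h = symmetrization σ h' := by
      refine Φ.injOn h2.2 h3.2 ?_
      rw [hΦ _ h2.2, hΦ _ h3.2]
      exact smul_right_injective E (by norm_num : (1 / 2 : ℝ) ≠ 0) h1
    have h5 := hVG _ h2.1 _ h3.1
    rw [div_inv_eq_mul] at h5
    exact h5 (map_inv_mul_of_symmetrization_eq h4)

/-- The splitting `𝔥 = 𝔭 ⊕ 𝔤` in coordinates on `𝔭`. -/
theorem IsSymmetricPair.exists_splitting (hσ : IsSymmetricPair E σ G) :
    ∃ e : E ≃L[ℝ] EuclideanSpace ℝ (Fin (Module.finrank ℝ (pPart E σ))) ×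
      LinearMap.ker (pProj E σ).toLinearMap, ∀ z, e.symm ((e z).1, 0) = pProj E σ z := by
  let p : Submodule ℝ E := pPart E σ
  let k : Submodule ℝ E := LinearMap.ker (pProj E σ).toLinearMap
  have hp : ∀ x ∈ p, pProj E σ x = x := fun x hx => by
    rw [pProj_apply, mem_pPart_iff.1 hx]
    module
  have hp' : ∀ x, pProj E σ x ∈ p := fun x => mem_pPart_iff.2 (hσ.involutionDeriv_pProj x)
  have hk : ∀ x, gProj E σ x ∈ k := fun x => by
    change pProj E σ (gProj E σ x) = 0
    rw [pProj_apply, hσ.involutionDeriv_gProj, sub_self, smul_zero]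
  have hkg : ∀ x ∈ k, gProj E σ x = x := fun x hx => by
    have h1 := gProj_add_pProj σ x
    rwa [show pProj E σ x = 0 from hx, add_zero] at h1
  -- Any linear isomorphism serves: only the dimension of the `𝔭`-factor matters for the model
  -- space.
  let ε : p ≃ₗ[ℝ] EuclideanSpace ℝ (Fin (Module.finrank ℝ (pPart E σ))) :=
    LinearEquiv.ofFinrankEq _ _ (by rw [finrank_euclideanSpace_fin]; rfl)
  let e : E ≃ₗ[ℝ] EuclideanSpace ℝ (Fin (Module.finrank ℝ (pPart E σ))) × k :=
    LinearEquiv.ofLinearMap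
      ((ε.toLinearMap ∘ₗ (pProj E σ).toLinearMap.codRestrict p hp').prod
        ((gProj E σ).toLinearMap.codRestrict k hk))
      ((p.subtype ∘ₗ ε.symm.toLinearMap).coprod k.subtype)
      (by
        refine LinearMap.ext fun x => ?_
        obtain ⟨x, y⟩ := x
        have h1 : pProj E σ ((ε.symm x : p) + (y : E)) = (ε.symm x : p) := by
          rw [map_add, hp _ (ε.symm x).2, show pProj E σ (y : E) = 0 from y.2, add_zero]
        have h2 : gProj E σ ((ε.symm x : p) + (y : E)) = y := by
          have h3 := gProj_add_pProj σ (((ε.symm x : p) : E) + (y : E))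
          rw [h1, add_comm ((ε.symm x : p) : E)] at h3
          rw [add_comm ((ε.symm x : p) : E)]
          exact add_right_cancel h3
        refine Prod.ext ?_ (Subtype.ext h2)
        have h4 : ε ⟨pProj E σ ((ε.symm x : p) + (y : E)), hp' _⟩ = ε (ε.symm x) :=
          congrArg ε (Subtype.ext h1)
        exact h4.trans (ε.apply_symm_apply x))
      (by
        refine LinearMap.ext fun x => ?_
        simp [add_comm, gProj_add_pProj])
  refine ⟨e.toContinuousLinearEquiv, fun z => ?_⟩
  change ((ε.symm (ε ⟨pProj E σ z, hp' z⟩) : p) : E) + ((0 : k) : E) = _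
  simp

theorem IsSymmetricPair.exists_isHomogeneousManifold (hσ : IsSymmetricPair E σ G) :
    ∃ _ : ChartedSpace (EuclideanSpace ℝ (Fin (Module.finrank ℝ (pPart E σ)))) (H ⧸ G),
      IsHomogeneousManifold E (EuclideanSpace ℝ (Fin (Module.finrank ℝ (pPart E σ)))) G := by
  obtain ⟨e, he⟩ := hσ.exists_splitting
  obtain ⟨S⟩ := hσ.nonempty_localSlice e he
  exact ⟨S.chartedSpace, S.isHomogeneousManifold⟩

end SymmetricChart

/-! ### The theorem -/

theorem mainTheorem1
    {E : Type*} [NormedAddCommGroup E] [NormedSpace ℝ E] [FiniteDimensional ℝ E]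
    {H : Type*} [TopologicalSpace H] [ChartedSpace E H] [Group H] [LieGroup 𝓘(ℝ, E) ∞ H]
    (σ : H ≃* H) (G : Subgroup H) (hσ : IsSymmetricPair E σ G)
    (Λ : LinearMap.BilinForm ℝ (GroupLieAlgebra 𝓘(ℝ, E) H)) (hΛ : IsLegendrianForm σ Λ) :
    -- the coset space is a smooth manifold of dimension `dim 𝔭`
    (∃ _ : ChartedSpace (EuclideanSpace ℝ (Fin (Module.finrank ℝ (pPart E σ)))) (H ⧸ G),
      IsHomogeneousManifold E (EuclideanSpace ℝ (Fin (Module.finrank ℝ (pPart E σ)))) G) ∧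
    -- the forms `β(ξ)` and `Υ` on `H` are smooth, right `G`-basic and left `G`-equivariant
    (∀ ξ ∈ gPart E σ, (betaForm σ Λ ξ).IsSmooth ∧ IsRightBasic σ G (betaForm σ Λ ξ) ∧
      ∀ g ∈ G, betaForm σ Λ (Ad g ξ) =
        DiffForm.pullback (fun h : H => g⁻¹ * h) (betaForm σ Λ ξ)) ∧
    ((upsilonForm σ Λ).IsSmooth ∧ IsRightBasic σ G (upsilonForm σ Λ) ∧
      ∀ g ∈ G, DiffForm.pullback (fun h : H => g * h) (upsilonForm σ Λ) = upsilonForm σ Λ) ∧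
    -- they descend to `P = H ⧸ G`, and `Ξ + τ` makes `P` a premoment space for `G`
    ∀ (F : Type*) [NormedAddCommGroup F] [NormedSpace ℝ F] [FiniteDimensional ℝ F]
      [ChartedSpace F (H ⧸ G)], IsHomogeneousManifold E F G →
      ∃ (Ξ : DiffForm F (H ⧸ G) 3) (τ : gPart E σ →ₗ[ℝ] DiffForm F (H ⧸ G) 1),
        IsDescent G (upsilonForm σ Λ) Ξ ∧
        (∀ ξ : gPart E σ, IsDescent G (betaForm σ Λ (ξ : GroupLieAlgebra 𝓘(ℝ, E) H)) (τ ξ)) ∧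
        IsPremomentSpace hσ Ξ τ := by
  refine ⟨hσ.exists_isHomogeneousManifold, fun ξ _ => ⟨betaForm_isSmooth (E := E) ξ,
    isRightBasic_betaForm (E := E) hσ ξ, fun g _ => ?_⟩, ⟨upsilonForm_isSmooth,
    hΛ.isRightBasic_upsilonForm hσ, fun g _ => hΛ.pullback_mul_left_upsilonForm g⟩, ?_⟩
  · exact (hΛ.pullback_inv_mul_left_betaForm (E := E) g ξ).symm
  intro F _ _ _ _ hG
  obtain ⟨Ξ, hΞ⟩ := (hΛ.isRightBasic_upsilonForm hσ).exists_isDescent upsilonForm_isSmooth hσ hG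
  obtain ⟨τ, hτ⟩ := hG.exists_linearMap_isDescent hσ Λ
  exact ⟨Ξ, τ, hΞ, hτ, hG.isPremomentSpace hσ hΛ hΞ hτ⟩
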